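/- **Setting.** A frame of $N$ slots is shared by $K$ users, each independently active with probability $\mu\in(0,1]$. There are $M$ messages. Message $m$ has a random codeword consisting of a unit pilot symbol followed by $n_0$ i.i.d. Bernoulli($\nu$) bits with $\nu=1/2$, and a random set of $L$ slots, chosen uniformly without replacement, in which the replicas of the codeword are placed; here $L\ge 1$ has the distribution $\Pr[L=\ell]=\Lambda_\ell$ with generating polynomial $\Lambda(x)=\sum_\ell\Lambda_\ell x^\ell$, and all the choices are independent over messages. Every message contains the signature of one user, and each active user selects a message uniformly among those with its own signature, so that different users send different messages. In every slot the receiver observes the noiseless integer sum of the transmitted codewords (binary adder channel). *Per-slot decoder.* In a slot with $k>0$ colliding codewords ($k$ is read off from the pilot), start from the list of all codewords assigned to this slot; at each position where the sum is $k$ (resp. $0$) discard all codewords with entry $0$ (resp. $1$). The slot is resolved if exactly $k$ codewords survive. The frame decoder runs this decoder in all slots, removes all replicas of the codewords found in the resolved slots, and repeats until no slot can be resolved. $\pi_U$ is the probability that a slot in which $U\ge1$ codewords collide is resolved by the per-slot decoder (the other $M-U$ messages being assigned to slots at random as above); the packet loss rate is the expected fraction of transmitted messages that are not decoded. *Asymptotic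 regime.* For $G>0$, $D>0$, $\beta\ge1$, $\delta\in(0,1)$, the $(G,D,\beta,\delta)$-asymptotic regime means: $K\to\infty$ with $\mu$ and $\Lambda$ fixed, $\mu K/N=G$, $M=DK^{1/\delta}$ and $n_0=\beta\log_2M$ (with $N,M,n_0$ rounded to integers). The decoding threshold $G^*(\Lambda)$ is the supremum of the loads $G>0$ such that the packet loss rate tends to $0$ in the $(G',D,\beta,\delta)$-asymptotic regime for all $G'\in(0,G]$. **Theorem.** For every $U\ge1$, in the $(G,D,\beta,\delta)$-asymptotic regime the limit of $\pi_U$ exists and $$\lim \pi_U\ \ge\ \bar\pi_U=\begin{cases}0,&U>-\log_2\big(1-2^{-(1-\delta)/\beta}\big),\\[2pt] \exp\!\big(-\mu^{-1}DG\Lambda'(1)\,(1-2^{-U})^{\beta\log_2D}\big),&U=-\log_2\big(1-2^{-(1-\delta)/\beta}\big),\\[2pt] 1,&U<-\log_2\big(1-2^{-(1-\delta)/\beta}\big).\end{cases}$$ Let $\bar T=\big\lfloor-\log_2\big(1-2^{-(1-\delta)/\beta}\big)\big\rfloor$ and $\lambda(x)=\Lambda'(x)/\Lambda'(1)$. Then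 $\bar T$ is a lower bound on the maximum number of resolvable users in a slot: $\lim\pi_U>0$ for all $1\le U\le\bar T$. Furthermore, $G^*(\Lambda)$ is at least the supremum of all $G>0$ such that $$p>\lambda\bigg(1-e^{-G\Lambda'(1)p}\sum_{u=0}^{\bar T-1}\frac{\bar\pi_{u+1}}{u!}\,\big(pG\Lambda'(1)\big)^u\bigg)\qquad\text{for all }p\in(0,1].$$ -/

import Mathlib

open Filter Topology
open scoped ENNReal

namespace IRSA

noncomputable section

/-! ### Codewords, the adder channel and the per-slot decoder -/

/-- A codeword of length `n + 1` (a unit pilot followed by `n` random bits), together with the set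
of those slots, among the `N` slots of a frame, in which its replicas are placed. -/
abbrev Codeword (N n : ℕ) := (Fin n → Bool) × Finset (Fin N)

/-- A codebook with `M` codewords. -/
abbrev Codebook (M N n : ℕ) := Fin M → Codeword N n

/-- The symbols of a codeword: the unit pilot at index `0`, then the `n` bits as `0`/`1`. -/
def symbol {N n : ℕ} (c : Codeword N n) : Fin (n + 1) → ℤ :=
  Fin.cons 1 (fun j => if c.1 j then 1 else 0)

/-- The noiseless sum, in slot `s`, of the replicas of the messages in `A`. -/
def slotSum {M N n : ℕ} (cb : Codebook M N n) (A : Finset (Fin M)) (s : Fin N)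
    (j : Fin (n + 1)) : ℤ :=
  ∑ i ∈ A.filter (fun i => s ∈ (cb i).2), symbol (cb i) j

/-- The candidate list of slot `s`: all codewords that could have been transmitted there. -/
def candidates {M N n : ℕ} (cb : Codebook M N n) (s : Fin N) : Finset (Fin M) :=
  Finset.univ.filter (fun i => s ∈ (cb i).2)

/-- The candidates of slot `s` that survive the discarding process when the signal in the slot is
`y`. The first entry `y 0` is the number of colliding codewords. If `y j` equals this number, all
candidates with `j`th entry `0` are discarded; if `y j = 0`, all those with `j`th entry `1` are. -/
def survivors {M N n : ℕ} (cb : Codebook M N n) (s : Fin N) (y : Fin (n + 1) → ℤ) :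
    Finset (Fin M) :=
  (candidates cb s).filter (fun i => ∀ j : Fin n,
    ¬ (y j.succ = y 0 ∧ symbol (cb i) j.succ = 0) ∧ ¬ (y j.succ = 0 ∧ symbol (cb i) j.succ = 1))

/-- The per-slot decoder resolves slot `s` with signal `y`: there is a collision of `y 0 > 0`
codewords and exactly that many candidates survive. -/
def Resolves {M N n : ℕ} (cb : Codebook M N n) (s : Fin N) (y : Fin (n + 1) → ℤ) : Prop :=
  0 < y 0 ∧ ((survivors cb s y).card : ℤ) = y 0

instance {M N n : ℕ} (cb : Codebook M N n) (s : Fin N) (y : Fin (n + 1) → ℤ) :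
    Decidable (Resolves cb s y) := by
  unfold Resolves; infer_instance

/-! ### Successive interference cancellation (ED-MPR) -/

/-- One iteration of the decoder on the received frame `y`, when the messages in `R` have been
decoded so far: their replicas are removed from all slots, the per-slot decoder is run in all
slots, and the surviving codewords of each resolved slot are decoded. -/
def step {M N n : ℕ} (cb : Codebook M N n) (y : Fin N → Fin (n + 1) → ℤ) (R : Finset (Fin M)) :
    Finset (Fin M) :=
  R ∪ Finset.univ.filter (fun i => ∃ s : Fin N,
    Resolves cb s (y s - slotSum cb R s) ∧ i ∈ survivors cb s (y s - slotSum cb R s))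

/-- The decoded messages. Every iteration before the decoder gets stuck decodes a new message, so
that `M` iterations reach the point where there are no more resolvable slots. -/
def decoded {M N n : ℕ} (cb : Codebook M N n) (y : Fin N → Fin (n + 1) → ℤ) : Finset (Fin M) :=
  (step cb y)^[M] ∅

/-- The fraction of the messages in `A` that are lost when precisely these are transmitted
(`0` if nothing is transmitted). -/
def lossFraction {M N n : ℕ} (cb : Codebook M N n) (A : Finset (Fin M)) : ℝ :=
  ((A \ decoded cb (slotSum cb A)).card : ℝ) / (A.card : ℝ)

/-! ### The random model -/

/-- `Λ(x) = ∑ L, Λ_L x ^ L` is the generating polynomial of a probability distribution of the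
number `L ≥ 1` of replicas. -/
structure IsDegreeDistribution (Λ : Polynomial ℝ) : Prop where
  nonneg : ∀ L, 0 ≤ Λ.coeff L
  coeff_zero : Λ.coeff 0 = 0
  eval_one : Λ.eval 1 = 1

/-- `Λ'(1)`, the average number of replicas. -/
def avgDegree (Λ : Polynomial ℝ) : ℝ := Λ.derivative.eval 1

/-- `λ(x) = Λ'(x) / Λ'(1)`. -/
def edgePoly (Λ : Polynomial ℝ) (x : ℝ) : ℝ := Λ.derivative.eval x / avgDegree Λ

/-- The probability of a codeword: its bits are i.i.d. Bernoulli(`ν`); independently of them, the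
number of replicas has distribution `Λ`, and the slots are chosen uniformly without replacement. -/
def codewordProb (ν : ℝ) (Λ : Polynomial ℝ) {N n : ℕ} (c : Codeword N n) : ℝ :=
  (∏ j, if c.1 j then ν else 1 - ν) * (Λ.coeff c.2.card / (N.choose c.2.card : ℝ))

/-- The probability of a codebook: the codewords are i.i.d. -/
def codebookProb (ν : ℝ) (Λ : Polynomial ℝ) {M N n : ℕ} (cb : Codebook M N n) : ℝ :=
  ∏ i, codewordProb ν Λ (cb i)

/-- `π_U`: the probability that the per-slot decoder resolves a degree-`U` slot, that is, the
conditional probability that the slot `s`, chosen uniformly, is resolved when the first `U` messages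
are transmitted, given that `s` is among the slots of each of these `U` messages. -/
def resolveProb (ν : ℝ) (Λ : Polynomial ℝ) (M N n U : ℕ) : ℝ :=
  let A : Finset (Fin M) := Finset.univ.filter (fun i => i.val < U)
  (∑ s : Fin N, ∑ cb : Codebook M N n,
      if (∀ i ∈ A, s ∈ (cb i).2) ∧ Resolves cb s (slotSum cb A s) then codebookProb ν Λ cb else 0) /
    (∑ s : Fin N, ∑ cb : Codebook M N n,
      if ∀ i ∈ A, s ∈ (cb i).2 then codebookProb ν Λ cb else 0)

/-- The probability that the users `k < K` select the messages `w k`. Every user has a signature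
that is part of its messages (message `m` carries the signature `m mod K`), and selects uniformly
among the messages with its own signature, so that different users select different messages. -/
def selectionProb {K M : ℕ} (w : Fin K → Fin M) : ℝ :=
  ∏ k, if (w k).val % K = k.val then
    1 / ((Finset.univ.filter (fun m : Fin M => m.val % K = k.val)).card : ℝ) else 0

/-- The packet loss rate: the expected fraction of the transmitted messages that are not decoded.
The sum runs over the set `a` of active users (each of the `K` users is active with probability `μ`,
independently), the selected messages `w` and the codebook. -/
def packetLossRate (ν μ : ℝ) (Λ : Polynomial ℝ) (K M N n : ℕ) : ℝ :=
  ∑ a : Finset (Fin K), ∑ w : Fin K → Fin M, ∑ cb : Codebook M N n,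
    μ ^ a.card * (1 - μ) ^ (K - a.card) * selectionProb w * codebookProb ν Λ cb *
      lossFraction cb (a.image w)

/-! ### The asymptotic regime and the decoding threshold -/

/-- The `(G, D, β, δ)`-asymptotic regime along a sequence of systems: `K → ∞`, `μ K / N = G`,
`M = D K ^ (1 / δ)` and `n = β log₂ M`, the integers `N`, `M`, `n` being rounded. -/
structure Regime (μ G D β δ : ℝ) (K M N n : ℕ → ℕ) : Prop where
  tendsto_K : Tendsto K atTop atTop
  slots : ∀ t, |(N t : ℝ) - μ * K t / G| ≤ 1
  messages : ∀ t, |(M t : ℝ) - D * (K t : ℝ) ^ (1 / δ)| ≤ 1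
  length : ∀ t, |(n t : ℝ) - β * Real.logb 2 (M t)| ≤ 1

/-- At channel load `G`, the packet loss rate vanishes in the asymptotic regime. -/
def VanishingLoss (ν μ : ℝ) (Λ : Polynomial ℝ) (D β δ G : ℝ) : Prop :=
  ∀ K M N n : ℕ → ℕ, Regime μ G D β δ K M N n →
    Tendsto (fun t => packetLossRate ν μ Λ (K t) (M t) (N t) (n t)) atTop (𝓝 0)

/-- The decoding threshold `G*(Λ)`: the supremum of the channel loads up to which the packet loss
rate vanishes. -/
def decodingThreshold (ν μ : ℝ) (Λ : Polynomial ℝ) (D β δ : ℝ) : ℝ≥0∞ :=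
  ⨆ G ∈ {G : ℝ | 0 < G ∧ ∀ G', 0 < G' → G' ≤ G → VanishingLoss ν μ Λ D β δ G'}, ENNReal.ofReal G

/-! ### The bounds -/

/-- The critical value `-log₂ (1 - 2 ^ (-(1 - δ) / β))` of the slot degree. -/
def critDegree (β δ : ℝ) : ℝ := -Real.logb 2 (1 - (2 : ℝ) ^ (-(1 - δ) / β))

/-- `π̄_U`. -/
def piBar (μ : ℝ) (Λ : Polynomial ℝ) (G D β δ : ℝ) (U : ℕ) : ℝ :=
  if critDegree β δ < U then 0
  else if (U : ℝ) = critDegree β δ then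
    Real.exp (-(μ⁻¹ * D * G * avgDegree Λ * (1 - (2 : ℝ) ^ (-(U : ℝ))) ^ (β * Real.logb 2 D)))
  else 1

/-- `T̄`. -/
def tBar (β δ : ℝ) : ℕ := ⌊critDegree β δ⌋₊

/-- The density-evolution inequality at load `G`. -/
def DensityEvolution (μ : ℝ) (Λ : Polynomial ℝ) (D β δ G : ℝ) : Prop :=
  ∀ p : ℝ, 0 < p → p ≤ 1 →
    p > edgePoly Λ (1 - Real.exp (-(G * avgDegree Λ * p)) *
      ∑ u ∈ Finset.range (tBar β δ),
        piBar μ Λ G D β δ (u + 1) / (u.factorial : ℝ) * (p * G * avgDegree Λ) ^ u)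

end

end IRSA

/-!
# Why the theorem is true

*A slot in isolation.* The survivors of a slot with colliding messages `B` are the candidates whose
bits agree with those of `B` in all positions where `B` is unanimous (`mem_survivors_iff`). The
number `e` of unanimous positions of `U` messages is binomial with parameters `n` and `2 ^ (1 - U)`,
and given `e`, each other message survives with probability `q * 2 ^ (-e)`, independently, where `q`
is the probability that it is placed in the slot (`resolveProb_eq`). As `q M = 2 ^ (x n + O(1))` with
`x = (1 - δ) / β`, the slot is resolved if `e` is well above `x n`, and it is not if `e` is well
below. Hence the limit of `π_U` is `1` or `0` according to whether `x < 2 ^ (1 - U)` or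
`x > 2 ^ (1 - U)`, by the law of large numbers, and it is `1 / 2` if both are equal, by the central
limit theorem. Finally, `2 ^ (-x) < 1 - x / 2` on `(0, 1)` by convexity, so that all degrees up to
the critical one, this one included, belong to the first case (`lt_of_le_critDegree`).

*The frame.* The decoder is compared with peeling in the random graph of users and slots, where a
slot is resolved as soon as at most `T = T̄` unresolved users are left in it. A lost user is blocked
in this process after `ℓ` rounds, or there is a path of length at most `ℓ` from it to a bad slot, in
which some set of at most `T` users leaves a false survivor
(`userBlocked_or_badReach_of_notMem_decoded`). Bad slots are so rare that the expected number of such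
paths vanishes (`expect_expect_badReach_le`). The peeling process follows density evolution: if, in
the limit, slots are blocked with probability `Y` and two slots independently so, then the number
of blocked users in a slot, jointly with the state of another slot, satisfies the recursion
`k P(k) = m P(k - 1)` with `m = ρ Λ'(Y)` up to `o(1)` (`eventually_abs_stein_le`). Therefore it is
asymptotically Poisson, and one more round replaces `Y` by the Poisson tail `P(Pois(m) ≥ T)`, again
independently for two slots (`slotLimit_and_pairLimit`). No local tree structure has to be exhibited:
the recursion excludes the slots and users that it has met, and only the effect of removing one user
has to be controlled. The hypothesis on `G` says that this recursion converges to zero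
(`tendsto_slotEvolution_zero`), and it is inherited by all smaller loads
(`edgePoly_poissonTail_lt`), so the packet loss rate vanishes for all of them.
-/

open Filter Topology
open scoped ENNReal

namespace IRSA

noncomputable section

/-! ### Expectations over independent, identically distributed choices -/

/-- The real-valued indicator of a proposition. -/
def ind (p : Prop) : ℝ := open Classical in if p then 1 else 0

lemma ind_of {p : Prop} (h : p) : ind p = 1 := by simp [ind, h]

lemma ind_of_not {p : Prop} (h : ¬ p) : ind p = 0 := by simp [ind, h]

lemma ind_nonneg (p : Prop) : 0 ≤ ind p := by unfold ind; split_ifs <;> norm_num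

lemma ind_le_one (p : Prop) : ind p ≤ 1 := by unfold ind; split_ifs <;> norm_num

lemma ind_mono {p q : Prop} (h : p → q) : ind p ≤ ind q := by
  by_cases hp : p
  · rw [ind_of hp, ind_of (h hp)]
  · rw [ind_of_not hp]; exact ind_nonneg q

lemma ind_congr {p q : Prop} (h : p ↔ q) : ind p = ind q := by rw [propext h]

lemma ind_and (p q : Prop) : ind (p ∧ q) = ind p * ind q := by
  by_cases hp : p <;> by_cases hq : q <;> simp [ind, hp, hq]

lemma ite_eq_ind (p : Prop) [Decidable p] : (if p then (1 : ℝ) else 0) = ind p := by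
  by_cases hp : p <;> simp [ind, hp]

lemma ite_eq_ind_mul (p : Prop) [Decidable p] (a : ℝ) : (if p then a else 0) = ind p * a := by
  by_cases hp : p <;> simp [ind, hp]

lemma ind_exists_le_sum {α : Type*} (s : Finset α) (p : α → Prop) :
    ind (∃ a ∈ s, p a) ≤ ∑ a ∈ s, ind (p a) := by
  by_cases h : ∃ a ∈ s, p a
  · obtain ⟨a, ha, hp⟩ := h
    calc ind _ ≤ 1 := ind_le_one _
      _ = ind (p a) := (ind_of hp).symm
      _ ≤ _ := Finset.single_le_sum (f := fun a => ind (p a)) (fun b _ => ind_nonneg _) ha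
  · rw [ind_of_not h]
    exact Finset.sum_nonneg fun b _ => ind_nonneg _

lemma ind_forall_mem_eq_prod {α : Type*} [Fintype α] [DecidableEq α] (s : Finset α)
    (p : α → Prop) : ind (∀ a ∈ s, p a) = ∏ a, if a ∈ s then ind (p a) else 1 := by
  by_cases h : ∀ a ∈ s, p a
  · rw [ind_of h, Finset.prod_eq_one]
    intro a _
    split_ifs with ha
    · exact ind_of (h a ha)
    · rfl
  · rw [ind_of_not h]
    push Not at h
    obtain ⟨a, ha, hne⟩ := h
    rw [Finset.prod_eq_zero (Finset.mem_univ a)]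
    rw [if_pos ha, ind_of_not hne]

/-- `w` is a probability distribution on the finite type `β`. -/
structure IsLaw {β : Type*} [Fintype β] (w : β → ℝ) : Prop where
  nonneg : ∀ b, 0 ≤ w b
  sum_eq_one : ∑ b, w b = 1

variable {ι β : Type*} [Fintype ι] [DecidableEq ι] [Fintype β]

/-- The expectation of `f x` when the coordinates `x i` are independent with law `w`. -/
def expect (w : β → ℝ) (f : (ι → β) → ℝ) : ℝ := ∑ x : ι → β, (∏ i, w (x i)) * f x

section

variable {w : β → ℝ}

lemma expect_congr {f g : (ι → β) → ℝ} (h : ∀ x, f x = g x) : expect w f = expect w g := by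
  rw [show f = g from funext h]

lemma expect_add (f g : (ι → β) → ℝ) :
    expect w (fun x => f x + g x) = expect w f + expect w g := by
  simp only [expect, mul_add, Finset.sum_add_distrib]

lemma expect_sub (f g : (ι → β) → ℝ) :
    expect w (fun x => f x - g x) = expect w f - expect w g := by
  simp only [expect, mul_sub, Finset.sum_sub_distrib]

lemma expect_const_mul (c : ℝ) (f : (ι → β) → ℝ) :
    expect w (fun x => c * f x) = c * expect w f := by
  simp only [expect, Finset.mul_sum]
  exact Finset.sum_congr rfl fun x _ => by ring

lemma expect_mul_const (c : ℝ) (f : (ι → β) → ℝ) :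
    expect w (fun x => f x * c) = expect w f * c := by
  simp only [expect, Finset.sum_mul]
  exact Finset.sum_congr rfl fun x _ => by ring

lemma expect_sum {α : Type*} (s : Finset α) (f : α → (ι → β) → ℝ) :
    expect w (fun x => ∑ a ∈ s, f a x) = ∑ a ∈ s, expect w (f a) := by
  simp only [expect, Finset.mul_sum]
  exact Finset.sum_comm

lemma IsLaw.sum_prod (hw : IsLaw w) : ∑ x : ι → β, ∏ i, w (x i) = 1 := by
  rw [← Fintype.prod_sum]
  simp [hw.sum_eq_one]

lemma expect_const (hw : IsLaw w) (c : ℝ) : expect (ι := ι) w (fun _ => c) = c := by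
  rw [expect, ← Finset.sum_mul, hw.sum_prod, one_mul]

lemma expect_mono (hw : IsLaw w) {f g : (ι → β) → ℝ} (h : ∀ x, f x ≤ g x) :
    expect w f ≤ expect w g :=
  Finset.sum_le_sum fun x _ =>
    mul_le_mul_of_nonneg_left (h x) (Finset.prod_nonneg fun _ _ => hw.nonneg _)

lemma expect_nonneg (hw : IsLaw w) {f : (ι → β) → ℝ} (h : ∀ x, 0 ≤ f x) : 0 ≤ expect w f :=
  Finset.sum_nonneg fun x _ => mul_nonneg (Finset.prod_nonneg fun _ _ => hw.nonneg _) (h x)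

lemma expect_le_one (hw : IsLaw w) {f : (ι → β) → ℝ} (h : ∀ x, f x ≤ 1) : expect w f ≤ 1 :=
  (expect_mono hw h).trans_eq (expect_const hw 1)

lemma abs_expect_le (hw : IsLaw w) (f : (ι → β) → ℝ) :
    |expect w f| ≤ expect w (fun x => |f x|) := by
  rw [abs_le]
  constructor
  · rw [neg_le, ← neg_one_mul, ← expect_const_mul]
    exact expect_mono hw fun x => by rw [neg_one_mul]; exact neg_le_abs _
  · exact expect_mono hw fun x => le_abs_self _

/-- Resampling one coordinate does not change the distribution. -/
lemma expect_resample (hw : IsLaw w) (i : ι) (f : (ι → β) → ℝ) :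
    expect w f = ∑ b, w b * expect w (fun x => f (Function.update x i b)) := by
  have key : ∀ (b : β) (x : ι → β),
      w b * ∏ j, w (x j) = w (x i) * ∏ j, w (Function.update x i b j) := by
    intro b x
    rw [← Finset.mul_prod_erase _ _ (Finset.mem_univ i),
      ← Finset.mul_prod_erase _ (fun j => w (Function.update x i b j)) (Finset.mem_univ i)]
    have : ∏ j ∈ Finset.univ.erase i, w (Function.update x i b j)
        = ∏ j ∈ Finset.univ.erase i, w (x j) :=
      Finset.prod_congr rfl fun j hj => by
        rw [Function.update_of_ne (Finset.ne_of_mem_erase hj)]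
    rw [this, Function.update_self]
    ring
  have h1 : ∑ b, w b * expect w (fun x => f (Function.update x i b))
      = ∑ q : β × (ι → β), w (q.2 i) * ((∏ j, w (Function.update q.2 i q.1 j))
        * f (Function.update q.2 i q.1)) := by
    rw [Fintype.sum_prod_type]
    refine Finset.sum_congr rfl fun b _ => ?_
    rw [expect, Finset.mul_sum]
    refine Finset.sum_congr rfl fun x _ => ?_
    rw [← mul_assoc, ← mul_assoc, key]
  -- exchanging the new value with the old one is an involution
  let e : Equiv.Perm (β × (ι → β)) :=
    { toFun := fun q => (q.2 i, Function.update q.2 i q.1)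
      invFun := fun q => (q.2 i, Function.update q.2 i q.1)
      left_inv := fun q => by simp
      right_inv := fun q => by simp }
  have h2 : ∑ q : β × (ι → β), w (q.2 i) * ((∏ j, w (Function.update q.2 i q.1 j))
        * f (Function.update q.2 i q.1))
      = ∑ q : β × (ι → β), w q.1 * ((∏ j, w (q.2 j)) * f q.2) :=
    Fintype.sum_equiv e _ _ fun q => by simp [e]
  rw [h1, h2, Fintype.sum_prod_type]
  simp only [← Finset.mul_sum, ← Finset.sum_mul, hw.sum_eq_one, one_mul]
  rfl

/-- A function of one coordinate is independent of a function of the others. -/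
lemma expect_mul_of_indep (hw : IsLaw w) (i : ι) (g : β → ℝ) (f : (ι → β) → ℝ)
    (hf : ∀ x b, f (Function.update x i b) = f x) :
    expect w (fun x => g (x i) * f x) = (∑ b, w b * g b) * expect w f := by
  rw [expect_resample hw i, Finset.sum_mul]
  refine Finset.sum_congr rfl fun b _ => ?_
  simp only [Function.update_self, hf]
  rw [expect_const_mul, mul_assoc]

lemma expect_coord (hw : IsLaw w) (i : ι) (g : β → ℝ) :
    expect w (fun x : ι → β => g (x i)) = ∑ b, w b * g b := by
  have := expect_mul_of_indep hw i g (fun _ => 1) (fun _ _ => rfl)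
  simpa [expect_const hw] using this

end

/-! ### Peeling with a threshold, and its blocked slots -/

section Peeling

variable {ι : Type*} [DecidableEq ι] {N : ℕ}

open Classical in
/-- Message passing in the graph of the users `V` and the slots `S i` that they occupy, cut off at
a given depth: slot `s` is blocked if at least `T` of the users in it cannot be decoded through
their other slots. The slots in `F` are not to be used for decoding. A user `i` in slot `s` is
hindered if all of its slots outside of `F` are blocked when `i` is removed and its slots are added
to `F`; so no slot is ever used twice along a branch of the recursion. -/
def SlotBlocked (T : ℕ) (S : ι → Finset (Fin N)) :
    ℕ → Fin N → Finset ι → Finset (Fin N) → Prop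
  | 0, _, _, _ => True
  | ℓ + 1, s, V, F => T ≤ (V.filter fun i => s ∈ S i ∧
      ∀ s' ∈ S i \ F, SlotBlocked T S ℓ s' (V.erase i) (F ∪ S i)).card

/-- User `i` cannot be decoded at depth `ℓ` through its slots outside of `F`. -/
def UserBlocked (T : ℕ) (S : ι → Finset (Fin N)) (ℓ : ℕ) (i : ι) (V : Finset ι)
    (F : Finset (Fin N)) : Prop :=
  ∀ s' ∈ S i \ F, SlotBlocked T S ℓ s' (V.erase i) (F ∪ S i)

open Classical in
/-- The number of blocked users in slot `s`. -/
def blockedCount (T : ℕ) (S : ι → Finset (Fin N)) (ℓ : ℕ) (s : Fin N) (V : Finset ι)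
    (F : Finset (Fin N)) : ℕ :=
  (V.filter fun i => s ∈ S i ∧ UserBlocked T S ℓ i V F).card

variable {T : ℕ} {S : ι → Finset (Fin N)}

lemma slotBlocked_succ {ℓ : ℕ} {s : Fin N} {V : Finset ι} {F : Finset (Fin N)} :
    SlotBlocked T S (ℓ + 1) s V F ↔ T ≤ blockedCount T S ℓ s V F := by
  unfold SlotBlocked blockedCount UserBlocked
  exact iff_of_eq (by congr!)

lemma SlotBlocked.mono {ℓ : ℕ} {s : Fin N} {V V' : Finset ι} {F F' : Finset (Fin N)}
    (hV : V ⊆ V') (hF : F ⊆ F') (h : SlotBlocked T S ℓ s V F) : SlotBlocked T S ℓ s V' F' := by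
  induction ℓ generalizing s V V' F F' with
  | zero => trivial
  | succ ℓ ih =>
    refine le_trans (show T ≤ _ from h) (Finset.card_le_card fun i hi => ?_)
    simp only [Finset.mem_filter, Finset.mem_sdiff] at hi ⊢
    exact ⟨hV hi.1, hi.2.1, fun s' hs' => ih (Finset.erase_subset_erase _ hV)
      (Finset.union_subset_union hF subset_rfl) (hi.2.2 s' ⟨hs'.1, fun h => hs'.2 (hF h)⟩)⟩

lemma UserBlocked.mono {ℓ : ℕ} {i : ι} {V V' : Finset ι} {F F' : Finset (Fin N)}
    (hV : V ⊆ V') (hF : F ⊆ F') (h : UserBlocked T S ℓ i V F) : UserBlocked T S ℓ i V' F' :=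
  fun s' hs' => (h s' (Finset.sdiff_subset_sdiff subset_rfl hF hs')).mono
    (Finset.erase_subset_erase _ hV) (Finset.union_subset_union hF subset_rfl)

lemma blockedCount_mono {ℓ : ℕ} {s : Fin N} {V V' : Finset ι} {F : Finset (Fin N)}
    (hV : V ⊆ V') : blockedCount T S ℓ s V F ≤ blockedCount T S ℓ s V' F := by
  refine Finset.card_le_card fun i hi => ?_
  simp only [Finset.mem_filter] at hi ⊢
  exact ⟨hV hi.1, hi.2.1, hi.2.2.mono hV subset_rfl⟩

/-- Whether a slot is blocked depends on the slots of the users in `V` only. -/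
lemma slotBlocked_congr {S' : ι → Finset (Fin N)} {ℓ : ℕ} {s : Fin N} {V : Finset ι}
    {F : Finset (Fin N)} (h : ∀ i ∈ V, S i = S' i) :
    SlotBlocked T S ℓ s V F ↔ SlotBlocked T S' ℓ s V F := by
  induction ℓ generalizing s V F with
  | zero => exact Iff.rfl
  | succ ℓ ih =>
    unfold SlotBlocked
    congr! 2
    ext i
    simp only [Finset.mem_filter]
    refine and_congr_right fun hi => ?_
    rw [h i hi]
    refine and_congr_right fun _ => forall₂_congr fun s' _ => ?_
    exact ih fun j hj => h j (Finset.mem_of_mem_erase hj)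

lemma userBlocked_congr {S' : ι → Finset (Fin N)} {ℓ : ℕ} {i : ι} {V : Finset ι}
    {F : Finset (Fin N)} (hi : S i = S' i) (h : ∀ j ∈ V, S j = S' j) :
    UserBlocked T S ℓ i V F ↔ UserBlocked T S' ℓ i V F := by
  unfold UserBlocked
  rw [hi]
  exact forall₂_congr fun s' _ => slotBlocked_congr fun j hj => h j (Finset.mem_of_mem_erase hj)

lemma blockedCount_congr {S' : ι → Finset (Fin N)} {ℓ : ℕ} {s : Fin N} {V : Finset ι}
    {F : Finset (Fin N)} (h : ∀ j ∈ V, S j = S' j) :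
    blockedCount T S ℓ s V F = blockedCount T S' ℓ s V F := by
  unfold blockedCount
  congr! 1
  ext i
  simp only [Finset.mem_filter]
  refine and_congr_right fun hi => ?_
  rw [h i hi, userBlocked_congr (h i hi) h]

/-- A user all of whose slots are excluded from decoding matters for none of the other slots. -/
lemma slotBlocked_erase {ℓ : ℕ} {s : Fin N} {V : Finset ι} {F : Finset (Fin N)} {j : ι}
    (hF : S j ⊆ F) (hs : s ∉ S j) :
    SlotBlocked T S ℓ s V F ↔ SlotBlocked T S ℓ s (V.erase j) F := by
  induction ℓ generalizing s V F with
  | zero => exact Iff.rfl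
  | succ ℓ ih =>
    unfold SlotBlocked
    congr! 2
    ext i
    simp only [Finset.mem_filter, Finset.mem_sdiff, Finset.mem_erase]
    constructor
    · rintro ⟨hi, hsi, h⟩
      refine ⟨⟨?_, hi⟩, hsi, fun s' hs' => ?_⟩
      · rintro rfl; exact hs hsi
      · rw [Finset.erase_right_comm]
        exact (ih (hF.trans Finset.subset_union_left) fun h => hs'.2 (hF h)).1 (h s' hs')
    · rintro ⟨⟨_, hi⟩, hsi, h⟩
      refine ⟨hi, hsi, fun s' hs' => ?_⟩
      have := h s' hs'
      rw [Finset.erase_right_comm] at this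
      exact (ih (hF.trans Finset.subset_union_left) fun h => hs'.2 (hF h)).2 this

end Peeling

/-! ### The law of the set of slots of a user -/

/-- The distribution of the set of slots occupied by a message. -/
def slotLaw (Λ : Polynomial ℝ) {N : ℕ} (c : Finset (Fin N)) : ℝ :=
  Λ.coeff c.card / (N.choose c.card : ℝ)

section SlotLaw

variable {Λ : Polynomial ℝ} {N : ℕ}

lemma IsDegreeDistribution.sum_coeff (hΛ : IsDegreeDistribution Λ) {n : ℕ}
    (hn : Λ.natDegree < n) : ∑ d ∈ Finset.range n, Λ.coeff d = 1 := by
  have := Polynomial.eval_eq_sum_range' hn (1 : ℝ)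
  simpa [hΛ.eval_one] using this.symm

lemma IsDegreeDistribution.natDegree_pos (hΛ : IsDegreeDistribution Λ) : 0 < Λ.natDegree := by
  by_contra h
  have h0 : Λ.natDegree < 1 := by omega
  have := hΛ.sum_coeff h0
  simp [hΛ.coeff_zero] at this

lemma eval_derivative_eq_sum (hΛ : IsDegreeDistribution Λ) (u : ℝ) :
    Λ.derivative.eval u = ∑ k ∈ Finset.range Λ.natDegree, Λ.coeff (k + 1) * (k + 1) * u ^ k := by
  have h := Polynomial.natDegree_derivative_lt hΛ.natDegree_pos.ne'
  rw [Polynomial.eval_eq_sum_range' h]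
  simp [Polynomial.coeff_derivative]

lemma IsDegreeDistribution.sum_coeff_succ (hΛ : IsDegreeDistribution Λ) :
    ∑ k ∈ Finset.range Λ.natDegree, Λ.coeff (k + 1) = 1 := by
  have := hΛ.sum_coeff (Nat.lt_succ_self _)
  rwa [Finset.sum_range_succ', hΛ.coeff_zero, add_zero] at this

lemma one_le_avgDegree (hΛ : IsDegreeDistribution Λ) : 1 ≤ avgDegree Λ := by
  rw [avgDegree, eval_derivative_eq_sum hΛ]
  refine hΛ.sum_coeff_succ.symm.trans_le ?_
  refine Finset.sum_le_sum fun k _ => ?_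
  have := hΛ.nonneg (k + 1)
  have hk : (0 : ℝ) ≤ k := k.cast_nonneg
  rw [one_pow, mul_one]
  nlinarith

lemma avgDegree_le (hΛ : IsDegreeDistribution Λ) : avgDegree Λ ≤ Λ.natDegree := by
  rw [avgDegree, eval_derivative_eq_sum hΛ]
  calc _ ≤ ∑ k ∈ Finset.range Λ.natDegree, Λ.coeff (k + 1) * (Λ.natDegree : ℝ) := by
        refine Finset.sum_le_sum fun k hk => ?_
        have h1 : ((k + 1 : ℕ) : ℝ) ≤ Λ.natDegree := by
          exact_mod_cast Finset.mem_range.1 hk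
        rw [one_pow, mul_one]
        push_cast at h1
        exact mul_le_mul_of_nonneg_left h1 (hΛ.nonneg _)
    _ = _ := by rw [← Finset.sum_mul, hΛ.sum_coeff_succ, one_mul]

lemma slotLaw_nonneg (hΛ : IsDegreeDistribution Λ) (c : Finset (Fin N)) : 0 ≤ slotLaw Λ c :=
  div_nonneg (hΛ.nonneg _) (Nat.cast_nonneg _)

lemma isLaw_slotLaw (hΛ : IsDegreeDistribution Λ) (hN : Λ.natDegree ≤ N) :
    IsLaw (slotLaw Λ : Finset (Fin N) → ℝ) := by
  refine ⟨slotLaw_nonneg hΛ, ?_⟩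
  have h := Finset.sum_powerset_apply_card (fun d => Λ.coeff d / (N.choose d : ℝ))
    (x := (Finset.univ : Finset (Fin N)))
  rw [Finset.powerset_univ, Finset.card_univ, Fintype.card_fin] at h
  unfold slotLaw
  rw [h, ← hΛ.sum_coeff (Nat.lt_succ_of_le hN)]
  refine Finset.sum_congr rfl fun d hd => ?_
  have : (N.choose d : ℝ) ≠ 0 := by
    have := Nat.choose_pos (Nat.lt_succ_iff.1 (Finset.mem_range.1 hd))
    positivity
  rw [nsmul_eq_mul]
  field_simp

lemma card_le_of_slotLaw_ne_zero {c : Finset (Fin N)} (h : slotLaw Λ c ≠ 0) :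
    c.card ≤ Λ.natDegree :=
  Polynomial.le_natDegree_of_ne_zero fun h0 => h (by simp [slotLaw, h0])

lemma nonempty_of_slotLaw_ne_zero (hΛ : IsDegreeDistribution Λ) {c : Finset (Fin N)}
    (h : slotLaw Λ c ≠ 0) : c.Nonempty := by
  rw [Finset.nonempty_iff_ne_empty]
  rintro rfl
  simp [slotLaw, hΛ.coeff_zero] at h

/-- The probability that a user occupies slot `s` and otherwise only slots from `Z`. -/
lemma sum_slotLaw_subset (s : Fin N) (Z : Finset (Fin N)) :
    ∑ c : Finset (Fin N), slotLaw Λ c * ind (s ∈ c ∧ c.erase s ⊆ Z) =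
      ∑ k ∈ Finset.range Λ.natDegree,
        Λ.coeff (k + 1) * (((Z.erase s).card.choose k : ℝ) / (N.choose (k + 1) : ℝ)) := by
  classical
  have h1 : ∑ c : Finset (Fin N), slotLaw Λ c * ind (s ∈ c ∧ c.erase s ⊆ Z)
      = ∑ c ∈ (Finset.univ : Finset (Finset (Fin N))).filter (fun c => s ∈ c ∧ c.erase s ⊆ Z),
        slotLaw Λ c := by
    rw [Finset.sum_filter]
    exact Finset.sum_congr rfl fun c _ => by rw [← ite_eq_ind]; split_ifs <;> simp
  have h2 : ∑ c ∈ (Finset.univ : Finset (Finset (Fin N))).filter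
        (fun c => s ∈ c ∧ c.erase s ⊆ Z), slotLaw Λ c
      = ∑ R ∈ (Z.erase s).powerset,
        Λ.coeff (R.card + 1) / (N.choose (R.card + 1) : ℝ) := by
    refine Finset.sum_nbij' (fun c => c.erase s) (fun R => insert s R) ?_ ?_ ?_ ?_ ?_
    · intro c hc
      simp only [Finset.mem_filter, Finset.mem_univ, true_and] at hc
      rw [Finset.mem_powerset]
      intro t ht
      exact Finset.mem_erase.2 ⟨(Finset.mem_erase.1 ht).1, hc.2 ht⟩
    · intro R hR
      rw [Finset.mem_powerset] at hR
      simp only [Finset.mem_filter, Finset.mem_univ, true_and, Finset.mem_insert_self]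
      intro t ht
      rw [Finset.mem_erase, Finset.mem_insert] at ht
      exact (Finset.mem_erase.1 (hR (ht.2.resolve_left ht.1))).2
    · intro c hc
      simp only [Finset.mem_filter, Finset.mem_univ, true_and] at hc
      exact Finset.insert_erase hc.1
    · intro R hR
      rw [Finset.mem_powerset] at hR
      exact Finset.erase_insert fun h => (Finset.mem_erase.1 (hR h)).1 rfl
    · intro c hc
      simp only [Finset.mem_filter, Finset.mem_univ, true_and] at hc
      rw [Finset.card_erase_add_one hc.1, slotLaw]
  rw [h1, h2, Finset.sum_powerset_apply_card
    (fun k => Λ.coeff (k + 1) / (N.choose (k + 1) : ℝ))]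
  set z := (Z.erase s).card
  have h3 : ∀ n, z + 1 ≤ n → ∑ k ∈ Finset.range (z + 1),
      z.choose k • (Λ.coeff (k + 1) / (N.choose (k + 1) : ℝ)) = ∑ k ∈ Finset.range n,
      Λ.coeff (k + 1) * ((z.choose k : ℝ) / (N.choose (k + 1) : ℝ)) := by
    intro n hn
    rw [← Finset.sum_subset (Finset.range_subset_range.2 hn)]
    · exact Finset.sum_congr rfl fun k _ => by rw [nsmul_eq_mul]; ring
    · intro k _ hk
      rw [Finset.mem_range, not_lt] at hk
      rw [Nat.choose_eq_zero_of_lt (by omega)]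
      simp
  rw [h3 _ (le_max_left (z + 1) Λ.natDegree)]
  symm
  apply Finset.sum_subset (Finset.range_subset_range.2 (le_max_right _ _))
  intro k _ hk
  rw [Finset.mem_range, not_lt] at hk
  rw [Polynomial.coeff_eq_zero_of_natDegree_lt (by omega)]
  simp

lemma choose_div_choose_succ (hN : 0 < N) (z k : ℕ) :
    (N : ℝ) * ((z.choose k : ℝ) / (N.choose (k + 1) : ℝ))
      = (k + 1) * ((z.choose k : ℝ) / ((N - 1).choose k : ℝ)) := by
  obtain ⟨n, rfl⟩ : ∃ n, N = n + 1 := ⟨N - 1, by omega⟩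
  rw [Nat.add_sub_cancel]
  have h := Nat.add_one_mul_choose_eq n k
  by_cases hk : k ≤ n
  · have h1 : (n.choose k : ℝ) ≠ 0 := by
      have := Nat.choose_pos hk
      positivity
    have h2 : ((n + 1).choose (k + 1) : ℝ) ≠ 0 := by
      have := Nat.choose_pos (show k + 1 ≤ n + 1 by omega)
      positivity
    have h' : ((n : ℝ) + 1) * n.choose k = (n + 1).choose (k + 1) * (k + 1) := by
      exact_mod_cast h
    rw [← mul_div_assoc, ← mul_div_assoc, div_eq_div_iff h2 h1]
    push_cast
    linear_combination (z.choose k : ℝ) * h'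
  · rw [Nat.choose_eq_zero_of_lt (show n < k by omega),
      Nat.choose_eq_zero_of_lt (show n + 1 < k + 1 by omega)]
    simp

lemma mul_sum_slotLaw_subset (hN : 0 < N) (s : Fin N) (Z : Finset (Fin N)) :
    (N : ℝ) * ∑ c : Finset (Fin N), slotLaw Λ c * ind (s ∈ c ∧ c.erase s ⊆ Z) =
      ∑ k ∈ Finset.range Λ.natDegree, Λ.coeff (k + 1) * (k + 1) *
        (((Z.erase s).card.choose k : ℝ) / ((N - 1).choose k : ℝ)) := by
  rw [sum_slotLaw_subset, Finset.mul_sum]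
  refine Finset.sum_congr rfl fun k _ => ?_
  rw [mul_left_comm, choose_div_choose_succ hN]
  ring

lemma sum_slotLaw_mem (hΛ : IsDegreeDistribution Λ) (hN : Λ.natDegree ≤ N) (s : Fin N) :
    ∑ c : Finset (Fin N), slotLaw Λ c * ind (s ∈ c) = avgDegree Λ / N := by
  have hD := hΛ.natDegree_pos
  have hN0 : 0 < N := by omega
  have hNr : (N : ℝ) ≠ 0 := by positivity
  rw [eq_div_iff hNr, mul_comm, avgDegree, eval_derivative_eq_sum hΛ]
  have := mul_sum_slotLaw_subset (Λ := Λ) hN0 s Finset.univ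
  simp only [Finset.subset_univ, and_true] at this
  rw [this]
  refine Finset.sum_congr rfl fun k hk => ?_
  have hk' := Finset.mem_range.1 hk
  rw [Finset.card_erase_of_mem (Finset.mem_univ s), Finset.card_univ, Fintype.card_fin, div_self,
    one_pow]
  have := Nat.choose_pos (show k ≤ N - 1 by omega)
  positivity

lemma sum_slotLaw_mem_mem (hΛ : IsDegreeDistribution Λ) (hN : 2 * Λ.natDegree + 2 ≤ N)
    {s s' : Fin N} (hs : s ≠ s') :
    ∑ c : Finset (Fin N), slotLaw Λ c * ind (s ∈ c ∧ s' ∈ c)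
      ≤ 2 * (Λ.natDegree : ℝ) ^ 2 / (N : ℝ) ^ 2 := by
  have hD := hΛ.natDegree_pos
  have hN0 : 0 < N := by omega
  have hNr : (0 : ℝ) < N := by positivity
  have h1 : ∑ c : Finset (Fin N), slotLaw Λ c * ind (s ∈ c ∧ s' ∈ c)
      = ∑ c : Finset (Fin N), slotLaw Λ c * ind (s ∈ c ∧ c.erase s ⊆ Finset.univ)
        - ∑ c : Finset (Fin N), slotLaw Λ c * ind (s ∈ c ∧ c.erase s ⊆ Finset.univ.erase s') := by
    rw [← Finset.sum_sub_distrib]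
    refine Finset.sum_congr rfl fun c _ => ?_
    have : (c.erase s ⊆ Finset.univ.erase s') ↔ s' ∉ c := by
      constructor
      · intro h hc
        exact (Finset.mem_erase.1 (h (Finset.mem_erase.2 ⟨hs.symm, hc⟩))).1 rfl
      · intro h t ht
        exact Finset.mem_erase.2 ⟨fun e => h (e ▸ (Finset.mem_erase.1 ht).2), Finset.mem_univ _⟩
    by_cases h2 : s ∈ c <;> by_cases h3 : s' ∈ c <;> simp [ind, this, h2, h3]
  rw [h1, le_div_iff₀ (by positivity)]
  rw [show ∀ a b : ℝ, (a - b) * (N : ℝ) ^ 2 = (N * a - N * b) * N from fun a b => by ring,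
    mul_sum_slotLaw_subset hN0, mul_sum_slotLaw_subset hN0, ← Finset.sum_sub_distrib,
    Finset.sum_mul]
  have hc1 : ((Finset.univ : Finset (Fin N)).erase s).card = N - 1 := by
    rw [Finset.card_erase_of_mem (Finset.mem_univ s), Finset.card_univ, Fintype.card_fin]
  have hc2 : ((Finset.univ.erase s').erase s).card = N - 2 := by
    rw [Finset.card_erase_of_mem (Finset.mem_erase.2 ⟨hs, Finset.mem_univ s⟩),
      Finset.card_erase_of_mem (Finset.mem_univ s'), Finset.card_univ, Fintype.card_fin]
    omega
  rw [hc1, hc2]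
  calc _ ≤ ∑ k ∈ Finset.range Λ.natDegree, Λ.coeff (k + 1) * (2 * (Λ.natDegree : ℝ) ^ 2) := by
        refine Finset.sum_le_sum fun k hk => ?_
        have hk' := Finset.mem_range.1 hk
        obtain ⟨n, hn⟩ : ∃ n, N = n + 2 := ⟨N - 2, by omega⟩
        have e1 : N - 1 = n + 1 := by omega
        have e2 : N - 2 = n := by omega
        rw [e1, e2]
        have hp : (0 : ℝ) < (n + 1).choose k := by
          have := Nat.choose_pos (show k ≤ n + 1 by omega)
          positivity
        have h := Nat.choose_mul_succ_eq n k
        have h' : (n.choose k : ℝ) * (n + 1) = (n + 1).choose k * (n + 1 - k) := by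
          rw [← Nat.cast_add_one, ← Nat.cast_sub (by omega)]
          exact_mod_cast h
        have hr : (n.choose k : ℝ) / (n + 1).choose k = 1 - k / (n + 1) := by
          rw [div_eq_iff hp.ne']
          field_simp
          linear_combination h'
        rw [div_self hp.ne', hr, hn]
        have hkD : ((k + 1 : ℕ) : ℝ) ≤ Λ.natDegree := by exact_mod_cast hk'
        push_cast at hkD ⊢
        have hn1 : ((n : ℝ) + 2) / (n + 1) ≤ 2 := by
          rw [div_le_iff₀ (by positivity)]
          have : (0 : ℝ) ≤ n := n.cast_nonneg
          linarith
        have hk0 : (0 : ℝ) ≤ k := k.cast_nonneg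
        calc _ = Λ.coeff (k + 1) * ((k + 1) * k * (((n : ℝ) + 2) / (n + 1))) := by
              field_simp
              ring
          _ ≤ _ := by
              refine mul_le_mul_of_nonneg_left ?_ (hΛ.nonneg _)
              calc ((k : ℝ) + 1) * k * (((n : ℝ) + 2) / (n + 1))
                  ≤ (Λ.natDegree * Λ.natDegree) * 2 := by
                    gcongr
                _ = _ := by ring
    _ = _ := by rw [← Finset.sum_mul, hΛ.sum_coeff_succ, one_mul]

/-- Drawing `k` slots without replacement is almost the same as drawing them with replacement. -/
lemma abs_choose_ratio_sub_pow_le (D Zc z k : ℕ) (hN : 2 * D + 2 ≤ N) (hk : k ≤ D)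
    (hz : z ≤ Zc) (hz' : Zc ≤ z + 1) (hzN : z + 1 ≤ N) (hZN : Zc ≤ N) :
    |(z.choose k : ℝ) / ((N - 1).choose k : ℝ) - ((Zc : ℝ) / N) ^ k| ≤ k * (2 * (D + 2) / N) := by
  have hN0 : (0 : ℝ) < N := by
    have : 0 < N := by omega
    positivity
  have hv0 : 0 ≤ (Zc : ℝ) / N := by positivity
  have hv1 : (Zc : ℝ) / N ≤ 1 := by
    rw [div_le_one hN0]
    exact_mod_cast hZN
  induction k with
  | zero => simp
  | succ k ih =>
    have ih := ih (by omega)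
    set v := (Zc : ℝ) / N with hv
    obtain ⟨n, hn⟩ : ∃ n, N = n + 1 := ⟨N - 1, by omega⟩
    have e1 : N - 1 = n := by omega
    rw [e1] at ih ⊢
    have hNn : (N : ℝ) = n + 1 := by rw [hn]; push_cast; ring
    have hkn : (k : ℝ) < n := by
      have : k < n := by omega
      exact_mod_cast this
    set r := (z.choose k : ℝ) / (n.choose k : ℝ)
    set c := ((z - k : ℕ) : ℝ) / ((n : ℝ) - k) with hc
    have hrc : (z.choose (k + 1) : ℝ) / (n.choose (k + 1) : ℝ) = r * c := by
      have h1 := Nat.choose_succ_right_eq z k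
      have h2 := Nat.choose_succ_right_eq n k
      have h1' : (z.choose (k + 1) : ℝ) * (k + 1) = z.choose k * ((z - k : ℕ) : ℝ) := by
        exact_mod_cast h1
      have h2' : (n.choose (k + 1) : ℝ) * (k + 1) = n.choose k * ((n : ℝ) - k) := by
        rw [← Nat.cast_sub (by omega)]
        exact_mod_cast h2
      have hk1 : ((k : ℝ) + 1) ≠ 0 := by positivity
      rw [← mul_div_mul_right _ _ hk1, h1', h2', mul_div_mul_comm]
    have hc0 : 0 ≤ c := div_nonneg (Nat.cast_nonneg _) (by linarith)
    have hc1 : c ≤ 1 := by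
      rw [hc, div_le_one (by linarith), ← Nat.cast_sub (by omega)]
      exact_mod_cast (show z - k ≤ n - k by omega)
    have hcv : |c - v| ≤ 2 * (D + 2) / N := by
      have hnk : (N : ℝ) / 2 ≤ n - k := by
        have : N ≤ 2 * (n - k) := by omega
        have h : (N : ℝ) ≤ 2 * ((n - k : ℕ) : ℝ) := by exact_mod_cast this
        rw [Nat.cast_sub (by omega)] at h
        linarith
      have hZ1 : (Zc : ℝ) ≤ z + 1 := by exact_mod_cast hz'
      have hZ0 : (z : ℝ) ≤ Zc := by exact_mod_cast hz
      have hkD : (k : ℝ) + 1 ≤ D := by exact_mod_cast hk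
      have hk0 : (0 : ℝ) ≤ k := k.cast_nonneg
      rcases le_or_gt k z with h | h
      · have hcz : c = ((z : ℝ) - k) / (n - k) := by rw [hc, Nat.cast_sub h]
        have hzn : (z : ℝ) + 1 ≤ n + 1 := by
          rw [← hNn]
          exact_mod_cast hzN
        have hZn : (Zc : ℝ) ≤ N := by exact_mod_cast hZN
        have hd : c - v = (N * ((z : ℝ) - Zc) - N * k + Zc * (1 + k)) / (N * (n - k)) := by
          rw [hcz, hv, div_sub_div _ _ (by linarith) hN0.ne']
          rw [mul_comm ((n : ℝ) - k) (N : ℝ)]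
          congr 1
          rw [hNn]
          ring
        have hZc0 : (0 : ℝ) ≤ Zc := Zc.cast_nonneg
        have hnum : |N * ((z : ℝ) - Zc) - N * k + Zc * (1 + k)| ≤ N * (D + 2) := by
          rw [abs_le]
          constructor <;> nlinarith
        rw [hd, abs_div, abs_of_pos (mul_pos hN0 (by linarith) : (0 : ℝ) < N * (n - k))]
        rw [div_le_div_iff₀ (mul_pos hN0 (by linarith)) hN0]
        calc |N * ((z : ℝ) - Zc) - N * k + Zc * (1 + k)| * N ≤ N * (D + 2) * N := by gcongr
          _ = 2 * (D + 2) * (N * (N / 2)) := by ring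
          _ ≤ 2 * (D + 2) * (N * (n - k)) := by gcongr
      · have hcz : c = 0 := by
          rw [hc, Nat.sub_eq_zero_of_le h.le, Nat.cast_zero, zero_div]
        have hzk : (z : ℝ) + 1 ≤ k := by exact_mod_cast h
        rw [hcz, zero_sub, abs_neg, abs_of_nonneg hv0, hv]
        gcongr
        linarith
    rw [hrc, show r * c - v ^ (k + 1) = (r - v ^ k) * c + v ^ k * (c - v) by ring]
    calc |(r - v ^ k) * c + v ^ k * (c - v)|
        ≤ |r - v ^ k| * c + v ^ k * |c - v| := by
          refine (abs_add_le _ _).trans_eq ?_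
          rw [abs_mul, abs_mul, abs_of_nonneg hc0, abs_of_nonneg (pow_nonneg hv0 k)]
      _ ≤ |r - v ^ k| * 1 + 1 * |c - v| := by
          gcongr
          exact pow_le_one₀ hv0 hv1
      _ ≤ k * (2 * (D + 2) / N) * 1 + 1 * (2 * (D + 2) / N) := by gcongr
      _ = _ := by push_cast; ring

/-- If `Z` is the set of blocked slots, a user in slot `s` all of whose other slots are blocked
occurs with probability close to `Λ' (|Z| / N) / N`. -/
lemma abs_mul_sum_slotLaw_subset_sub_le (hΛ : IsDegreeDistribution Λ)
    (hN : 2 * Λ.natDegree + 2 ≤ N) (s : Fin N) (Z : Finset (Fin N)) :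
    |(N : ℝ) * ∑ c : Finset (Fin N), slotLaw Λ c * ind (s ∈ c ∧ c.erase s ⊆ Z)
      - Λ.derivative.eval ((Z.card : ℝ) / N)| ≤
      (Λ.natDegree : ℝ) ^ 2 * (2 * (Λ.natDegree + 2) / N) := by
  have hN0 : 0 < N := by omega
  rw [mul_sum_slotLaw_subset hN0, eval_derivative_eq_sum hΛ, ← Finset.sum_sub_distrib]
  refine (Finset.abs_sum_le_sum_abs _ _).trans ?_
  have hZ : Z.card ≤ N := by simpa using Finset.card_le_univ Z
  have hz1 : (Z.erase s).card ≤ Z.card := Finset.card_le_card (Finset.erase_subset _ _)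
  have hz2 : Z.card ≤ (Z.erase s).card + 1 := by
    have := Finset.pred_card_le_card_erase (s := Z) (a := s)
    omega
  have hz3 : (Z.erase s).card + 1 ≤ N := by
    have h : (Z.erase s).card < (Finset.univ : Finset (Fin N)).card :=
      Finset.card_lt_card ⟨Finset.subset_univ _,
        fun h => Finset.notMem_erase s Z (h (Finset.mem_univ s))⟩
    rw [Finset.card_univ, Fintype.card_fin] at h
    exact h
  calc _ ≤ ∑ k ∈ Finset.range Λ.natDegree, Λ.coeff (k + 1) *
        ((Λ.natDegree : ℝ) ^ 2 * (2 * (Λ.natDegree + 2) / N)) := by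
        refine Finset.sum_le_sum fun k hk => ?_
        have hk' := Finset.mem_range.1 hk
        have h := abs_choose_ratio_sub_pow_le Λ.natDegree Z.card (Z.erase s).card k hN hk'.le
          hz1 hz2 hz3 hZ
        have hkD : (k : ℝ) + 1 ≤ Λ.natDegree := by exact_mod_cast hk'
        have hk0 : (0 : ℝ) ≤ k := k.cast_nonneg
        rw [← mul_sub, abs_mul, abs_mul, abs_of_nonneg (hΛ.nonneg _),
          abs_of_nonneg (by linarith : (0 : ℝ) ≤ (k : ℝ) + 1), mul_assoc]
        refine mul_le_mul_of_nonneg_left ?_ (hΛ.nonneg _)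
        calc _ ≤ (Λ.natDegree : ℝ) * (Λ.natDegree * (2 * (Λ.natDegree + 2) / N)) := by
              gcongr
              refine h.trans ?_
              gcongr
          _ = _ := by ring
    _ = _ := by rw [← Finset.sum_mul, hΛ.sum_coeff_succ, one_mul]

end SlotLaw

/-! ### Almost independence of the branches of message passing -/

/-- The filter of pairs `(a, N)` where the number `N` of slots tends to infinity and the number
`a` of users is such that `a / N` tends to `ρ`. -/
def loadFilter (ρ : ℝ) : Filter (ℕ × ℕ) :=
  comap (fun p : ℕ × ℕ => (p.2, (p.1 : ℝ) / p.2)) (atTop ×ˢ 𝓝 ρ)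

section LoadFilter

variable {ρ : ℝ}

lemma tendsto_snd_loadFilter : Tendsto (fun p : ℕ × ℕ => p.2) (loadFilter ρ) atTop :=
  tendsto_fst.comp tendsto_comap

lemma tendsto_ratio_loadFilter :
    Tendsto (fun p : ℕ × ℕ => (p.1 : ℝ) / p.2) (loadFilter ρ) (𝓝 ρ) :=
  tendsto_snd.comp (tendsto_comap (f := fun p : ℕ × ℕ => (p.2, (p.1 : ℝ) / p.2)))

lemma tendsto_const_div_loadFilter (C : ℝ) :
    Tendsto (fun p : ℕ × ℕ => C / (p.2 : ℝ)) (loadFilter ρ) (𝓝 0) :=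
  (tendsto_const_div_atTop_nhds_zero_nat C).comp tendsto_snd_loadFilter

lemma eventually_const_div_le (C : ℝ) {ε : ℝ} (hε : 0 < ε) :
    ∀ᶠ p : ℕ × ℕ in loadFilter ρ, C / (p.2 : ℝ) ≤ ε :=
  (tendsto_const_div_loadFilter C).eventually (eventually_le_nhds hε)

lemma tendsto_pred_loadFilter :
    Tendsto (fun p : ℕ × ℕ => (p.1 - 1, p.2)) (loadFilter ρ) (loadFilter ρ) := by
  refine tendsto_comap_iff.2 (Tendsto.prodMk tendsto_snd_loadFilter ?_)
  have h0 := tendsto_const_div_loadFilter (ρ := ρ) 1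
  refine tendsto_of_tendsto_of_tendsto_of_le_of_le
    (by simpa using tendsto_ratio_loadFilter.sub h0) tendsto_ratio_loadFilter (fun p => ?_)
    (fun p => ?_)
  · rw [inv_eq_one_div, ← sub_div]
    simp only
    gcongr
    rw [sub_le_iff_le_add]
    exact_mod_cast (show p.1 ≤ p.1 - 1 + 1 by omega)
  · simp only
    gcongr
    omega

end LoadFilter

section Estimates

variable {T : ℕ} {Λ : Polynomial ℝ} {M N : ℕ}

/-- The probability that slot `s` is blocked. -/
def blockProb (T : ℕ) (Λ : Polynomial ℝ) {M N : ℕ} (ℓ : ℕ) (s : Fin N) (V : Finset (Fin M))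
    (F : Finset (Fin N)) : ℝ :=
  expect (slotLaw Λ) fun S : Fin M → Finset (Fin N) => ind (SlotBlocked T S ℓ s V F)

open Classical in
/-- The set of slots that are blocked for an additional user in this slot only. -/
def blockedSlots (T : ℕ) {M N : ℕ} (S : Fin M → Finset (Fin N)) (ℓ : ℕ) (V : Finset (Fin M)) :
    Finset (Fin N) :=
  Finset.univ.filter fun s => SlotBlocked T S ℓ s V {s}

lemma mem_blockedSlots {S : Fin M → Finset (Fin N)} {ℓ : ℕ} {V : Finset (Fin M)} {s : Fin N} :
    s ∈ blockedSlots T S ℓ V ↔ SlotBlocked T S ℓ s V {s} := by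
  simp [blockedSlots]

lemma update_eq_of_mem_erase {α β : Type*} [DecidableEq α] (f : α → β) (i : α) (b : β)
    {V : Finset α} {j : α} (hj : j ∈ V.erase i) : Function.update f i b j = f j :=
  Function.update_of_ne (Finset.ne_of_mem_erase hj) _ _

lemma blockedSlots_update (S : Fin M → Finset (Fin N)) (ℓ : ℕ) (V : Finset (Fin M)) (i : Fin M)
    (R : Finset (Fin N)) :
    blockedSlots T (Function.update S i R) ℓ (V.erase i) = blockedSlots T S ℓ (V.erase i) := by
  ext s
  rw [mem_blockedSlots, mem_blockedSlots]
  exact slotBlocked_congr fun j hj => update_eq_of_mem_erase S i R hj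

/-- The indicator that some property holds of a pair but fails after shrinking is bounded by the
sum of differences of indicators. -/
lemma ind_forall_not_forall_le {α : Type*} (A : Finset α) {p q : α → Prop}
    (hqp : ∀ a ∈ A, q a → p a) :
    ind ((∀ a ∈ A, p a) ∧ ¬ ∀ a ∈ A, q a) ≤ ∑ a ∈ A, (ind (p a) - ind (q a)) := by
  by_cases h : (∀ a ∈ A, p a) ∧ ¬ ∀ a ∈ A, q a
  · have h1 : ind ((∀ a ∈ A, p a) ∧ ¬ ∀ a ∈ A, q a) = 1 := ind_of h
    obtain ⟨hp, hq⟩ := h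
    push Not at hq
    obtain ⟨a, ha, hqa⟩ := hq
    rw [h1]
    calc (1 : ℝ) = ind (p a) - ind (q a) := by rw [ind_of (hp a ha), ind_of_not hqa, sub_zero]
      _ ≤ _ := Finset.single_le_sum (f := fun a => ind (p a) - ind (q a))
        (fun b hb => sub_nonneg.2 (ind_mono (hqp b hb))) ha
  · rw [ind_of_not h]
    exact Finset.sum_nonneg fun b hb => sub_nonneg.2 (ind_mono (hqp b hb))

lemma sum_expect_ind_sub_le {Y ε : ℝ} {D : ℕ} (hε : 0 ≤ ε)
    {ℓ : ℕ} {V : Finset (Fin M)} {A : Finset (Fin N)} (hA : A.card ≤ D)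
    {F F' : Fin N → Finset (Fin N)}
    (h : ∀ s ∈ A, |blockProb T Λ ℓ s V (F s) - Y| ≤ ε)
    (h' : ∀ s ∈ A, |blockProb T Λ ℓ s V (F' s) - Y| ≤ ε) :
    ∑ s ∈ A, (blockProb T Λ ℓ s V (F s) - blockProb T Λ ℓ s V (F' s)) ≤ D * (2 * ε) := by
  calc _ ≤ ∑ s ∈ A, 2 * ε := Finset.sum_le_sum fun s hs => by
        have := abs_le.1 (h s hs)
        have := abs_le.1 (h' s hs)
        linarith
    _ = A.card * (2 * ε) := by rw [Finset.sum_const, nsmul_eq_mul]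
    _ ≤ _ := by gcongr

/-- A user in slot `s` is rarely blocked unless all its other slots are blocked in the system
without this user. -/
lemma expect_userBlocked_not_subset_le (hΛ : IsDegreeDistribution Λ)
    (hN : 2 * Λ.natDegree + 2 ≤ N) {ℓ b : ℕ} {Y ε : ℝ} (hε : 0 ≤ ε) {V : Finset (Fin M)}
    {i : Fin M}
    (h : ∀ (s : Fin N) (F : Finset (Fin N)), s ∈ F → F.card ≤ b + Λ.natDegree →
      |blockProb T Λ ℓ s (V.erase i) F - Y| ≤ ε)
    {s : Fin N} {F : Finset (Fin N)} (hs : s ∈ F) (hF : F.card ≤ b) :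
    expect (slotLaw Λ) (fun S : Fin M → Finset (Fin N) => ind ((s ∈ S i ∧ UserBlocked T S ℓ i V F) ∧
        ¬ (s ∈ S i ∧ (S i).erase s ⊆ blockedSlots T S ℓ (V.erase i)))) ≤
      b * (2 * (Λ.natDegree : ℝ) ^ 2 / (N : ℝ) ^ 2)
        + avgDegree Λ / N * (Λ.natDegree * (2 * ε)) := by
  have hD := hΛ.natDegree_pos
  have hlaw : IsLaw (slotLaw Λ : Finset (Fin N) → ℝ) := isLaw_slotLaw hΛ (by omega)
  rw [expect_resample hlaw i]
  simp only [Function.update_self, blockedSlots_update]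
  have hb : 1 ≤ b := (Finset.card_pos.2 ⟨s, hs⟩).trans_le hF
  have key : ∀ R : Finset (Fin N), slotLaw Λ R * expect (slotLaw Λ)
      (fun S : Fin M → Finset (Fin N) =>
        ind ((s ∈ R ∧ UserBlocked T (Function.update S i R) ℓ i V F)
        ∧ ¬ (s ∈ R ∧ R.erase s ⊆ blockedSlots T S ℓ (V.erase i)))) ≤
      ∑ f ∈ F.erase s, slotLaw Λ R * ind (s ∈ R ∧ f ∈ R)
        + slotLaw Λ R * ind (s ∈ R) * (Λ.natDegree * (2 * ε)) := by
    intro R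
    by_cases hR : slotLaw Λ R = 0
    · simp [hR]
    rw [← Finset.mul_sum, mul_assoc, ← mul_add]
    refine mul_le_mul_of_nonneg_left ?_ (slotLaw_nonneg hΛ R)
    have hRc := card_le_of_slotLaw_ne_zero hR
    by_cases hsR : s ∈ R
    swap
    · simp only [hsR, false_and]
      rw [ind_of_not not_false, expect_const hlaw]
      simp
    by_cases hf : ∃ f ∈ F.erase s, f ∈ R
    · calc _ ≤ (1 : ℝ) := expect_le_one hlaw fun _ => ind_le_one _
        _ ≤ ∑ f ∈ F.erase s, ind (s ∈ R ∧ f ∈ R) := by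
          refine le_trans (le_of_eq ?_) (ind_exists_le_sum _ _)
          rw [ind_of]
          obtain ⟨f, hf, hfR⟩ := hf
          exact ⟨f, hf, hsR, hfR⟩
        _ ≤ _ := le_add_of_nonneg_right (mul_nonneg (ind_nonneg _) (by positivity))
    · have hRF : R.erase s = R \ F := by
        ext t
        rw [Finset.mem_erase, Finset.mem_sdiff]
        constructor
        · rintro ⟨h1, h2⟩
          exact ⟨h2, fun h3 => hf ⟨t, Finset.mem_erase.2 ⟨h1, h3⟩, h2⟩⟩
        · rintro ⟨h1, h2⟩
          exact ⟨fun h3 => h2 (h3 ▸ hs), h1⟩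
      refine le_trans ?_ (le_add_of_nonneg_left (Finset.sum_nonneg fun f _ => ind_nonneg _))
      rw [ind_of hsR, one_mul]
      have hcard : (R \ F).card ≤ Λ.natDegree := (Finset.card_le_card Finset.sdiff_subset).trans hRc
      refine le_trans ?_ (sum_expect_ind_sub_le (T := T) (Λ := Λ) (M := M) (V := V.erase i)
        (ℓ := ℓ) (Y := Y) hε hcard (F := fun _ => F ∪ R) (F' := fun s' => {s'}) ?_ ?_)
      · simp only [blockProb, ← expect_sub]
        rw [← expect_sum]
        refine expect_mono hlaw fun S => ?_
        refine le_trans (ind_mono ?_) (ind_forall_not_forall_le (R \ F) fun s' hs' h' =>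
          SlotBlocked.mono (T := T) (S := S) (ℓ := ℓ) (F := {s'}) (F' := F ∪ R) subset_rfl
            (Finset.singleton_subset_iff.2
              (Finset.mem_union_right _ (Finset.mem_sdiff.1 hs').1)) h')
        rintro ⟨⟨_, h1⟩, h2⟩
        refine ⟨fun s' hs' => ?_, fun h3 => h2 ⟨hsR, fun s' hs' => ?_⟩⟩
        · have := h1 s' (by rwa [Function.update_self])
          rw [Function.update_self] at this
          exact (slotBlocked_congr fun j hj => update_eq_of_mem_erase S i R hj).1 this
        · rw [hRF] at hs'
          exact mem_blockedSlots.2 (h3 s' hs')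
      · intro s' hs'
        exact h s' _ (Finset.mem_union_right _ (Finset.mem_sdiff.1 hs').1)
          ((Finset.card_union_le _ _).trans (by omega))
      · intro s' hs'
        exact h s' _ (Finset.mem_singleton_self _) (by rw [Finset.card_singleton]; omega)
  refine (Finset.sum_le_sum fun R _ => key R).trans ?_
  rw [Finset.sum_add_distrib, Finset.sum_comm, ← Finset.sum_mul, sum_slotLaw_mem hΛ (by omega)]
  refine add_le_add ?_ le_rfl
  calc _ ≤ ∑ f ∈ F.erase s, 2 * (Λ.natDegree : ℝ) ^ 2 / (N : ℝ) ^ 2 :=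
        Finset.sum_le_sum fun f hf => sum_slotLaw_mem_mem hΛ hN (Finset.ne_of_mem_erase hf).symm
    _ = (F.erase s).card * (2 * (Λ.natDegree : ℝ) ^ 2 / (N : ℝ) ^ 2) := by
        rw [Finset.sum_const, nsmul_eq_mul]
    _ ≤ _ := by
        have : (F.erase s).card ≤ b := (Finset.card_le_card (Finset.erase_subset _ _)).trans hF
        gcongr

/-- Removing a user `j` in slot `s` rarely unblocks a user `i` in slot `s₂`. -/
lemma expect_userBlocked_not_erase_le (hΛ : IsDegreeDistribution Λ)
    (hN : 2 * Λ.natDegree + 2 ≤ N) {ℓ b : ℕ} {Y ε : ℝ} (hε : 0 ≤ ε) {V : Finset (Fin M)}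
    {i j : Fin M} (hij : i ≠ j)
    (h : ∀ (s : Fin N) (F : Finset (Fin N)), s ∈ F → F.card ≤ b + 2 * Λ.natDegree →
      |blockProb T Λ ℓ s ((V.erase j).erase i) F - Y| ≤ ε)
    {s s₂ : Fin N} {F : Finset (Fin N)} (hs : s₂ ∈ F) (hF : F.card ≤ b) :
    expect (slotLaw Λ) (fun S : Fin M → Finset (Fin N) => ind (s ∈ S j ∧ s₂ ∈ S i ∧
        UserBlocked T S ℓ i V F ∧ ¬ UserBlocked T S ℓ i (V.erase j) F)) ≤
      avgDegree Λ / N * (Λ.natDegree * (2 * (Λ.natDegree : ℝ) ^ 2 / (N : ℝ) ^ 2)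
        + avgDegree Λ / N * (Λ.natDegree * (2 * ε))) := by
  have hD := hΛ.natDegree_pos
  have hlaw : IsLaw (slotLaw Λ : Finset (Fin N) → ℝ) := isLaw_slotLaw hΛ (by omega)
  rw [expect_resample hlaw j]
  rw [← sum_slotLaw_mem hΛ (by omega) s, Finset.sum_mul]
  refine Finset.sum_le_sum fun R _ => ?_
  by_cases hR : slotLaw Λ R = 0
  · simp [hR]
  have hRc := card_le_of_slotLaw_ne_zero hR
  rw [mul_assoc]
  refine mul_le_mul_of_nonneg_left ?_ (slotLaw_nonneg hΛ R)
  simp only [Function.update_self]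
  by_cases hsR : s ∈ R
  swap
  · simp only [hsR, false_and]
    rw [ind_of_not not_false, expect_const hlaw, zero_mul]
  rw [ind_of hsR, one_mul, expect_resample hlaw i]
  -- the law of the slots of `i`, given that they meet `s₂` and maybe a second slot of `j`
  have key : ∀ Q : Finset (Fin N), slotLaw Λ Q * expect (slotLaw Λ)
      (fun S : Fin M → Finset (Fin N) =>
        ind (s ∈ R ∧ s₂ ∈ Function.update (Function.update S i Q) j R i ∧
        UserBlocked T (Function.update (Function.update S i Q) j R) ℓ i V F ∧
        ¬ UserBlocked T (Function.update (Function.update S i Q) j R) ℓ i (V.erase j) F)) ≤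
      ∑ r ∈ R \ F, slotLaw Λ Q * ind (s₂ ∈ Q ∧ r ∈ Q)
        + slotLaw Λ Q * ind (s₂ ∈ Q) * (Λ.natDegree * (2 * ε)) := by
    intro Q
    by_cases hQ : slotLaw Λ Q = 0
    · simp [hQ]
    have hQc := card_le_of_slotLaw_ne_zero hQ
    rw [← Finset.mul_sum, mul_assoc, ← mul_add]
    refine mul_le_mul_of_nonneg_left ?_ (slotLaw_nonneg hΛ Q)
    have hi : ∀ S : Fin M → Finset (Fin N),
        Function.update (Function.update S i Q) j R i = Q := fun S => by
      rw [Function.update_of_ne hij, Function.update_self]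
    simp only [hi]
    by_cases hsQ : s₂ ∈ Q
    swap
    · simp only [hsQ, false_and, and_false]
      rw [ind_of_not not_false, expect_const hlaw]
      simp
    by_cases hf : ∃ r ∈ R \ F, r ∈ Q
    · calc _ ≤ (1 : ℝ) := expect_le_one hlaw fun _ => ind_le_one _
        _ ≤ ∑ r ∈ R \ F, ind (s₂ ∈ Q ∧ r ∈ Q) := by
          refine le_trans (le_of_eq ?_) (ind_exists_le_sum _ _)
          rw [ind_of]
          obtain ⟨f, hf, hfR⟩ := hf
          exact ⟨f, hf, hsQ, hfR⟩
        _ ≤ _ := le_add_of_nonneg_right (mul_nonneg (ind_nonneg _) (by positivity))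
    · refine le_trans ?_ (le_add_of_nonneg_left (Finset.sum_nonneg fun f _ => ind_nonneg _))
      rw [ind_of hsQ, one_mul]
      have hcard : (Q \ F).card ≤ Λ.natDegree := (Finset.card_le_card Finset.sdiff_subset).trans hQc
      refine le_trans ?_ (sum_expect_ind_sub_le (T := T) (Λ := Λ) (M := M)
        (V := (V.erase j).erase i)
        (ℓ := ℓ) (Y := Y) hε hcard (F := fun _ => F ∪ Q ∪ R) (F' := fun _ => F ∪ Q) ?_ ?_)
      · simp only [blockProb, ← expect_sub]
        rw [← expect_sum]
        refine expect_mono hlaw fun S => ?_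
        refine le_trans (ind_mono ?_) (ind_forall_not_forall_le (Q \ F) fun s' hs' h' =>
          SlotBlocked.mono (T := T) (S := S) (ℓ := ℓ) (F := F ∪ Q) (F' := F ∪ Q ∪ R) subset_rfl
            Finset.subset_union_left h')
        have hcongr : ∀ k ∈ (V.erase j).erase i,
            Function.update (Function.update S i Q) j R k = S k := fun k hk => by
          rw [Function.update_of_ne (Finset.ne_of_mem_erase (Finset.mem_of_mem_erase hk)),
            Function.update_of_ne (Finset.ne_of_mem_erase hk)]
        rintro ⟨_, _, h1, h2⟩
        refine ⟨fun s' hs' => ?_, fun h3 => h2 fun s' hs' => ?_⟩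
        · have h4 := h1 s' (by rwa [hi])
          rw [hi] at h4
          replace h4 := h4.mono (subset_refl _) (Finset.subset_union_left (s₂ := R))
          have hs'R : s' ∉ R := fun hr => by
            rw [Finset.mem_sdiff] at hs'
            exact hf ⟨s', Finset.mem_sdiff.2 ⟨hr, hs'.2⟩, hs'.1⟩
          rw [slotBlocked_erase (j := j)
            (by rw [Function.update_self]; exact Finset.subset_union_right)
            (by rwa [Function.update_self]), Finset.erase_right_comm] at h4
          exact (slotBlocked_congr hcongr).1 h4
        · rw [hi] at hs' ⊢
          exact (slotBlocked_congr hcongr).2 (h3 s' hs')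
      · intro s' hs'
        refine h s' _
          (Finset.mem_union_left _ (Finset.mem_union_right _ (Finset.mem_sdiff.1 hs').1)) ?_
        have h1 := Finset.card_union_le (F ∪ Q) R
        have h2 := Finset.card_union_le F Q
        omega
      · intro s' hs'
        refine h s' _ (Finset.mem_union_right _ (Finset.mem_sdiff.1 hs').1) ?_
        have h2 := Finset.card_union_le F Q
        omega
  refine (Finset.sum_le_sum fun Q _ => key Q).trans ?_
  rw [Finset.sum_add_distrib, Finset.sum_comm, ← Finset.sum_mul, sum_slotLaw_mem hΛ (by omega) s₂,
    sum_slotLaw_mem hΛ (by omega) s]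
  refine add_le_add ?_ le_rfl
  calc _ ≤ ∑ r ∈ R \ F, 2 * (Λ.natDegree : ℝ) ^ 2 / (N : ℝ) ^ 2 :=
        Finset.sum_le_sum fun r hr => sum_slotLaw_mem_mem hΛ hN (by
          rintro rfl
          exact (Finset.mem_sdiff.1 hr).2 hs)
    _ = (R \ F).card * (2 * (Λ.natDegree : ℝ) ^ 2 / (N : ℝ) ^ 2) := by
        rw [Finset.sum_const, nsmul_eq_mul]
    _ ≤ _ := by
        have : (R \ F).card ≤ Λ.natDegree := (Finset.card_le_card Finset.sdiff_subset).trans hRc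
        gcongr

end Estimates

/-! ### A Poisson limit from the Chen–Stein recursion -/

/-- The probability that a Poisson variable with mean `m` is at least `T`. -/
def poissonTail (T : ℕ) (m : ℝ) : ℝ :=
  1 - Real.exp (-m) * ∑ u ∈ Finset.range T, m ^ u / (u.factorial : ℝ)

lemma poissonTail_nonneg (T : ℕ) {m : ℝ} (hm : 0 ≤ m) : 0 ≤ poissonTail T m := by
  have h := Real.sum_le_exp_of_nonneg hm T
  have : Real.exp (-m) * ∑ u ∈ Finset.range T, m ^ u / (u.factorial : ℝ)
      ≤ Real.exp (-m) * Real.exp m := by gcongr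
  rw [← Real.exp_add, neg_add_cancel, Real.exp_zero] at this
  unfold poissonTail
  linarith

lemma poissonTail_le_one (T : ℕ) {m : ℝ} (hm : 0 ≤ m) : poissonTail T m ≤ 1 := by
  have : 0 ≤ Real.exp (-m) * ∑ u ∈ Finset.range T, m ^ u / (u.factorial : ℝ) := by positivity
  unfold poissonTail
  linarith

lemma continuous_poissonTail (T : ℕ) : Continuous (poissonTail T) := by
  unfold poissonTail
  fun_prop

/-- A nonnegative sequence that nearly satisfies the recursion `(k + 1) P (k + 1) = m P k` of the
Poisson weights, and whose sum is nearly `Φ`, is close to `Φ` times the Poisson weights. -/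
lemma exists_abs_sub_poissonTail_le {m : ℝ} (hm : 0 ≤ m) (T : ℕ) (C : ℝ) {ε : ℝ} (hε : 0 < ε) :
    ∃ (K : ℕ) (η : ℝ), 0 < η ∧ ∀ (P : ℕ → ℝ) (Φ : ℝ), 0 ≤ P 0 → P 0 ≤ 1 →
      (∀ k < K, |((k : ℝ) + 1) * P (k + 1) - m * P k| ≤ η) →
      (∀ k, |Φ - ∑ j ∈ Finset.range k, P j| * k ≤ C) →
      |Φ - ∑ j ∈ Finset.range T, P j - Φ * poissonTail T m| ≤ ε := by
  have hexp : Tendsto (fun n => ∑ u ∈ Finset.range n, m ^ u / (u.factorial : ℝ)) atTop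
      (𝓝 (Real.exp m)) := by
    rw [Real.exp_eq_exp_ℝ]
    exact (NormedSpace.expSeries_div_hasSum_exp m).tendsto_sum_nat
  have h1 : ∀ᶠ n : ℕ in atTop,
      |Real.exp m - ∑ u ∈ Finset.range n, m ^ u / (u.factorial : ℝ)| ≤ ε / 4 := by
    have := (Metric.tendsto_nhds.1 hexp (ε / 4) (by positivity))
    filter_upwards [this] with n hn
    rw [dist_comm, Real.dist_eq] at hn
    exact hn.le
  have h2 : ∀ᶠ n : ℕ in atTop, C / (n : ℝ) ≤ ε / 4 :=
    (tendsto_const_div_atTop_nhds_zero_nat C).eventually (eventually_le_nhds (by positivity))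
  obtain ⟨K, hK1, hK2, hKT, hK0⟩ :=
    (h1.and (h2.and ((eventually_ge_atTop T).and (eventually_gt_atTop 0)))).exists
  have hm1 : (1 : ℝ) ≤ 1 + m := by linarith
  set A : ℝ := K * (1 + m) ^ K with hA
  have hKr : (0 : ℝ) < K := by exact_mod_cast hK0
  have hA0 : 0 < A := by positivity
  refine ⟨K, ε / (4 * K * A), by positivity, fun P Φ hP0 hP1 hrec hsum => ?_⟩
  set η := ε / (4 * K * A) with hη
  have hη0 : 0 < η := by positivity
  have herr : ∀ k ≤ K, |P k - m ^ k / (k.factorial : ℝ) * P 0| ≤ η * (k * (1 + m) ^ k) := by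
    intro k
    induction k with
    | zero => intro _; simp
    | succ k ih =>
      intro hk
      have ih := ih (by omega)
      have hr := hrec k (by omega)
      have hk1 : (1 : ℝ) ≤ (k : ℝ) + 1 := by
        have : (0 : ℝ) ≤ k := k.cast_nonneg
        linarith
      have hfac : m ^ (k + 1) / ((k + 1).factorial : ℝ) * P 0 * ((k : ℝ) + 1)
          = m * (m ^ k / (k.factorial : ℝ) * P 0) := by
        rw [Nat.factorial_succ]
        push_cast
        field_simp
        ring
      have h3 : |P (k + 1) - m ^ (k + 1) / ((k + 1).factorial : ℝ) * P 0|
          ≤ |(P (k + 1) - m ^ (k + 1) / ((k + 1).factorial : ℝ) * P 0) * ((k : ℝ) + 1)| := by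
        rw [abs_mul, abs_of_nonneg (by linarith : (0 : ℝ) ≤ (k : ℝ) + 1)]
        exact le_mul_of_one_le_right (abs_nonneg _) hk1
      refine h3.trans ?_
      rw [sub_mul, hfac, show P (k + 1) * ((k : ℝ) + 1) - m * (m ^ k / (k.factorial : ℝ) * P 0)
        = (((k : ℝ) + 1) * P (k + 1) - m * P k)
          + m * (P k - m ^ k / (k.factorial : ℝ) * P 0) by ring]
      refine (abs_add_le _ _).trans ?_
      rw [abs_mul, abs_of_nonneg hm]
      have hpow : (1 : ℝ) ≤ (1 + m) ^ (k + 1) := one_le_pow₀ hm1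
      calc _ ≤ η + m * (η * (k * (1 + m) ^ k)) := by gcongr
        _ ≤ η * (1 + m) ^ (k + 1) + (1 + m) * (η * (k * (1 + m) ^ k)) := by
          gcongr
          · exact le_mul_of_one_le_right hη0.le hpow
          · linarith
        _ = _ := by push_cast; ring
  have herr' : ∀ n ≤ K, |∑ j ∈ Finset.range n, P j
      - (∑ j ∈ Finset.range n, m ^ j / (j.factorial : ℝ)) * P 0| ≤ ε / 4 := by
    intro n hn
    rw [Finset.sum_mul, ← Finset.sum_sub_distrib]
    calc _ ≤ ∑ j ∈ Finset.range n, |P j - m ^ j / (j.factorial : ℝ) * P 0| :=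
          Finset.abs_sum_le_sum_abs _ _
      _ ≤ ∑ j ∈ Finset.range n, η * A := by
          refine Finset.sum_le_sum fun j hj => ?_
          have hj' : j ≤ K := (Finset.mem_range.1 hj).le.trans hn
          refine (herr j hj').trans ?_
          rw [hA]
          gcongr
      _ = n * (η * A) := by rw [Finset.sum_const, Finset.card_range, nsmul_eq_mul]
      _ ≤ K * (η * A) := by gcongr
      _ = ε / 4 := by rw [hη]; field_simp
  have hKs : |Φ - ∑ j ∈ Finset.range K, P j| ≤ ε / 4 := by
    refine le_trans ?_ hK2
    rw [le_div_iff₀ hKr]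
    exact hsum K
  have hmain : |Φ - Real.exp m * P 0| ≤ ε * 3 / 4 := by
    have e : Φ - Real.exp m * P 0 = (Φ - ∑ j ∈ Finset.range K, P j)
        + (∑ j ∈ Finset.range K, P j - (∑ j ∈ Finset.range K, m ^ j / (j.factorial : ℝ)) * P 0)
        - (Real.exp m - ∑ j ∈ Finset.range K, m ^ j / (j.factorial : ℝ)) * P 0 := by ring
    rw [e]
    refine (abs_sub _ _).trans ?_
    refine (add_le_add (abs_add_le _ _) le_rfl).trans ?_
    rw [abs_mul, abs_of_nonneg hP0]
    have h5 : |Real.exp m - ∑ j ∈ Finset.range K, m ^ j / (j.factorial : ℝ)| * P 0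
        ≤ ε / 4 * 1 := by gcongr
    have := herr' K le_rfl
    linarith
  set s := ∑ j ∈ Finset.range T, m ^ j / (j.factorial : ℝ) with hs
  have hs0 : 0 ≤ Real.exp (-m) * s := by positivity
  have hs1 : Real.exp (-m) * s ≤ 1 := by
    have := poissonTail_nonneg T hm
    unfold poissonTail at this
    linarith
  have e : Φ - ∑ j ∈ Finset.range T, P j - Φ * poissonTail T m
      = Real.exp (-m) * s * (Φ - Real.exp m * P 0) - (∑ j ∈ Finset.range T, P j - s * P 0) := by
    have : Real.exp (-m) * Real.exp m = 1 := by
      rw [← Real.exp_add, neg_add_cancel, Real.exp_zero]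
    unfold poissonTail
    rw [← hs]
    linear_combination s * P 0 * this
  rw [e]
  refine (abs_sub _ _).trans ?_
  rw [abs_mul, abs_of_nonneg hs0]
  have h6 : Real.exp (-m) * s * |Φ - Real.exp m * P 0| ≤ 1 * (ε * 3 / 4) := by gcongr
  have := herr' T hKT
  linarith

/-! ### Density evolution: one more round of message passing -/

/-- In the limit of `ρ` users per slot, a slot is blocked at depth `ℓ` with probability `Y`,
whatever bounded set of slots is excluded. -/
def SlotLimit (T : ℕ) (Λ : Polynomial ℝ) (ρ : ℝ) (ℓ : ℕ) (Y : ℝ) : Prop :=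
  ∀ (b : ℕ) (ε : ℝ), 0 < ε → ∀ᶠ p : ℕ × ℕ in loadFilter ρ, ∀ (M : ℕ) (V : Finset (Fin M)),
    V.card = p.1 → ∀ (s : Fin p.2) (F : Finset (Fin p.2)), s ∈ F → F.card ≤ b →
      |blockProb T Λ ℓ s V F - Y| ≤ ε

/-- In the limit of `ρ` users per slot, different slots are blocked independently. -/
def PairLimit (T : ℕ) (Λ : Polynomial ℝ) (ρ : ℝ) (ℓ : ℕ) (Y : ℝ) : Prop :=
  ∀ ε : ℝ, 0 < ε → ∀ᶠ p : ℕ × ℕ in loadFilter ρ, ∀ (M : ℕ) (V : Finset (Fin M)),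
    V.card = p.1 → ∀ s s₂ : Fin p.2, s ≠ s₂ →
      |expect (slotLaw Λ) (fun S : Fin M → Finset (Fin p.2) =>
        ind (SlotBlocked T S ℓ s V {s}) * ind (SlotBlocked T S ℓ s₂ V {s₂})) - Y ^ 2| ≤ ε

section Step

variable {T : ℕ} {Λ : Polynomial ℝ} {ρ : ℝ} {ℓ : ℕ} {Y : ℝ}

lemma eventually_slots_large (n : ℕ) : ∀ᶠ p : ℕ × ℕ in loadFilter ρ, n ≤ p.2 :=
  tendsto_snd_loadFilter.eventually_ge_atTop n

lemma card_blockedSlots {M N : ℕ} (S : Fin M → Finset (Fin N)) (V : Finset (Fin M)) :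
    ((blockedSlots T S ℓ V).card : ℝ) = ∑ s, ind (SlotBlocked T S ℓ s V {s}) := by
  classical
  rw [blockedSlots, Finset.card_filter]
  push_cast
  exact Finset.sum_congr rfl fun s _ => by rw [← ite_eq_ind]

/-- The fraction of blocked slots concentrates. -/
lemma eventually_expect_abs_blockedSlots_le (hΛ : IsDegreeDistribution Λ) (hY0 : 0 ≤ Y)
    (hY1 : Y ≤ 1) (h1 : SlotLimit T Λ ρ ℓ Y) (h2 : PairLimit T Λ ρ ℓ Y) {δ : ℝ} (hδ : 0 < δ) :
    ∀ᶠ p : ℕ × ℕ in loadFilter ρ, ∀ (M : ℕ) (V : Finset (Fin M)), V.card = p.1 →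
      expect (slotLaw Λ) (fun S : Fin M → Finset (Fin p.2) =>
        |((blockedSlots T S ℓ V).card : ℝ) / p.2 - Y|) ≤ δ := by
  set ε := δ ^ 2 / 4 with hε
  have hε0 : 0 < ε := by positivity
  filter_upwards [h1 1 ε hε0, h2 ε hε0, eventually_const_div_le 1 hε0,
    eventually_slots_large (Λ.natDegree + 1)] with p hp1 hp2 hp3 hpN M V hV
  have hlaw : IsLaw (slotLaw Λ : Finset (Fin p.2) → ℝ) := isLaw_slotLaw hΛ (by omega)
  have hN : (0 : ℝ) < p.2 := by
    have : 0 < p.2 := by omega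
    positivity
  set N : ℝ := (p.2 : ℝ) with hNdef
  let y : (Fin M → Finset (Fin p.2)) → Fin p.2 → ℝ := fun S s => ind (SlotBlocked T S ℓ s V {s})
  have hsq : expect (slotLaw Λ) (fun S : Fin M → Finset (Fin p.2) =>
      (((blockedSlots T S ℓ V).card : ℝ) / N - Y) ^ 2) ≤ 4 * ε := by
    have e : ∀ S : Fin M → Finset (Fin p.2), (((blockedSlots T S ℓ V).card : ℝ) / N - Y) ^ 2
        = (N⁻¹ ^ 2) * (∑ s, ∑ s₂, y S s * y S s₂) + (-2 * Y * N⁻¹) * (∑ s, y S s) + Y ^ 2 := by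
      intro S
      rw [card_blockedSlots, ← Finset.sum_mul_sum]
      simp only [y]
      field_simp
      ring
    rw [expect_congr e, expect_add, expect_add, expect_const hlaw, expect_const_mul,
      expect_const_mul, expect_sum, expect_sum]
    have hpair : ∑ s, expect (slotLaw Λ) (fun S => ∑ s₂, y S s * y S s₂)
        ≤ N ^ 2 * (Y ^ 2 + ε) + N := by
      have : ∀ s s₂ : Fin p.2, expect (slotLaw Λ) (fun S => y S s * y S s₂)
          ≤ (Y ^ 2 + ε) + if s = s₂ then 1 else 0 := by
        intro s s₂
        split_ifs with h
        · have h1 : expect (slotLaw Λ) (fun S => y S s * y S s₂) ≤ 1 :=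
            expect_le_one hlaw fun S => mul_le_one₀ (ind_le_one _) (ind_nonneg _) (ind_le_one _)
          have : 0 ≤ Y ^ 2 := sq_nonneg Y
          linarith
        · have := (abs_le.1 (hp2 M V hV s s₂ h)).2
          simp only [y]
          linarith
      calc _ ≤ ∑ s : Fin p.2, ∑ s₂ : Fin p.2, ((Y ^ 2 + ε) + if s = s₂ then 1 else 0) := by
            refine Finset.sum_le_sum fun s _ => ?_
            rw [expect_sum]
            exact Finset.sum_le_sum fun s₂ _ => this s s₂
        _ = _ := by
            simp only [Finset.sum_add_distrib, Finset.sum_const, Finset.card_univ,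
              Fintype.card_fin, nsmul_eq_mul, Finset.sum_ite_eq, Finset.mem_univ, if_true]
            rw [hNdef]
            ring
    have hone : N * (Y - ε) ≤ ∑ s, expect (slotLaw Λ) (fun S => y S s) := by
      calc N * (Y - ε) = ∑ s : Fin p.2, (Y - ε) := by
            rw [Finset.sum_const, Finset.card_univ, Fintype.card_fin, nsmul_eq_mul]
        _ ≤ _ := Finset.sum_le_sum fun s _ => by
            have := (abs_le.1 (hp1 M V hV s {s} (Finset.mem_singleton_self s)
              (Finset.card_singleton s).le)).1
            simp only [blockProb] at this
            simp only [y]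
            linarith
    have hp3' : N⁻¹ ≤ ε := by rwa [one_div] at hp3
    calc _ ≤ N⁻¹ ^ 2 * (N ^ 2 * (Y ^ 2 + ε) + N) + -(2 * Y * N⁻¹ * (N * (Y - ε))) + Y ^ 2 := by
          have h3 : 2 * Y * N⁻¹ * (N * (Y - ε))
              ≤ 2 * Y * N⁻¹ * ∑ s, expect (slotLaw Λ) (fun S => y S s) := by gcongr
          have h4 : N⁻¹ ^ 2 * ∑ s, expect (slotLaw Λ) (fun S => ∑ s₂, y S s * y S s₂)
            ≤ N⁻¹ ^ 2 * (N ^ 2 * (Y ^ 2 + ε) + N) := by gcongr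
          linarith
      _ = ε + N⁻¹ + 2 * Y * ε := by field_simp; ring
      _ ≤ ε + ε + 2 * 1 * ε := by gcongr
      _ = 4 * ε := by ring
  calc _ ≤ expect (slotLaw Λ) (fun S : Fin M → Finset (Fin p.2) =>
        δ / 2 + (2 * δ)⁻¹ * (((blockedSlots T S ℓ V).card : ℝ) / N - Y) ^ 2) := by
        refine expect_mono hlaw fun S => ?_
        set x := ((blockedSlots T S ℓ V).card : ℝ) / N - Y
        -- the inequality of arithmetic and geometric means
        have h5 : 0 ≤ (2 * δ)⁻¹ * (|x| - δ) ^ 2 := by positivity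
        have h6 : (2 * δ)⁻¹ * (|x| - δ) ^ 2 = (2 * δ)⁻¹ * x ^ 2 - |x| + δ / 2 := by
          rw [← sq_abs x]
          field_simp
          ring
        linarith
    _ ≤ δ / 2 + (2 * δ)⁻¹ * (4 * ε) := by
        rw [expect_add, expect_const hlaw, expect_const_mul]
        gcongr
    _ = δ := by rw [hε]; field_simp; ring

lemma exists_lipschitz_derivative (hΛ : IsDegreeDistribution Λ) :
    ∃ L : ℝ, 0 ≤ L ∧ ∀ u v : ℝ, 0 ≤ u → u ≤ 1 → 0 ≤ v → v ≤ 1 →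
      |Λ.derivative.eval u - Λ.derivative.eval v| ≤ L * |u - v| := by
  refine ⟨∑ k ∈ Finset.range Λ.natDegree, Λ.coeff (k + 1) * (k + 1) * k,
    Finset.sum_nonneg fun k _ => ?_, fun u v hu hu' hv hv' => ?_⟩
  · have := hΛ.nonneg (k + 1)
    positivity
  rw [eval_derivative_eq_sum hΛ, eval_derivative_eq_sum hΛ, ← Finset.sum_sub_distrib,
    Finset.sum_mul]
  refine (Finset.abs_sum_le_sum_abs _ _).trans (Finset.sum_le_sum fun k _ => ?_)
  have h0 := hΛ.nonneg (k + 1)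
  have h1 : (0 : ℝ) ≤ Λ.coeff (k + 1) * (k + 1) := by positivity
  rw [← mul_sub, abs_mul, abs_of_nonneg h1, mul_assoc (Λ.coeff (k + 1) * (k + 1) : ℝ)]
  refine mul_le_mul_of_nonneg_left ?_ h1
  refine (abs_pow_sub_pow_le u v k).trans ?_
  have hmax : (max |u| |v|) ^ (k - 1) ≤ 1 := by
    refine pow_le_one₀ ((abs_nonneg u).trans (le_max_left _ _)) ?_
    rw [abs_of_nonneg hu, abs_of_nonneg hv]
    exact max_le hu' hv'
  calc |u - v| * k * (max |u| |v|) ^ (k - 1) ≤ |u - v| * k * 1 := by gcongr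
    _ = k * |u - v| := by ring

/-- A user occupies a given slot and is blocked with probability `Λ' (Y) / N`, almost independently
of the other users. -/
lemma eventually_abs_expect_userBlocked_mul_sub_le (hΛ : IsDegreeDistribution Λ) (hY0 : 0 ≤ Y)
    (hY1 : Y ≤ 1) (h1 : SlotLimit T Λ ρ ℓ Y) (h2 : PairLimit T Λ ρ ℓ Y) (b : ℕ) {ε : ℝ}
    (hε : 0 < ε) :
    ∀ᶠ p : ℕ × ℕ in loadFilter ρ, ∀ (M : ℕ) (V : Finset (Fin M)), V.card = p.1 →
      ∀ i ∈ V, ∀ (s : Fin p.2) (F : Finset (Fin p.2)), s ∈ F → F.card ≤ b →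
      ∀ ψ : (Fin M → Finset (Fin p.2)) → ℝ, (∀ S, 0 ≤ ψ S) → (∀ S, ψ S ≤ 1) →
      (∀ S R, ψ (Function.update S i R) = ψ S) →
      |expect (slotLaw Λ) (fun S => ind (s ∈ S i ∧ UserBlocked T S ℓ i V F) * ψ S)
        - Λ.derivative.eval Y / p.2 * expect (slotLaw Λ) ψ| ≤ ε / p.2 := by
  obtain ⟨L, hL0, hL⟩ := exists_lipschitz_derivative hΛ
  set D : ℝ := (Λ.natDegree : ℝ) with hD
  set κ := avgDegree Λ
  have hκ : 0 ≤ κ := zero_le_one.trans (one_le_avgDegree hΛ)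
  set η := ε / (4 * (κ * (D * 2) + L + 1)) with hη
  have hη0 : 0 < η := by positivity
  have hηε : η * (κ * (D * 2) + L + 1) = ε / 4 := by
    rw [hη, div_mul_eq_mul_div, div_eq_div_iff (by positivity) (by norm_num)]
    ring
  have hbound1 : η * (κ * (D * 2)) ≤ ε / 4 := by
    rw [← hηε]; gcongr; linarith
  have hbound2 : η * L ≤ ε / 4 := by
    rw [← hηε]; gcongr; nlinarith
  filter_upwards [tendsto_pred_loadFilter.eventually (h1 (b + Λ.natDegree) η hη0),
    tendsto_pred_loadFilter.eventually (eventually_expect_abs_blockedSlots_le hΛ hY0 hY1 h1 h2 hη0),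
    eventually_const_div_le (b * (2 * D ^ 2)) (show 0 < ε / 4 by positivity),
    eventually_const_div_le (D ^ 2 * (2 * (D + 2))) (show 0 < ε / 4 by positivity),
    eventually_slots_large (2 * Λ.natDegree + 2)]
    with p hp1 hp2 hp3 hp4 hpN M V hV i hi s F hs hF ψ hψ0 hψ1 hψ
  have hlaw : IsLaw (slotLaw Λ : Finset (Fin p.2) → ℝ) := isLaw_slotLaw hΛ (by omega)
  have hN : (0 : ℝ) < p.2 := by
    have : 0 < p.2 := by omega
    positivity
  have hVe : (V.erase i).card = p.1 - 1 := by rw [Finset.card_erase_of_mem hi, hV]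
  set N : ℝ := (p.2 : ℝ) with hNdef
  -- the indicator that user `i` is in slot `s` and sees only blocked slots elsewhere
  let X : (Fin M → Finset (Fin p.2)) → ℝ := fun S => ind (s ∈ S i ∧ UserBlocked T S ℓ i V F)
  let X' : (Fin M → Finset (Fin p.2)) → ℝ := fun S =>
    ind (s ∈ S i ∧ (S i).erase s ⊆ blockedSlots T S ℓ (V.erase i))
  have hX'X : ∀ S : Fin M → Finset (Fin p.2),
      (s ∈ S i ∧ (S i).erase s ⊆ blockedSlots T S ℓ (V.erase i)) →
        (s ∈ S i ∧ UserBlocked T S ℓ i V F) := by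
    rintro S ⟨hsS, h⟩
    refine ⟨hsS, fun s' hs' => ?_⟩
    rw [Finset.mem_sdiff] at hs'
    have h' := mem_blockedSlots.1 (h (Finset.mem_erase.2 ⟨by
      rintro rfl
      exact hs'.2 hs, hs'.1⟩))
    exact h'.mono subset_rfl (Finset.singleton_subset_iff.2 (Finset.mem_union_right _ hs'.1))
  have hdiff : ∀ S, X S - X' S = ind ((s ∈ S i ∧ UserBlocked T S ℓ i V F) ∧
      ¬ (s ∈ S i ∧ (S i).erase s ⊆ blockedSlots T S ℓ (V.erase i))) := by
    intro S
    simp only [X, X']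
    by_cases h3 : s ∈ S i ∧ (S i).erase s ⊆ blockedSlots T S ℓ (V.erase i)
    · rw [ind_of h3, ind_of (hX'X S h3), ind_of_not (fun h => h.2 h3), sub_self]
    · rw [ind_of_not h3, sub_zero]
      exact ind_congr ⟨fun h => ⟨h, h3⟩, fun h => h.1⟩
  have hE1 : expect (slotLaw Λ) (fun S => X S - X' S) ≤ (ε / 2) / N := by
    rw [expect_congr hdiff]
    refine (expect_userBlocked_not_subset_le hΛ hpN hη0.le
      (fun s F hs hF => hp1 M _ hVe s F hs hF) hs hF).trans ?_
    calc b * (2 * D ^ 2 / N ^ 2) + κ / N * (D * (2 * η))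
        = (b * (2 * D ^ 2) / N + η * (κ * (D * 2))) / N := by field_simp
      _ ≤ (ε / 4 + ε / 4) / N := by gcongr
      _ = _ := by ring
  have hE1' : |expect (slotLaw Λ) (fun S => (X S - X' S) * ψ S)| ≤ (ε / 2) / N := by
    refine (abs_expect_le hlaw _).trans (le_trans (expect_mono hlaw fun S => ?_) hE1)
    rw [hdiff, abs_mul, abs_of_nonneg (ind_nonneg _), abs_of_nonneg (hψ0 S)]
    exact mul_le_of_le_one_right (ind_nonneg _) (hψ1 S)
  let q : (Fin M → Finset (Fin p.2)) → ℝ := fun S => ∑ c : Finset (Fin p.2),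
    slotLaw Λ c * ind (s ∈ c ∧ c.erase s ⊆ blockedSlots T S ℓ (V.erase i))
  have hE2 : expect (slotLaw Λ) (fun S => X' S * ψ S)
      = expect (slotLaw Λ) (fun S => q S * ψ S) := by
    rw [expect_resample hlaw i]
    simp only [X', Function.update_self, blockedSlots_update, hψ, q]
    simp only [Finset.sum_mul]
    rw [expect_sum]
    refine Finset.sum_congr rfl fun R _ => ?_
    rw [← expect_const_mul]
    exact expect_congr fun S => by ring
  have hq : ∀ S, |q S - Λ.derivative.eval Y / N| ≤
      (ε / 4 + L * |((blockedSlots T S ℓ (V.erase i)).card : ℝ) / N - Y|) / N := by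
    intro S
    have h3 := abs_mul_sum_slotLaw_subset_sub_le hΛ hpN s (blockedSlots T S ℓ (V.erase i))
    have hv1 : ((blockedSlots T S ℓ (V.erase i)).card : ℝ) / N ≤ 1 := by
      rw [div_le_one hN]
      have := Finset.card_le_univ (blockedSlots T S ℓ (V.erase i))
      rw [Fintype.card_fin] at this
      rw [hNdef]
      exact_mod_cast this
    have h4 := hL _ Y (by positivity) hv1 hY0 hY1
    rw [le_div_iff₀ hN]
    nth_rewrite 2 [← abs_of_pos hN]
    rw [← abs_mul, sub_mul, div_mul_cancel₀ _ hN.ne']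
    have h5 : D ^ 2 * (2 * (D + 2) / N) ≤ ε / 4 := by
      refine le_trans (le_of_eq ?_) hp4
      ring
    calc |q S * N - Λ.derivative.eval Y|
        ≤ |N * q S - Λ.derivative.eval (((blockedSlots T S ℓ (V.erase i)).card : ℝ) / N)|
          + |Λ.derivative.eval (((blockedSlots T S ℓ (V.erase i)).card : ℝ) / N)
            - Λ.derivative.eval Y| := by
          rw [mul_comm]
          exact abs_sub_le _ _ _
      _ ≤ _ := add_le_add (h3.trans h5) h4
  have hE3 : |expect (slotLaw Λ) (fun S => q S * ψ S)
      - Λ.derivative.eval Y / N * expect (slotLaw Λ) ψ| ≤ (ε / 2) / N := by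
    rw [← expect_const_mul, ← expect_sub]
    refine (abs_expect_le hlaw _).trans ?_
    calc _ ≤ expect (slotLaw Λ) (fun S =>
          (ε / 4) / N + (L / N) * |((blockedSlots T S ℓ (V.erase i)).card : ℝ) / N - Y|) := by
          refine expect_mono hlaw fun S => ?_
          rw [← sub_mul, abs_mul, abs_of_nonneg (hψ0 S)]
          refine (mul_le_of_le_one_right (abs_nonneg _) (hψ1 S)).trans ((hq S).trans_eq ?_)
          ring
      _ ≤ (ε / 4) / N + (L / N) * η := by
          rw [expect_add, expect_const hlaw, expect_const_mul]
          have := hp2 M _ hVe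
          gcongr
      _ = (ε / 4 + η * L) / N := by ring
      _ ≤ (ε / 4 + ε / 4) / N := by gcongr
      _ = _ := by ring
  have hsplit : expect (slotLaw Λ) (fun S => X S * ψ S)
      = expect (slotLaw Λ) (fun S => (X S - X' S) * ψ S)
        + expect (slotLaw Λ) (fun S => X' S * ψ S) := by
    rw [← expect_add]
    exact expect_congr fun S => by ring
  change |expect (slotLaw Λ) (fun S => X S * ψ S) - _| ≤ _
  rw [hsplit, hE2, add_sub_assoc]
  refine (abs_add_le _ _).trans ((add_le_add hE1' hE3).trans_eq ?_)
  ring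

/-- Asymptotic form of the stability under the removal of a user. -/
lemma eventually_expect_userBlocked_not_erase_le (hΛ : IsDegreeDistribution Λ)
    (h1 : SlotLimit T Λ ρ ℓ Y) (b : ℕ) {ε : ℝ} (hε : 0 < ε) :
    ∀ᶠ p : ℕ × ℕ in loadFilter ρ, ∀ (M : ℕ) (V : Finset (Fin M)), V.card = p.1 →
      ∀ i ∈ V, ∀ j ∈ V, i ≠ j → ∀ (s s₂ : Fin p.2) (F : Finset (Fin p.2)), s₂ ∈ F → F.card ≤ b →
      expect (slotLaw Λ) (fun S : Fin M → Finset (Fin p.2) => ind (s ∈ S j ∧ s₂ ∈ S i ∧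
        UserBlocked T S ℓ i V F ∧ ¬ UserBlocked T S ℓ i (V.erase j) F)) ≤ ε / (p.2 : ℝ) ^ 2 := by
  set D : ℝ := (Λ.natDegree : ℝ) with hD
  set κ := avgDegree Λ
  have hκ : 0 ≤ κ := zero_le_one.trans (one_le_avgDegree hΛ)
  set η := ε / (2 * (κ * (κ * (D * 2)) + 1)) with hη
  have hη0 : 0 < η := by positivity
  have hηε : η * (κ * (κ * (D * 2))) ≤ ε / 2 := by
    have : η * (κ * (κ * (D * 2)) + 1) = ε / 2 := by
      rw [hη, div_mul_eq_mul_div, div_eq_div_iff (by positivity) (by norm_num)]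
      ring
    linarith
  filter_upwards [tendsto_pred_loadFilter.eventually (tendsto_pred_loadFilter.eventually
      (h1 (b + 2 * Λ.natDegree) η hη0)),
    eventually_const_div_le (κ * (D * (2 * D ^ 2))) (show 0 < ε / 2 by positivity),
    eventually_slots_large (2 * Λ.natDegree + 2)]
    with p hp1 hp2 hpN M V hV i hi j hj hij s s₂ F hs hF
  have hN : (0 : ℝ) < p.2 := by
    have : 0 < p.2 := by omega
    positivity
  have hVe : ((V.erase j).erase i).card = p.1 - 1 - 1 := by
    rw [Finset.card_erase_of_mem (Finset.mem_erase.2 ⟨hij, hi⟩), Finset.card_erase_of_mem hj, hV]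
  refine (expect_userBlocked_not_erase_le hΛ hpN hη0.le hij
    (fun s F hs hF => hp1 M _ hVe s F hs hF) hs hF).trans ?_
  calc _ = (κ * (D * (2 * D ^ 2)) / p.2 + η * (κ * (κ * (D * 2)))) / (p.2 : ℝ) ^ 2 := by
        field_simp
        ring
    _ ≤ (ε / 2 + ε / 2) / (p.2 : ℝ) ^ 2 := by gcongr
    _ = _ := by ring

end Step

section Counts

variable {T : ℕ} {M N : ℕ} {S : Fin M → Finset (Fin N)} {ℓ : ℕ}

lemma blockedCount_eq_sum (s : Fin N) (V : Finset (Fin M)) (F : Finset (Fin N)) :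
    (blockedCount T S ℓ s V F : ℝ) = ∑ i ∈ V, ind (s ∈ S i ∧ UserBlocked T S ℓ i V F) := by
  classical
  rw [blockedCount, Finset.card_filter]
  push_cast
  exact Finset.sum_congr rfl fun s _ => by rw [← ite_eq_ind]

lemma blockedCount_update (R : Finset (Fin N)) (s : Fin N) (V : Finset (Fin M)) (j : Fin M)
    (F : Finset (Fin N)) :
    blockedCount T (Function.update S j R) ℓ s (V.erase j) F
      = blockedCount T S ℓ s (V.erase j) F :=
  blockedCount_congr fun _ hk => update_eq_of_mem_erase S j R hk

lemma blockedCount_eq_add_one {s : Fin N} {V : Finset (Fin M)} {F : Finset (Fin N)} {j : Fin M}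
    (hj : j ∈ V) (hX : s ∈ S j ∧ UserBlocked T S ℓ j V F)
    (h : ¬ ∃ i ∈ V.erase j,
      s ∈ S i ∧ UserBlocked T S ℓ i V F ∧ ¬ UserBlocked T S ℓ i (V.erase j) F) :
    blockedCount T S ℓ s V F = blockedCount T S ℓ s (V.erase j) F + 1 := by
  classical
  push Not at h
  have : (blockedCount T S ℓ s V F : ℝ) = blockedCount T S ℓ s (V.erase j) F + 1 := by
    rw [blockedCount_eq_sum, blockedCount_eq_sum, ← Finset.sum_erase_add _ _ hj, ind_of hX]
    congr 1
    refine Finset.sum_congr rfl fun i hi => ind_congr ?_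
    exact and_congr_right fun hs =>
      ⟨h i hi hs, fun h => h.mono (Finset.erase_subset _ _) subset_rfl⟩
  exact_mod_cast this

lemma blockedCount_eq_erase {s : Fin N} {V : Finset (Fin M)} {F : Finset (Fin N)} {j : Fin M}
    (hj : j ∈ V) (hX : s ∉ S j)
    (h : ¬ ∃ i ∈ V.erase j,
      s ∈ S i ∧ UserBlocked T S ℓ i V F ∧ ¬ UserBlocked T S ℓ i (V.erase j) F) :
    blockedCount T S ℓ s V F = blockedCount T S ℓ s (V.erase j) F := by
  classical
  push Not at h
  have : (blockedCount T S ℓ s V F : ℝ) = blockedCount T S ℓ s (V.erase j) F := by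
    rw [blockedCount_eq_sum, blockedCount_eq_sum, ← Finset.sum_erase_add _ _ hj,
      ind_of_not fun h => hX h.1, add_zero]
    refine Finset.sum_congr rfl fun i hi => ind_congr ?_
    exact and_congr_right fun hs =>
      ⟨h i hi hs, fun h => h.mono (Finset.erase_subset _ _) subset_rfl⟩
  exact_mod_cast this

end Counts

section Stein

variable {T : ℕ} {Λ : Polynomial ℝ} {ρ : ℝ} {ℓ : ℕ} {Y : ℝ}

lemma derivative_eval_nonneg (hΛ : IsDegreeDistribution Λ) {u : ℝ} (hu : 0 ≤ u) :
    0 ≤ Λ.derivative.eval u := by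
  rw [eval_derivative_eq_sum hΛ]
  refine Finset.sum_nonneg fun k _ => ?_
  have := hΛ.nonneg (k + 1)
  positivity

lemma eventually_abs_ratio_sub_le {ε : ℝ} (hε : 0 < ε) :
    ∀ᶠ p : ℕ × ℕ in loadFilter ρ, |(p.1 : ℝ) / p.2 - ρ| ≤ ε := by
  filter_upwards [(Metric.tendsto_nhds.1 tendsto_ratio_loadFilter ε hε)] with p hp
  rw [Real.dist_eq] at hp
  exact hp.le

/-- The expected number of blocked users in a slot tends to `ρ Λ' (Y)`. -/
lemma eventually_abs_expect_blockedCount_sub_le (hΛ : IsDegreeDistribution Λ) (hρ : 0 ≤ ρ)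
    (hY0 : 0 ≤ Y) (hY1 : Y ≤ 1) (h1 : SlotLimit T Λ ρ ℓ Y) (h2 : PairLimit T Λ ρ ℓ Y) (b : ℕ)
    {ε : ℝ} (hε : 0 < ε) :
    ∀ᶠ p : ℕ × ℕ in loadFilter ρ, ∀ (M : ℕ) (V : Finset (Fin M)), V.card = p.1 →
      ∀ (s : Fin p.2) (F : Finset (Fin p.2)), s ∈ F → F.card ≤ b →
      |expect (slotLaw Λ) (fun S : Fin M → Finset (Fin p.2) => (blockedCount T S ℓ s V F : ℝ))
        - ρ * Λ.derivative.eval Y| ≤ ε := by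
  set d := Λ.derivative.eval Y with hd
  have hd0 : 0 ≤ d := derivative_eval_nonneg hΛ hY0
  set η := min 1 (ε / (2 * (ρ + 1 + d))) with hη
  have hη0 : 0 < η := by positivity
  have hη1 : η ≤ 1 := min_le_left _ _
  have hη2 : η * (ρ + 1 + d) ≤ ε / 2 := by
    calc η * (ρ + 1 + d) ≤ ε / (2 * (ρ + 1 + d)) * (ρ + 1 + d) := by
          gcongr
          exact min_le_right _ _
      _ = ε / 2 := by field_simp
  filter_upwards [eventually_abs_expect_userBlocked_mul_sub_le hΛ hY0 hY1 h1 h2 b hη0,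
    eventually_abs_ratio_sub_le hη0, eventually_slots_large (Λ.natDegree + 1)]
    with p hp1 hp2 hpN M V hV s F hs hF
  have hlaw : IsLaw (slotLaw Λ : Finset (Fin p.2) → ℝ) := isLaw_slotLaw hΛ (by omega)
  have hN : (0 : ℝ) < p.2 := by
    have : 0 < p.2 := by omega
    positivity
  have hi : ∀ i ∈ V, |expect (slotLaw Λ) (fun S : Fin M → Finset (Fin p.2) =>
      ind (s ∈ S i ∧ UserBlocked T S ℓ i V F)) - d / p.2| ≤ η / p.2 := by
    intro i hi
    have := hp1 M V hV i hi s F hs hF (fun _ => 1) (fun _ => zero_le_one) (fun _ => le_rfl)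
      (fun _ _ => rfl)
    simpa only [mul_one, expect_const hlaw] using this
  simp only [blockedCount_eq_sum]
  rw [expect_sum]
  have h3 : |∑ i ∈ V, expect (slotLaw Λ) (fun S : Fin M → Finset (Fin p.2) =>
      ind (s ∈ S i ∧ UserBlocked T S ℓ i V F)) - p.1 / p.2 * d| ≤ p.1 / p.2 * η := by
    have e : (p.1 : ℝ) / p.2 * d = ∑ i ∈ V, d / p.2 := by
      rw [Finset.sum_const, hV, nsmul_eq_mul]
      ring
    rw [e, ← Finset.sum_sub_distrib]
    refine (Finset.abs_sum_le_sum_abs _ _).trans ((Finset.sum_le_sum hi).trans_eq ?_)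
    rw [Finset.sum_const, hV, nsmul_eq_mul]
    ring
  have h4 : (p.1 : ℝ) / p.2 ≤ ρ + 1 := by
    have := (abs_le.1 hp2).2
    linarith
  calc _ ≤ _ := abs_sub_le _ ((p.1 : ℝ) / p.2 * d) _
    _ ≤ (ρ + 1) * η + η * d := by
        refine add_le_add (h3.trans (by gcongr)) ?_
        rw [← sub_mul, abs_mul, abs_of_nonneg hd0]
        gcongr
    _ = η * (ρ + 1 + d) := by ring
    _ ≤ ε := by linarith

/-- Removing a user rarely changes the number of blocked users in a given slot. -/
lemma eventually_expect_blockedCount_ne_erase_le (hΛ : IsDegreeDistribution Λ) (hρ : 0 ≤ ρ)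
    (hY0 : 0 ≤ Y) (hY1 : Y ≤ 1) (h1 : SlotLimit T Λ ρ ℓ Y) (h2 : PairLimit T Λ ρ ℓ Y) (b : ℕ)
    {ε : ℝ} (hε : 0 < ε) :
    ∀ᶠ p : ℕ × ℕ in loadFilter ρ, ∀ (M : ℕ) (V : Finset (Fin M)), V.card = p.1 → ∀ j ∈ V,
      ∀ (s : Fin p.2) (F : Finset (Fin p.2)), s ∈ F → F.card ≤ b →
      expect (slotLaw Λ) (fun S : Fin M → Finset (Fin p.2) =>
        ind (blockedCount T S ℓ s V F ≠ blockedCount T S ℓ s (V.erase j) F)) ≤ ε := by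
  have h3 := eventually_abs_expect_blockedCount_sub_le hΛ hρ hY0 hY1 h1 h2 b
    (show 0 < ε / 2 by positivity)
  filter_upwards [h3, tendsto_pred_loadFilter.eventually h3,
    eventually_slots_large (Λ.natDegree + 1)] with p hp1 hp2 hpN M V hV j hj s F hs hF
  have hlaw : IsLaw (slotLaw Λ : Finset (Fin p.2) → ℝ) := isLaw_slotLaw hΛ (by omega)
  have hVe : (V.erase j).card = p.1 - 1 := by rw [Finset.card_erase_of_mem hj, hV]
  have h4 := (abs_le.1 (hp1 M V hV s F hs hF)).2
  have h5 := (abs_le.1 (hp2 M _ hVe s F hs hF)).1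
  calc _ ≤ expect (slotLaw Λ) (fun S : Fin M → Finset (Fin p.2) =>
        (blockedCount T S ℓ s V F : ℝ) - blockedCount T S ℓ s (V.erase j) F) := by
        refine expect_mono hlaw fun S => ?_
        have hle := blockedCount_mono (T := T) (S := S) (ℓ := ℓ) (s := s) (F := F)
          (Finset.erase_subset j V)
        by_cases h : blockedCount T S ℓ s V F = blockedCount T S ℓ s (V.erase j) F
        · rw [ind_of_not (not_not.2 h), h, sub_self]
        · rw [ind_of h, le_sub_iff_add_le, add_comm]
          exact_mod_cast lt_of_le_of_ne hle (Ne.symm h)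
    _ ≤ ε := by
        rw [expect_sub]
        simp only at h5
        linarith

lemma eventually_expect_exists_userBlocked_le (hΛ : IsDegreeDistribution Λ) (hρ : 0 ≤ ρ)
    (h1 : SlotLimit T Λ ρ ℓ Y) (b : ℕ) {ε : ℝ} (hε : 0 < ε) :
    ∀ᶠ p : ℕ × ℕ in loadFilter ρ, ∀ (M : ℕ) (V : Finset (Fin M)), V.card = p.1 → ∀ j ∈ V,
      ∀ (s s₂ : Fin p.2) (F : Finset (Fin p.2)), s₂ ∈ F → F.card ≤ b →
      expect (slotLaw Λ) (fun S : Fin M → Finset (Fin p.2) =>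
        ind (s ∈ S j ∧ ∃ i ∈ V.erase j, s₂ ∈ S i ∧ UserBlocked T S ℓ i V F ∧
          ¬ UserBlocked T S ℓ i (V.erase j) F)) ≤ ε / (p.2 : ℝ) := by
  filter_upwards [eventually_expect_userBlocked_not_erase_le hΛ h1 b
      (show 0 < ε / (ρ + 1) by positivity), eventually_abs_ratio_sub_le (zero_lt_one),
    eventually_slots_large (Λ.natDegree + 1)] with p hp1 hp2 hpN M V hV j hj s s₂ F hs hF
  have hlaw : IsLaw (slotLaw Λ : Finset (Fin p.2) → ℝ) := isLaw_slotLaw hΛ (by omega)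
  have hN : (0 : ℝ) < p.2 := by
    have : 0 < p.2 := by omega
    positivity
  have h4 : (p.1 : ℝ) / p.2 ≤ ρ + 1 := by
    have := (abs_le.1 hp2).2
    linarith
  calc _ ≤ expect (slotLaw Λ) (fun S : Fin M → Finset (Fin p.2) => ∑ i ∈ V.erase j,
        ind (s ∈ S j ∧ s₂ ∈ S i ∧ UserBlocked T S ℓ i V F ∧
          ¬ UserBlocked T S ℓ i (V.erase j) F)) := by
        refine expect_mono hlaw fun S => le_trans (ind_mono ?_) (ind_exists_le_sum _ _)
        rintro ⟨h, i, hi, h'⟩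
        exact ⟨i, hi, h, h'⟩
    _ ≤ ∑ i ∈ V.erase j, ε / (ρ + 1) / (p.2 : ℝ) ^ 2 := by
        rw [expect_sum]
        exact Finset.sum_le_sum fun i hi => hp1 M V hV i (Finset.mem_of_mem_erase hi) j hj
          (Finset.ne_of_mem_erase hi) s s₂ F hs hF
    _ ≤ ∑ i ∈ V, ε / (ρ + 1) / (p.2 : ℝ) ^ 2 :=
        Finset.sum_le_sum_of_subset_of_nonneg (Finset.erase_subset _ _) fun i _ _ => by positivity
    _ = (p.1 / p.2) * (ε / (ρ + 1)) / p.2 := by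
        rw [Finset.sum_const, hV, nsmul_eq_mul]
        field_simp
    _ ≤ (ρ + 1) * (ε / (ρ + 1)) / p.2 := by gcongr
    _ = ε / p.2 := by field_simp

/-- The Chen–Stein recursion for the number of blocked users in slot `s`, jointly with an event
about another slot `s₂`. Removing a blocked user `j` from slot `s` decreases the number by one and
leaves `s₂` alone, up to events of small probability. -/
lemma eventually_abs_stein_le (hΛ : IsDegreeDistribution Λ) (hρ : 0 ≤ ρ)
    (hY0 : 0 ≤ Y) (hY1 : Y ≤ 1) (h1 : SlotLimit T Λ ρ ℓ Y) (h2 : PairLimit T Λ ρ ℓ Y) (b t k : ℕ)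
    {ε : ℝ} (hε : 0 < ε) :
    ∀ᶠ p : ℕ × ℕ in loadFilter ρ, ∀ (M : ℕ) (V : Finset (Fin M)), V.card = p.1 →
      ∀ (s s₂ : Fin p.2) (F F₂ : Finset (Fin p.2)), s ≠ s₂ → s ∈ F → F.card ≤ b →
      s₂ ∈ F₂ → F₂.card ≤ b →
      |((k : ℝ) + 1) * expect (slotLaw Λ) (fun S : Fin M → Finset (Fin p.2) =>
          ind (blockedCount T S ℓ s V F = k + 1 ∧ t ≤ blockedCount T S ℓ s₂ V F₂))
        - ρ * Λ.derivative.eval Y * expect (slotLaw Λ) (fun S : Fin M → Finset (Fin p.2) =>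
          ind (blockedCount T S ℓ s V F = k ∧ t ≤ blockedCount T S ℓ s₂ V F₂))| ≤ ε := by
  set d := Λ.derivative.eval Y with hd
  have hd0 : 0 ≤ d := derivative_eval_nonneg hΛ hY0
  set C := (ρ + 1) * (4 + 2 * d) + d with hC
  have hC0 : 0 < C := by positivity
  set η := min 1 (ε / C) with hη
  have hη0 : 0 < η := by positivity
  have hη1 : η ≤ 1 := min_le_left _ _
  have hη2 : η * C ≤ ε := by
    calc η * C ≤ ε / C * C := by
          gcongr
          exact min_le_right _ _
      _ = ε := by field_simp
  filter_upwards [eventually_abs_expect_userBlocked_mul_sub_le hΛ hY0 hY1 h1 h2 b hη0,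
    eventually_expect_exists_userBlocked_le hΛ hρ h1 b hη0,
    eventually_expect_blockedCount_ne_erase_le hΛ hρ hY0 hY1 h1 h2 b hη0,
    eventually_abs_ratio_sub_le hη0, eventually_const_div_le (2 * (Λ.natDegree : ℝ) ^ 2) hη0,
    eventually_slots_large (2 * Λ.natDegree + 2)]
    with p hthin hstab hne hratio hpair hpN M V hV s s₂ F F₂ hss hs hF hs₂ hF₂
  have hlaw : IsLaw (slotLaw Λ : Finset (Fin p.2) → ℝ) := isLaw_slotLaw hΛ (by omega)
  have hN : (0 : ℝ) < p.2 := by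
    have : 0 < p.2 := by omega
    positivity
  -- `φ V' n` is the event that `n` users are blocked in slot `s` when the users are `V'`
  let φ : Finset (Fin M) → ℕ → (Fin M → Finset (Fin p.2)) → ℝ := fun V' n S =>
    ind (blockedCount T S ℓ s V' F = n ∧ t ≤ blockedCount T S ℓ s₂ V' F₂)
  have hφ0 : ∀ V' n S, 0 ≤ φ V' n S := fun V' n S => ind_nonneg _
  have hφ1 : ∀ V' n S, φ V' n S ≤ 1 := fun V' n S => ind_le_one _
  let X : Fin M → (Fin M → Finset (Fin p.2)) → ℝ := fun j S =>
    ind (s ∈ S j ∧ UserBlocked T S ℓ j V F)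
  set P := expect (slotLaw Λ) (φ V k) with hP
  have hP0 : 0 ≤ P := expect_nonneg hlaw fun S => hφ0 _ _ S
  have hP1 : P ≤ 1 := expect_le_one hlaw fun S => hφ1 _ _ S
  have hj : ∀ j ∈ V, |expect (slotLaw Λ) (fun S => X j S * φ V (k + 1) S) - d / p.2 * P|
      ≤ η * (4 + 2 * d) / p.2 := by
    intro j hj
    have ha : |expect (slotLaw Λ) (fun S => X j S * φ V (k + 1) S)
        - expect (slotLaw Λ) (fun S => X j S * φ (V.erase j) k S)| ≤ 3 * η / p.2 := by
      rw [← expect_sub]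
      refine (abs_expect_le hlaw _).trans ?_
      calc _ ≤ expect (slotLaw Λ) (fun S : Fin M → Finset (Fin p.2) =>
            ind (s ∈ S j ∧ ∃ i ∈ V.erase j, s ∈ S i ∧ UserBlocked T S ℓ i V F ∧
              ¬ UserBlocked T S ℓ i (V.erase j) F) +
            ind (s ∈ S j ∧ ∃ i ∈ V.erase j, s₂ ∈ S i ∧ UserBlocked T S ℓ i V F₂ ∧
              ¬ UserBlocked T S ℓ i (V.erase j) F₂) + ind (s ∈ S j ∧ s₂ ∈ S j)) := by
            refine expect_mono hlaw fun S => ?_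
            by_cases hX : s ∈ S j ∧ UserBlocked T S ℓ j V F
            swap
            · simp only [X]
              rw [ind_of_not hX, zero_mul, zero_mul, sub_zero, abs_zero]
              exact add_nonneg (add_nonneg (ind_nonneg _) (ind_nonneg _)) (ind_nonneg _)
            have hle : |X j S * φ V (k + 1) S - X j S * φ (V.erase j) k S| ≤ 1 := by
              simp only [X]
              rw [ind_of hX, one_mul, one_mul, abs_le]
              have := hφ0 V (k + 1) S
              have := hφ1 V (k + 1) S
              have := hφ0 (V.erase j) k S
              have := hφ1 (V.erase j) k S
              constructor <;> linarith
            by_cases hA : ∃ i ∈ V.erase j, s ∈ S i ∧ UserBlocked T S ℓ i V F ∧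
              ¬ UserBlocked T S ℓ i (V.erase j) F
            · rw [ind_of ⟨hX.1, hA⟩]
              exact hle.trans (le_add_of_le_of_nonneg (le_add_of_nonneg_right (ind_nonneg _))
                (ind_nonneg _))
            by_cases hB : ∃ i ∈ V.erase j, s₂ ∈ S i ∧ UserBlocked T S ℓ i V F₂ ∧
              ¬ UserBlocked T S ℓ i (V.erase j) F₂
            · rw [ind_of (p := _ ∧ ∃ i ∈ V.erase j, s₂ ∈ S i ∧ _) ⟨hX.1, hB⟩]
              exact hle.trans (le_add_of_le_of_nonneg (le_add_of_nonneg_left (ind_nonneg _))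
                (ind_nonneg _))
            by_cases hC' : s₂ ∈ S j
            · rw [ind_of (p := s ∈ S j ∧ s₂ ∈ S j) ⟨hX.1, hC'⟩]
              exact hle.trans (le_add_of_nonneg_left (add_nonneg (ind_nonneg _) (ind_nonneg _)))
            have e : φ V (k + 1) S = φ (V.erase j) k S := by
              refine ind_congr ?_
              rw [blockedCount_eq_add_one hj hX hA, blockedCount_eq_erase hj hC' hB,
                Nat.add_right_cancel_iff]
            rw [e, sub_self, abs_zero]
            exact add_nonneg (add_nonneg (ind_nonneg _) (ind_nonneg _)) (ind_nonneg _)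
        _ ≤ η / p.2 + η / p.2 + η / p.2 := by
            rw [expect_add, expect_add]
            refine add_le_add (add_le_add (hstab M V hV j hj s s F hs hF)
              (hstab M V hV j hj s s₂ F₂ hs₂ hF₂)) ?_
            rw [expect_coord hlaw j (fun c => ind (s ∈ c ∧ s₂ ∈ c))]
            refine (sum_slotLaw_mem_mem hΛ hpN hss).trans ?_
            rw [sq (p.2 : ℝ), ← div_div]
            gcongr
        _ = 3 * η / p.2 := by ring
    have hb := hthin M V hV j hj s F hs hF (φ (V.erase j) k) (hφ0 _ _) (hφ1 _ _) fun S R => by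
      simp only [φ, blockedCount_update]
    have hc : |expect (slotLaw Λ) (φ (V.erase j) k) - P| ≤ 2 * η := by
      rw [hP, ← expect_sub]
      refine (abs_expect_le hlaw _).trans ?_
      calc _ ≤ expect (slotLaw Λ) (fun S : Fin M → Finset (Fin p.2) =>
            ind (blockedCount T S ℓ s V F ≠ blockedCount T S ℓ s (V.erase j) F) +
            ind (blockedCount T S ℓ s₂ V F₂ ≠ blockedCount T S ℓ s₂ (V.erase j) F₂)) := by
            refine expect_mono hlaw fun S => ?_
            have hle : |φ (V.erase j) k S - φ V k S| ≤ 1 := by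
              rw [abs_le]
              have := hφ0 V k S
              have := hφ1 V k S
              have := hφ0 (V.erase j) k S
              have := hφ1 (V.erase j) k S
              constructor <;> linarith
            by_cases hA : blockedCount T S ℓ s V F = blockedCount T S ℓ s (V.erase j) F
            swap
            · rw [ind_of (p := _ ≠ _) hA]
              exact hle.trans (le_add_of_nonneg_right (ind_nonneg _))
            by_cases hB : blockedCount T S ℓ s₂ V F₂ = blockedCount T S ℓ s₂ (V.erase j) F₂
            swap
            · rw [ind_of (p := blockedCount T S ℓ s₂ V F₂ ≠ _) hB]
              exact hle.trans (le_add_of_nonneg_left (ind_nonneg _))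
            simp only [φ, hA, hB, sub_self, abs_zero]
            exact add_nonneg (ind_nonneg _) (ind_nonneg _)
        _ ≤ η + η := by
            rw [expect_add]
            exact add_le_add (hne M V hV j hj s F hs hF) (hne M V hV j hj s₂ F₂ hs₂ hF₂)
        _ = 2 * η := by ring
    have hc' : |d / p.2 * expect (slotLaw Λ) (φ (V.erase j) k) - d / p.2 * P|
        ≤ d / p.2 * (2 * η) := by
      rw [← mul_sub, abs_mul, abs_of_nonneg (by positivity : (0 : ℝ) ≤ d / p.2)]
      gcongr
    calc _ ≤ _ := abs_sub_le _ (expect (slotLaw Λ) (fun S => X j S * φ (V.erase j) k S)) _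
      _ ≤ 3 * η / p.2 + (η / p.2 + d / p.2 * (2 * η)) :=
        add_le_add ha ((abs_sub_le _ _ _).trans (add_le_add hb hc'))
      _ = _ := by ring
  have hsum : ((k : ℝ) + 1) * expect (slotLaw Λ) (φ V (k + 1))
      = ∑ j ∈ V, expect (slotLaw Λ) (fun S => X j S * φ V (k + 1) S) := by
    rw [← expect_sum, ← expect_const_mul]
    refine expect_congr fun S => ?_
    rw [← Finset.sum_mul]
    have : (∑ j ∈ V, X j S) = (blockedCount T S ℓ s V F : ℝ) := (blockedCount_eq_sum s V F).symm
    rw [this]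
    by_cases h : blockedCount T S ℓ s V F = k + 1
    · rw [h]; push_cast; ring
    · simp only [φ, h, false_and]
      rw [ind_of_not not_false, mul_zero, mul_zero]
  have h3 : |((k : ℝ) + 1) * expect (slotLaw Λ) (φ V (k + 1)) - p.1 / p.2 * d * P|
      ≤ p.1 / p.2 * (η * (4 + 2 * d)) := by
    have e : (p.1 : ℝ) / p.2 * d * P = ∑ i ∈ V, d / p.2 * P := by
      rw [Finset.sum_const, hV, nsmul_eq_mul]
      ring
    rw [hsum, e, ← Finset.sum_sub_distrib]
    refine (Finset.abs_sum_le_sum_abs _ _).trans ((Finset.sum_le_sum hj).trans_eq ?_)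
    rw [Finset.sum_const, hV, nsmul_eq_mul]
    ring
  have h4 : (p.1 : ℝ) / p.2 ≤ ρ + 1 := by
    have := (abs_le.1 hratio).2
    linarith
  calc _ ≤ _ := abs_sub_le _ ((p.1 : ℝ) / p.2 * d * P) _
    _ ≤ (ρ + 1) * (η * (4 + 2 * d)) + η * d * 1 := by
        refine add_le_add (h3.trans (by gcongr)) ?_
        have e : (p.1 : ℝ) / p.2 * d * P - ρ * d * expect (slotLaw Λ) (φ V k)
            = (p.1 / p.2 - ρ) * d * P := by rw [← hP]; ring
        change |(p.1 : ℝ) / p.2 * d * P - ρ * d * expect (slotLaw Λ) (φ V k)| ≤ _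
        rw [e, abs_mul, abs_mul, abs_of_nonneg hd0, abs_of_nonneg hP0]
        gcongr
    _ = η * C := by rw [hC]; ring
    _ ≤ ε := hη2

lemma sum_ind_eq (n k : ℕ) (q : Prop) :
    ind (k ≤ n ∧ q) = ind q - ∑ j ∈ Finset.range k, ind (n = j ∧ q) := by
  by_cases hq : q
  swap
  · simp [hq, ind]
  simp only [hq, and_true]
  by_cases h : k ≤ n
  · rw [ind_of h, ind_of trivial, Finset.sum_eq_zero, sub_zero]
    intro j hj
    rw [ind_of_not]
    have := Finset.mem_range.1 hj
    omega
  · rw [ind_of_not h, Finset.sum_eq_single n, ind_of rfl, ind_of trivial, sub_self]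
    · exact fun j _ hj => ind_of_not hj.symm
    · intro hn
      rw [Finset.mem_range] at hn
      omega

/-- The event that slot `s` is blocked at the next depth has the probability of a Poisson tail,
asymptotically independently of the state of another slot. -/
lemma eventually_abs_expect_joint_sub_le (hΛ : IsDegreeDistribution Λ) (hρ : 0 ≤ ρ)
    (hY0 : 0 ≤ Y) (hY1 : Y ≤ 1) (h1 : SlotLimit T Λ ρ ℓ Y) (h2 : PairLimit T Λ ρ ℓ Y) (b t : ℕ)
    {ε : ℝ} (hε : 0 < ε) :
    ∀ᶠ p : ℕ × ℕ in loadFilter ρ, ∀ (M : ℕ) (V : Finset (Fin M)), V.card = p.1 →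
      ∀ (s s₂ : Fin p.2) (F F₂ : Finset (Fin p.2)), s ≠ s₂ → s ∈ F → F.card ≤ b →
      s₂ ∈ F₂ → F₂.card ≤ b →
      |expect (slotLaw Λ) (fun S : Fin M → Finset (Fin p.2) =>
          ind (T ≤ blockedCount T S ℓ s V F ∧ t ≤ blockedCount T S ℓ s₂ V F₂))
        - expect (slotLaw Λ) (fun S : Fin M → Finset (Fin p.2) =>
          ind (t ≤ blockedCount T S ℓ s₂ V F₂)) * poissonTail T (ρ * Λ.derivative.eval Y)| ≤ ε := by
  set m := ρ * Λ.derivative.eval Y with hm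
  have hm0 : 0 ≤ m := mul_nonneg hρ (derivative_eval_nonneg hΛ hY0)
  obtain ⟨K, η, hη, hK⟩ := exists_abs_sub_poissonTail_le hm0 T (m + 1) hε
  have hst := (Finset.eventually_all (Finset.range K)).2 fun k _ =>
    eventually_abs_stein_le hΛ hρ hY0 hY1 h1 h2 b t k hη
  filter_upwards [hst, eventually_abs_expect_blockedCount_sub_le hΛ hρ hY0 hY1 h1 h2 b zero_lt_one,
    eventually_slots_large (Λ.natDegree + 1)]
    with p hp1 hp2 hpN M V hV s s₂ F F₂ hss hs hF hs₂ hF₂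
  have hlaw : IsLaw (slotLaw Λ : Finset (Fin p.2) → ℝ) := isLaw_slotLaw hΛ (by omega)
  set P : ℕ → ℝ := fun k => expect (slotLaw Λ) (fun S : Fin M → Finset (Fin p.2) =>
    ind (blockedCount T S ℓ s V F = k ∧ t ≤ blockedCount T S ℓ s₂ V F₂)) with hP
  set Φ := expect (slotLaw Λ) (fun S : Fin M → Finset (Fin p.2) =>
    ind (t ≤ blockedCount T S ℓ s₂ V F₂)) with hΦ
  have hge : ∀ k, expect (slotLaw Λ) (fun S : Fin M → Finset (Fin p.2) =>
      ind (k ≤ blockedCount T S ℓ s V F ∧ t ≤ blockedCount T S ℓ s₂ V F₂))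
      = Φ - ∑ j ∈ Finset.range k, P j := by
    intro k
    simp only [sum_ind_eq]
    rw [expect_sub, expect_sum]
  rw [hge]
  refine hK P Φ (expect_nonneg hlaw fun _ => ind_nonneg _)
    (expect_le_one hlaw fun _ => ind_le_one _)
    (fun k hk => hp1 k (Finset.mem_range.2 hk) M V hV s s₂ F F₂ hss hs hF hs₂ hF₂) fun k => ?_
  -- Markov's inequality
  rw [← hge, abs_of_nonneg (expect_nonneg hlaw fun _ => ind_nonneg _), ← expect_mul_const]
  refine le_trans (expect_mono hlaw fun S => ?_)
    (show expect (slotLaw Λ) (fun S : Fin M → Finset (Fin p.2) =>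
      (blockedCount T S ℓ s V F : ℝ)) ≤ m + 1 by
      have := (abs_le.1 (hp2 M V hV s F hs hF)).2
      linarith)
  by_cases h : k ≤ blockedCount T S ℓ s V F ∧ t ≤ blockedCount T S ℓ s₂ V F₂
  · rw [ind_of h, one_mul]
    exact_mod_cast h.1
  · rw [ind_of_not h, zero_mul]
    positivity

lemma SlotLimit.succ (hΛ : IsDegreeDistribution Λ) (hρ : 0 ≤ ρ)
    (hY0 : 0 ≤ Y) (hY1 : Y ≤ 1) (h1 : SlotLimit T Λ ρ ℓ Y) (h2 : PairLimit T Λ ρ ℓ Y) :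
    SlotLimit T Λ ρ (ℓ + 1) (poissonTail T (ρ * Λ.derivative.eval Y)) := by
  intro b ε hε
  filter_upwards [eventually_abs_expect_joint_sub_le hΛ hρ hY0 hY1 h1 h2 (b + 1) 0 hε,
    eventually_slots_large (Λ.natDegree + 2)] with p hp hpN M V hV s F hs hF
  have hlaw : IsLaw (slotLaw Λ : Finset (Fin p.2) → ℝ) := isLaw_slotLaw hΛ (by omega)
  have : Nontrivial (Fin p.2) := Fin.nontrivial_iff_two_le.2 (by omega)
  obtain ⟨s₂, hs₂⟩ := exists_ne s
  have := hp M V hV s s₂ F {s₂} hs₂.symm hs (by omega) (Finset.mem_singleton_self _) (by simp)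
  simp only [Nat.zero_le, and_true, ind_of trivial, expect_const hlaw, one_mul] at this
  simpa only [blockProb, slotBlocked_succ] using this

lemma PairLimit.succ (hΛ : IsDegreeDistribution Λ) (hρ : 0 ≤ ρ)
    (hY0 : 0 ≤ Y) (hY1 : Y ≤ 1) (h1 : SlotLimit T Λ ρ ℓ Y) (h2 : PairLimit T Λ ρ ℓ Y) :
    PairLimit T Λ ρ (ℓ + 1) (poissonTail T (ρ * Λ.derivative.eval Y)) := by
  intro ε hε
  have hm0 : 0 ≤ ρ * Λ.derivative.eval Y := mul_nonneg hρ (derivative_eval_nonneg hΛ hY0)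
  filter_upwards [eventually_abs_expect_joint_sub_le hΛ hρ hY0 hY1 h1 h2 1 T (half_pos hε),
    h1.succ hΛ hρ hY0 hY1 h2 1 (ε / 2) (half_pos hε)] with p hp1 hp2 M V hV s s₂ hss
  have h3 := hp1 M V hV s s₂ {s} {s₂} hss (Finset.mem_singleton_self _) (by simp)
    (Finset.mem_singleton_self _) (by simp)
  have h4 := hp2 M V hV s₂ {s₂} (Finset.mem_singleton_self _) (by simp)
  simp only [blockProb, slotBlocked_succ] at h4
  simp only [slotBlocked_succ, ← ind_and]
  set Y' := poissonTail T (ρ * Λ.derivative.eval Y)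
  have hY'0 : 0 ≤ Y' := poissonTail_nonneg T hm0
  have hY'1 : Y' ≤ 1 := poissonTail_le_one T hm0
  calc _ ≤ _ := abs_sub_le _ _ _
    _ ≤ ε / 2 + ε / 2 * 1 := by
        refine add_le_add h3 ?_
        rw [sq, ← sub_mul, abs_mul, abs_of_nonneg hY'0]
        gcongr
    _ = ε := by ring

/-- The probability that a slot is blocked at depth `ℓ`, according to density evolution. -/
def slotEvolution (T : ℕ) (Λ : Polynomial ℝ) (ρ : ℝ) : ℕ → ℝ
  | 0 => 1
  | ℓ + 1 => poissonTail T (ρ * Λ.derivative.eval (slotEvolution T Λ ρ ℓ))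

lemma slotEvolution_mem (hΛ : IsDegreeDistribution Λ) (hρ : 0 ≤ ρ) (ℓ : ℕ) :
    0 ≤ slotEvolution T Λ ρ ℓ ∧ slotEvolution T Λ ρ ℓ ≤ 1 := by
  induction ℓ with
  | zero => simp [slotEvolution]
  | succ ℓ ih =>
    have hm := mul_nonneg hρ (derivative_eval_nonneg hΛ ih.1)
    exact ⟨poissonTail_nonneg T hm, poissonTail_le_one T hm⟩

lemma slotLimit_and_pairLimit (hΛ : IsDegreeDistribution Λ) (hρ : 0 ≤ ρ) (ℓ : ℕ) :
    SlotLimit T Λ ρ ℓ (slotEvolution T Λ ρ ℓ) ∧ PairLimit T Λ ρ ℓ (slotEvolution T Λ ρ ℓ) := by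
  induction ℓ with
  | zero =>
    constructor
    · intro b ε hε
      filter_upwards [eventually_slots_large (Λ.natDegree + 1)] with p hpN M V hV s F hs hF
      have hlaw : IsLaw (slotLaw Λ : Finset (Fin p.2) → ℝ) := isLaw_slotLaw hΛ (by omega)
      simp only [blockProb, SlotBlocked, slotEvolution, ind_of trivial, expect_const hlaw, sub_self,
        abs_zero, hε.le]
    · intro ε hε
      filter_upwards [eventually_slots_large (Λ.natDegree + 1)] with p hpN M V hV s s₂ hs
      have hlaw : IsLaw (slotLaw Λ : Finset (Fin p.2) → ℝ) := isLaw_slotLaw hΛ (by omega)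
      simp only [SlotBlocked, slotEvolution, ind_of trivial, one_pow, mul_one, expect_const hlaw,
        sub_self, abs_zero, hε.le]
  | succ ℓ ih =>
    have hY := slotEvolution_mem (T := T) hΛ hρ ℓ
    exact ⟨ih.1.succ hΛ hρ hY.1 hY.2 ih.2, ih.2.succ hΛ hρ hY.1 hY.2 ih.1⟩

/-- A user is blocked at depth `ℓ` with probability at most that of one of its slots. -/
lemma eventually_expect_userBlocked_le (hΛ : IsDegreeDistribution Λ) (hρ : 0 ≤ ρ) (ℓ : ℕ)
    {ε : ℝ} (hε : 0 < ε) :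
    ∀ᶠ p : ℕ × ℕ in loadFilter ρ, ∀ (M : ℕ) (V : Finset (Fin M)), V.card = p.1 → ∀ i ∈ V,
      expect (slotLaw Λ) (fun S : Fin M → Finset (Fin p.2) => ind (UserBlocked T S ℓ i V ∅))
        ≤ slotEvolution T Λ ρ ℓ + ε := by
  filter_upwards [tendsto_pred_loadFilter.eventually
    ((slotLimit_and_pairLimit (T := T) hΛ hρ ℓ).1 Λ.natDegree ε hε),
    eventually_slots_large (Λ.natDegree + 1)] with p hp hpN M V hV i hi
  have hlaw : IsLaw (slotLaw Λ : Finset (Fin p.2) → ℝ) := isLaw_slotLaw hΛ (by omega)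
  have hVe : (V.erase i).card = p.1 - 1 := by rw [Finset.card_erase_of_mem hi, hV]
  rw [expect_resample hlaw i, ← one_mul (_ + _), ← hlaw.sum_eq_one, Finset.sum_mul]
  refine Finset.sum_le_sum fun R _ => ?_
  by_cases hR : slotLaw Λ R = 0
  · simp [hR]
  refine mul_le_mul_of_nonneg_left ?_ (slotLaw_nonneg hΛ R)
  obtain ⟨s, hs⟩ := nonempty_of_slotLaw_ne_zero hΛ hR
  have h := (abs_le.1 (hp M _ hVe s R hs (card_le_of_slotLaw_ne_zero hR))).2
  refine le_trans (expect_mono hlaw fun S => ind_mono fun hb => ?_)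
    (show blockProb T Λ ℓ s (V.erase i) R ≤ _ by linarith)
  have := hb s (by simpa using hs)
  rw [Function.update_self, Finset.empty_union] at this
  exact (slotBlocked_congr fun j hj => update_eq_of_mem_erase S i R hj).1 this

end Stein

/-! ### The critical degree and the density evolution recursion -/

section Critical

variable {β δ : ℝ}

lemma le_critDegree_iff (hβ : 1 ≤ β) (hδ' : δ < 1) (U : ℕ) :
    (U : ℝ) ≤ critDegree β δ ↔ 1 - (2 : ℝ) ^ (-((1 - δ) / β)) ≤ (2 : ℝ) ^ (-(U : ℝ)) := by
  have hx0 : 0 < (1 - δ) / β := div_pos (by linarith) (by linarith)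
  have h1 : (2 : ℝ) ^ (-((1 - δ) / β)) < 1 :=
    Real.rpow_lt_one_of_one_lt_of_neg one_lt_two (by linarith)
  rw [critDegree, neg_div, le_neg, Real.logb_le_iff_le_rpow one_lt_two (by linarith)]

/-- Up to the critical degree `-log₂ (1 - 2 ^ (-x))`, with `x = (1 - δ) / β`, the exponent
`2 ^ (1 - U)` of the number of unanimous positions exceeds `x`, because `2 ^ (-x) < 1 - x / 2`
by strict convexity. -/
lemma lt_of_le_critDegree (hβ : 1 ≤ β) (hδ : 0 < δ) (hδ' : δ < 1) {U : ℕ}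
    (hU : (U : ℝ) ≤ critDegree β δ) : (1 - δ) / β < 2 * (2 : ℝ)⁻¹ ^ U := by
  rw [le_critDegree_iff hβ hδ'] at hU
  set x := (1 - δ) / β with hx
  have hx0 : 0 < x := div_pos (by linarith) (by linarith)
  have hx1 : x < 1 := by
    rw [hx, div_lt_one (by linarith)]
    linarith
  have hlog : Real.log 2 ≠ 0 := (Real.log_pos one_lt_two).ne'
  have h := strictConvexOn_exp.2 (Set.mem_univ (0 : ℝ)) (Set.mem_univ (-Real.log 2))
    (by simpa using hlog) (by linarith : 0 < 1 - x) hx0 (by ring)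
  simp only [smul_eq_mul, mul_zero, zero_add, Real.exp_zero, Real.exp_neg,
    Real.exp_log (zero_lt_two : (0 : ℝ) < 2)] at h
  have h2 : (2 : ℝ) ^ (-x) = Real.exp (x * -Real.log 2) := by
    rw [Real.rpow_def_of_pos zero_lt_two]
    congr 1
    ring
  have h3 : (2 : ℝ) ^ (-(U : ℝ)) = (2 : ℝ)⁻¹ ^ U := by
    rw [Real.rpow_neg zero_le_two, Real.rpow_natCast, inv_pow]
  rw [h2, h3] at hU
  linarith

lemma one_le_critDegree (hβ : 1 ≤ β) (hδ : 0 < δ) (hδ' : δ < 1) : 1 ≤ critDegree β δ := by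
  have h := (le_critDegree_iff hβ hδ' 1).2 ?_
  · simpa using h
  have hx1 : (1 - δ) / β ≤ 1 := by
    rw [div_le_one (by linarith)]
    linarith
  have : (2 : ℝ) ^ (-1 : ℝ) ≤ (2 : ℝ) ^ (-((1 - δ) / β)) :=
    Real.rpow_le_rpow_of_exponent_le one_le_two (by linarith)
  rw [Real.rpow_neg_one] at this
  rw [Nat.cast_one, Real.rpow_neg_one]
  linarith

lemma one_le_tBar (hβ : 1 ≤ β) (hδ : 0 < δ) (hδ' : δ < 1) : 1 ≤ tBar β δ := by
  rw [tBar, Nat.one_le_floor_iff]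
  exact one_le_critDegree hβ hδ hδ'

lemma le_critDegree_of_le_tBar (hβ : 1 ≤ β) (hδ : 0 < δ) (hδ' : δ < 1) {U : ℕ}
    (hU : U ≤ tBar β δ) : (U : ℝ) ≤ critDegree β δ :=
  (Nat.le_floor_iff (zero_le_one.trans (one_le_critDegree hβ hδ hδ'))).1 hU

end Critical

lemma piBar_le_one {Λ : Polynomial ℝ} (hΛ : IsDegreeDistribution Λ) {μ G D : ℝ} (hμ : 0 < μ)
    (hG : 0 < G) (hD : 0 < D) (β δ : ℝ) (U : ℕ) : piBar μ Λ G D β δ U ≤ 1 := by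
  unfold piBar
  split_ifs
  · exact zero_le_one
  · rw [Real.exp_le_one_iff, neg_nonpos]
    have h1 : 0 ≤ avgDegree Λ := zero_le_one.trans (one_le_avgDegree hΛ)
    have h2 : (2 : ℝ) ^ (-(U : ℝ)) ≤ 1 :=
      Real.rpow_le_one_of_one_le_of_nonpos one_le_two (by simp)
    have h3 := Real.rpow_nonneg (sub_nonneg.2 h2) (β * Real.logb 2 D)
    positivity
  · exact le_rfl

section Evolution

variable {Λ : Polynomial ℝ}

lemma edgePoly_mono (hΛ : IsDegreeDistribution Λ) {u v : ℝ} (hu : 0 ≤ u) (huv : u ≤ v) :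
    edgePoly Λ u ≤ edgePoly Λ v := by
  have h1 : 0 ≤ avgDegree Λ := zero_le_one.trans (one_le_avgDegree hΛ)
  unfold edgePoly
  rw [eval_derivative_eq_sum hΛ, eval_derivative_eq_sum hΛ]
  refine div_le_div_of_nonneg_right (Finset.sum_le_sum fun k _ => ?_) h1
  have := hΛ.nonneg (k + 1)
  gcongr

lemma continuous_edgePoly (Λ : Polynomial ℝ) : Continuous (edgePoly Λ) := by
  unfold edgePoly
  exact Λ.derivative.continuous.div_const _

lemma poissonTail_zero {T : ℕ} (hT : 1 ≤ T) : poissonTail T 0 = 0 := by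
  obtain ⟨t, rfl⟩ : ∃ t, T = t + 1 := ⟨T - 1, by omega⟩
  simp [poissonTail, Finset.sum_range_succ']

/-- The density evolution inequality at load `G` is inherited by all smaller loads: rescale `p`. -/
lemma edgePoly_poissonTail_lt (hΛ : IsDegreeDistribution Λ) {μ G D β δ ρ : ℝ} (hμ : 0 < μ)
    (hD : 0 < D) (hG : 0 < G) (h : DensityEvolution μ Λ D β δ G) (hρ : 0 < ρ) (hρG : ρ ≤ G)
    {p : ℝ} (hp : 0 < p) (hp1 : p ≤ 1) :
    edgePoly Λ (poissonTail (tBar β δ) (ρ * avgDegree Λ * p)) < p := by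
  have hκ : 0 < avgDegree Λ := zero_lt_one.trans_le (one_le_avgDegree hΛ)
  set q := ρ / G * p with hq
  have hr1 : ρ / G ≤ 1 := (div_le_one hG).2 hρG
  have hqp : q ≤ p := mul_le_of_le_one_left hp.le hr1
  have hq0 : 0 < q := by positivity
  have hGq : q * G * avgDegree Λ = ρ * avgDegree Λ * p := by rw [hq]; field_simp
  have hm : 0 ≤ ρ * avgDegree Λ * p := by positivity
  refine lt_of_le_of_lt (edgePoly_mono hΛ (poissonTail_nonneg _ hm) ?_)
    ((h q hq0 (hqp.trans hp1)).trans_le hqp)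
  rw [hGq, show G * avgDegree Λ * q = ρ * avgDegree Λ * p by rw [← hGq]; ring, poissonTail]
  refine sub_le_sub_left (mul_le_mul_of_nonneg_left (Finset.sum_le_sum fun u _ => ?_)
    (Real.exp_pos _).le) _
  have h1 := piBar_le_one hΛ hμ hG hD β δ (u + 1)
  rw [div_mul_eq_mul_div]
  gcongr
  exact mul_le_of_le_one_left (by positivity) h1

lemma tendsto_slotEvolution_zero (hΛ : IsDegreeDistribution Λ) {T : ℕ} (hT : 1 ≤ T) {ρ : ℝ}
    (hρ : 0 < ρ)
    (h : ∀ p : ℝ, 0 < p → p ≤ 1 → edgePoly Λ (poissonTail T (ρ * avgDegree Λ * p)) < p) :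
    Tendsto (slotEvolution T Λ ρ) atTop (𝓝 0) := by
  have hκ : 0 < avgDegree Λ := zero_lt_one.trans_le (one_le_avgDegree hΛ)
  set f : ℝ → ℝ := fun p => edgePoly Λ (poissonTail T (ρ * avgDegree Λ * p)) with hf
  have hfc : Continuous f :=
    (continuous_edgePoly Λ).comp
      ((continuous_poissonTail T).comp (continuous_const.mul continuous_id))
  have hf0 : f 0 ≤ 0 := by
    have h1 : Tendsto (fun n : ℕ => f (1 / ((n : ℝ) + 1))) atTop (𝓝 (f 0)) :=
      (hfc.tendsto 0).comp tendsto_one_div_add_atTop_nhds_zero_nat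
    refine le_of_tendsto_of_tendsto' h1 tendsto_one_div_add_atTop_nhds_zero_nat fun n => ?_
    refine (h _ (by positivity) ?_).le
    rw [div_le_one (by positivity)]
    have : (0 : ℝ) ≤ n := n.cast_nonneg
    linarith
  set p : ℕ → ℝ := fun ℓ => edgePoly Λ (slotEvolution T Λ ρ ℓ) with hp
  have hY := slotEvolution_mem (T := T) hΛ hρ.le
  have hstep : ∀ ℓ, slotEvolution T Λ ρ (ℓ + 1) = poissonTail T (ρ * avgDegree Λ * p ℓ) := by
    intro ℓ
    rw [slotEvolution]
    simp only [hp, edgePoly]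
    congr 1
    field_simp
  have hp0 : ∀ ℓ, 0 ≤ p ℓ := fun ℓ => div_nonneg (derivative_eval_nonneg hΛ (hY ℓ).1) hκ.le
  have hp1 : ∀ ℓ, p ℓ ≤ 1 := fun ℓ => by
    refine (edgePoly_mono hΛ (hY ℓ).1 (hY ℓ).2).trans_eq ?_
    exact div_self hκ.ne'
  have hpf : ∀ ℓ, p (ℓ + 1) = f (p ℓ) := fun ℓ => by
    change edgePoly Λ (slotEvolution T Λ ρ (ℓ + 1)) = _
    rw [hstep]
  have hanti : Antitone p := antitone_nat_of_succ_le fun ℓ => by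
    rw [hpf]
    rcases (hp0 ℓ).eq_or_lt with h0 | h0
    · rw [← h0]; exact hf0
    · exact (h _ h0 (hp1 ℓ)).le
  have hlim := tendsto_atTop_ciInf hanti ⟨0, by rintro _ ⟨ℓ, rfl⟩; exact hp0 ℓ⟩
  set c := ⨅ ℓ, p ℓ
  have hc0 : 0 ≤ c := ge_of_tendsto' hlim hp0
  have hc1 : c ≤ 1 := le_of_tendsto' hlim hp1
  have hfix : f c = c := by
    have h1 : Tendsto (fun ℓ => f (p ℓ)) atTop (𝓝 (f c)) := (hfc.tendsto c).comp hlim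
    have h2 : Tendsto (fun ℓ => p (ℓ + 1)) atTop (𝓝 c) := hlim.comp (tendsto_add_atTop_nat 1)
    simp only [hpf] at h2
    exact tendsto_nhds_unique h1 h2
  have hc : c = 0 := by
    by_contra hne
    have h3 := h c (lt_of_le_of_ne hc0 (Ne.symm hne)) hc1
    change f c < c at h3
    rw [hfix] at h3
    exact lt_irrefl _ h3
  rw [hc] at hlim
  rw [← tendsto_add_atTop_iff_nat 1]
  simp only [hstep]
  have h4 := ((continuous_poissonTail T).tendsto (ρ * avgDegree Λ * 0)).comp
    (hlim.const_mul (ρ * avgDegree Λ))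
  rwa [mul_zero, poissonTail_zero hT] at h4

end Evolution

/-! ### The decoder is at least as good as message passing -/

section Decoder

variable {M N n : ℕ} {cb : Codebook M N n}

/-- The bits of message `m` agree with those of the messages in `B` wherever the latter are
unanimous, so that the discarding process cannot distinguish `m` from the messages in `B`. -/
def Consistent {M n : ℕ} (x : Fin M → Fin n → Bool) (B : Finset (Fin M)) (m : Fin M) : Prop :=
  ∀ (j : Fin n) (b : Bool), (∀ i ∈ B, x i j = b) → x m j = b

/-- Some set `B` of at most `T` transmitted messages cannot be resolved in slot `s`, because
another message assigned to this slot survives. -/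
def SlotBad (T : ℕ) (cb : Codebook M N n) (A : Finset (Fin M)) (s : Fin N) : Prop :=
  ∃ B ⊆ A.filter (fun i => s ∈ (cb i).2), B.Nonempty ∧ B.card ≤ T ∧
    ∃ m ∉ B, s ∈ (cb m).2 ∧ Consistent (fun i => (cb i).1) B m

lemma slotSum_zero (B : Finset (Fin M)) (s : Fin N) :
    slotSum cb B s 0 = ((B.filter fun i => s ∈ (cb i).2).card : ℤ) := by
  simp [slotSum, symbol]

lemma slotSum_succ (B : Finset (Fin M)) (s : Fin N) (j : Fin n) :
    slotSum cb B s j.succ =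
      (((B.filter fun i => s ∈ (cb i).2).filter fun i => (cb i).1 j = true).card : ℤ) := by
  simp [slotSum, symbol]

/-- The survivors are the candidates that are consistent with the colliding messages. -/
lemma mem_survivors_iff {B : Finset (Fin M)} {s : Fin N} {m : Fin M} :
    m ∈ survivors cb s (slotSum cb B s) ↔
      s ∈ (cb m).2 ∧ Consistent (fun i => (cb i).1) (B.filter fun i => s ∈ (cb i).2) m := by
  set C := B.filter fun i => s ∈ (cb i).2 with hC
  rw [survivors, candidates, Finset.filter_filter, Finset.mem_filter]
  simp only [Finset.mem_univ, true_and]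
  refine and_congr_right fun _ => ?_
  have h1 : ∀ j : Fin n, slotSum cb B s j.succ = slotSum cb B s 0 ↔ ∀ i ∈ C, (cb i).1 j = true := by
    intro j
    rw [slotSum_succ, slotSum_zero, ← hC, Nat.cast_inj, Finset.card_filter_eq_iff]
  have h0 : ∀ j : Fin n, slotSum cb B s j.succ = 0 ↔ ∀ i ∈ C, (cb i).1 j = false := by
    intro j
    rw [slotSum_succ, ← hC, Nat.cast_eq_zero, Finset.card_eq_zero, Finset.filter_eq_empty_iff]
    simp
  have hs0 : ∀ j : Fin n, symbol (cb m) j.succ = 0 ↔ (cb m).1 j = false := by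
    intro j
    cases h : (cb m).1 j <;> simp [symbol, h]
  have hs1 : ∀ j : Fin n, symbol (cb m) j.succ = 1 ↔ (cb m).1 j = true := by
    intro j
    cases h : (cb m).1 j <;> simp [symbol, h]
  simp only [h1, h0, hs0, hs1]
  constructor
  · intro h j b hb
    cases b
    · by_contra hne
      exact (h j).2 ⟨hb, by simpa using hne⟩
    · by_contra hne
      exact (h j).1 ⟨hb, by simpa using hne⟩
  · intro h j
    constructor
    · rintro ⟨h2, h3⟩
      have := h j true h2
      simp only at this
      rw [h3] at this
      exact Bool.noConfusion this
    · rintro ⟨h2, h3⟩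
      have := h j false h2
      simp only at this
      rw [h3] at this
      exact Bool.noConfusion this

lemma subset_survivors {B : Finset (Fin M)} {s : Fin N} :
    (B.filter fun i => s ∈ (cb i).2) ⊆ survivors cb s (slotSum cb B s) := by
  intro i hi
  exact mem_survivors_iff.2 ⟨(Finset.mem_filter.1 hi).2, fun j b h => h i hi⟩

/-- In a resolved slot, precisely the colliding messages survive. -/
lemma survivors_eq_of_resolves {B : Finset (Fin M)} {s : Fin N}
    (h : Resolves cb s (slotSum cb B s)) :
    survivors cb s (slotSum cb B s) = B.filter fun i => s ∈ (cb i).2 := by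
  have h2 := h.2
  rw [slotSum_zero, Nat.cast_inj] at h2
  exact (Finset.eq_of_subset_of_card_le subset_survivors h2.le).symm

lemma resolves_iff {B : Finset (Fin M)} {s : Fin N} :
    Resolves cb s (slotSum cb B s) ↔ (B.filter fun i => s ∈ (cb i).2).Nonempty ∧
      ∀ m, s ∈ (cb m).2 → Consistent (fun i => (cb i).1) (B.filter fun i => s ∈ (cb i).2) m →
        m ∈ B.filter fun i => s ∈ (cb i).2 := by
  constructor
  · intro h
    have h1 := h.1
    rw [slotSum_zero, Nat.cast_pos, Finset.card_pos] at h1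
    refine ⟨h1, fun m hm hc => ?_⟩
    rw [← survivors_eq_of_resolves h]
    exact mem_survivors_iff.2 ⟨hm, hc⟩
  · rintro ⟨h1, h2⟩
    have h3 : survivors cb s (slotSum cb B s) = B.filter fun i => s ∈ (cb i).2 := by
      refine Finset.Subset.antisymm (fun m hm => ?_) subset_survivors
      obtain ⟨h4, h5⟩ := mem_survivors_iff.1 hm
      exact h2 m h4 h5
    refine ⟨?_, ?_⟩
    · rw [slotSum_zero, Nat.cast_pos, Finset.card_pos]
      exact h1
    · rw [h3, slotSum_zero]

lemma slotSum_sub {A R : Finset (Fin M)} (h : R ⊆ A) (s : Fin N) :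
    slotSum cb A s - slotSum cb R s = slotSum cb (A \ R) s := by
  ext j
  simp only [slotSum, Pi.sub_apply, Finset.sum_filter]
  rw [sub_eq_iff_eq_add, Finset.sum_sdiff h]

lemma step_subset {A R : Finset (Fin M)} (h : R ⊆ A) : step cb (slotSum cb A) R ⊆ A := by
  intro i hi
  rw [step, Finset.mem_union, Finset.mem_filter] at hi
  rcases hi with hi | ⟨_, s, h1, h2⟩
  · exact h hi
  · rw [slotSum_sub h] at h1 h2
    rw [survivors_eq_of_resolves h1] at h2
    exact (Finset.mem_sdiff.1 (Finset.mem_filter.1 h2).1).1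

lemma iterate_step_subset (A : Finset (Fin M)) (t : ℕ) :
    (step cb (slotSum cb A))^[t] ∅ ⊆ A := by
  induction t with
  | zero => simp
  | succ t ih => rw [Function.iterate_succ_apply']; exact step_subset ih

lemma iterate_step_mono (A : Finset (Fin M)) {t t' : ℕ} (h : t ≤ t') :
    (step cb (slotSum cb A))^[t] ∅ ⊆ (step cb (slotSum cb A))^[t'] ∅ := by
  induction h with
  | refl => exact subset_rfl
  | step _ ih =>
    rw [Function.iterate_succ_apply']
    exact ih.trans Finset.subset_union_left

/-- A slot that is not bad and in which at most `T` messages remain is resolved. -/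
lemma mem_step {T : ℕ} {A R : Finset (Fin M)} (h : R ⊆ A) {s : Fin N} (hbad : ¬ SlotBad T cb A s)
    (hcard : ((A \ R).filter fun i => s ∈ (cb i).2).card ≤ T) {i : Fin M} (hi : i ∈ A \ R)
    (his : s ∈ (cb i).2) : i ∈ step cb (slotSum cb A) R := by
  have hi' : i ∈ (A \ R).filter fun i => s ∈ (cb i).2 := Finset.mem_filter.2 ⟨hi, his⟩
  rw [step, Finset.mem_union, Finset.mem_filter]
  refine Or.inr ⟨Finset.mem_univ _, s, ?_⟩
  rw [slotSum_sub h]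
  refine ⟨resolves_iff.2 ⟨⟨i, hi'⟩, fun m hm hc => ?_⟩, subset_survivors hi'⟩
  by_contra hmB
  exact hbad ⟨_, Finset.filter_subset_filter _ Finset.sdiff_subset, ⟨i, hi'⟩, hcard, m, hmB, hm, hc⟩

/-- A bad slot is met within `ℓ` steps from user `i` in the graph of the users `V`, along a path
that does not repeat users. -/
def BadReach {ι : Type*} [DecidableEq ι] (bad : Fin N → Prop) (S : ι → Finset (Fin N)) :
    ℕ → ι → Finset ι → Prop
  | 0, _, _ => False
  | ℓ + 1, i, V => ∃ s ∈ S i, bad s ∨ ∃ i' ∈ V.erase i, s ∈ S i' ∧ BadReach bad S ℓ i' (V.erase i)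

/-- A user that is not blocked at depth `ℓ` is decoded within `ℓ` iterations, if message passing
meets no bad slot. The users outside of `V` do not interfere, as they have all their slots in the
set `F` of slots that are not used any more. -/
lemma mem_iterate_step {T ℓ : ℕ} {A V : Finset (Fin M)} {F : Finset (Fin N)} (hV : V ⊆ A)
    (hF : ∀ j ∈ A \ V, (cb j).2 ⊆ F) {i : Fin M} (hi : i ∈ V)
    (hb : ¬ UserBlocked T (fun i => (cb i).2) ℓ i V F)
    (hr : ¬ BadReach (SlotBad T cb A) (fun i => (cb i).2) ℓ i V) :
    i ∈ (step cb (slotSum cb A))^[ℓ] ∅ := by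
  induction ℓ generalizing V F i with
  | zero => exact absurd (fun _ _ => trivial) hb
  | succ ℓ ih =>
    unfold UserBlocked at hb
    push Not at hb
    obtain ⟨s, hs, hsb⟩ := hb
    rw [slotBlocked_succ, not_le] at hsb
    rw [Finset.mem_sdiff] at hs
    unfold BadReach at hr
    push Not at hr
    obtain ⟨hbad, hr⟩ := hr s hs.1
    set R := (step cb (slotSum cb A))^[ℓ] ∅ with hR
    have hRA : R ⊆ A := iterate_step_subset A ℓ
    rw [Function.iterate_succ_apply', ← hR]
    by_cases hiR : i ∈ R
    · exact Finset.mem_union_left _ hiR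
    refine mem_step hRA hbad ?_ (Finset.mem_sdiff.2 ⟨hV hi, hiR⟩) hs.1
    classical
    have hF' : ∀ j ∈ A \ V.erase i, (cb j).2 ⊆ F ∪ (cb i).2 := by
      intro j hj
      rw [Finset.mem_sdiff, Finset.mem_erase, not_and] at hj
      by_cases hji : j = i
      · rw [hji]; exact Finset.subset_union_right
      · exact (hF j (Finset.mem_sdiff.2 ⟨hj.1, hj.2 hji⟩)).trans Finset.subset_union_left
    have hsub : ((A \ R).filter fun i => s ∈ (cb i).2) ⊆
        insert i ((V.erase i).filter fun j => s ∈ (cb j).2 ∧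
          UserBlocked T (fun i => (cb i).2) ℓ j (V.erase i) (F ∪ (cb i).2)) := by
      intro j hj
      rw [Finset.mem_filter, Finset.mem_sdiff] at hj
      obtain ⟨⟨hjA, hjR⟩, hjs⟩ := hj
      by_cases hji : j = i
      · exact hji ▸ Finset.mem_insert_self _ _
      have hjV : j ∈ V.erase i := by
        refine Finset.mem_erase.2 ⟨hji, ?_⟩
        by_contra hjV
        exact hs.2 (hF j (Finset.mem_sdiff.2 ⟨hjA, hjV⟩) hjs)
      refine Finset.mem_insert_of_mem (Finset.mem_filter.2 ⟨hjV, hjs, ?_⟩)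
      by_contra hjb
      exact hjR (ih ((Finset.erase_subset _ _).trans hV) hF' hjV hjb (hr j hjV hjs))
    have hcount : ((V.erase i).filter fun j => s ∈ (cb j).2 ∧
          UserBlocked T (fun i => (cb i).2) ℓ j (V.erase i) (F ∪ (cb i).2)).card
        = blockedCount T (fun i => (cb i).2) ℓ s (V.erase i) (F ∪ (cb i).2) := by
      unfold blockedCount
      congr!
    have := (Finset.card_le_card hsub).trans (Finset.card_insert_le _ _)
    omega

/-- A lost message is blocked in message passing, or message passing meets a bad slot. -/
lemma userBlocked_or_badReach_of_notMem_decoded {T ℓ : ℕ} {A : Finset (Fin M)} (hℓ : ℓ ≤ M)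
    {i : Fin M} (hi : i ∈ A) (h : i ∉ decoded cb (slotSum cb A)) :
    UserBlocked T (fun i => (cb i).2) ℓ i A ∅ ∨
      BadReach (SlotBad T cb A) (fun i => (cb i).2) ℓ i A := by
  by_contra hne
  rw [not_or] at hne
  exact h (iterate_step_mono A hℓ (mem_iterate_step subset_rfl (by simp) hi hne.1 hne.2))

end Decoder

/-! ### Random bits and false survivors -/

section Independence

variable {ι β : Type*} [Fintype ι] [DecidableEq ι] [Fintype β] {w : β → ℝ}

lemma expect_prod (g : ι → β → ℝ) :
    expect w (fun x => ∏ i, g i (x i)) = ∏ i, ∑ b, w b * g i b := by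
  simp only [expect, ← Finset.prod_mul_distrib]
  exact (Fintype.prod_sum fun i b => w b * g i b).symm

lemma expect_mul_coord (hw : IsLaw w) (i : ι) {χ : (ι → β) → ℝ} {φ : (ι → β) → β → ℝ}
    (hχ : ∀ x b, χ (Function.update x i b) = χ x) (hφ : ∀ x b, φ (Function.update x i b) = φ x) :
    expect w (fun x => χ x * φ x (x i)) = expect w (fun x => χ x * ∑ b, w b * φ x b) := by
  rw [expect_resample hw i]
  simp only [hχ, hφ, Function.update_self, Finset.mul_sum]
  rw [expect_sum]
  refine Finset.sum_congr rfl fun b _ => ?_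
  rw [← expect_const_mul]
  exact expect_congr fun x => by ring

/-- Given the coordinates in `A`, the coordinates outside of `A` are independent. -/
lemma expect_mul_prod_coord (hw : IsLaw w) (A C : Finset ι) (hC : Disjoint A C)
    {χ : (ι → β) → ℝ} {φ : (ι → β) → β → ℝ}
    (hχ : ∀ i ∉ A, ∀ x b, χ (Function.update x i b) = χ x)
    (hφ : ∀ i ∉ A, ∀ x b, φ (Function.update x i b) = φ x) :
    expect w (fun x => χ x * ∏ i ∈ C, φ x (x i))
      = expect w (fun x => χ x * (∑ b, w b * φ x b) ^ C.card) := by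
  induction C using Finset.induction_on generalizing χ with
  | empty => simp
  | insert m C hm ih =>
    rw [Finset.disjoint_insert_right] at hC
    have h1 : ∀ x : ι → β, χ x * ∏ i ∈ insert m C, φ x (x i)
        = (χ x * ∏ i ∈ C, φ x (x i)) * φ x (x m) := by
      intro x
      rw [Finset.prod_insert hm]
      ring
    rw [expect_congr h1, expect_mul_coord hw m]
    · have h2 : ∀ x : ι → β, (χ x * ∏ i ∈ C, φ x (x i)) * (∑ b, w b * φ x b)
          = (χ x * (∑ b, w b * φ x b)) * ∏ i ∈ C, φ x (x i) := fun x => by ring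
      rw [expect_congr h2, ih hC.2]
      · rw [Finset.card_insert_of_notMem hm]
        exact expect_congr fun x => by ring
      · intro i hi x b
        rw [hχ i hi, hφ i hi]
    · intro x b
      rw [hχ m hC.1, hφ m hC.1]
      congr 1
      refine Finset.prod_congr rfl fun i hi => ?_
      rw [Function.update_of_ne]
      rintro rfl
      exact hm hi
    · exact hφ m hC.1

end Independence

section Binomial

/-- The expectation of `g` under the binomial distribution with parameters `n` and `p`. -/
def binomExpect (n : ℕ) (p : ℝ) (g : ℕ → ℝ) : ℝ :=
  ∑ e ∈ Finset.range (n + 1), (n.choose e : ℝ) * p ^ e * (1 - p) ^ (n - e) * g e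

lemma sum_finset_eq_binomExpect (n : ℕ) (p : ℝ) (g : ℕ → ℝ) :
    ∑ E : Finset (Fin n), p ^ E.card * (1 - p) ^ (n - E.card) * g E.card = binomExpect n p g := by
  have h := Finset.sum_powerset_apply_card (fun e => p ^ e * (1 - p) ^ (n - e) * g e)
    (x := (Finset.univ : Finset (Fin n)))
  rw [Finset.powerset_univ, Finset.card_univ, Fintype.card_fin] at h
  rw [h, binomExpect]
  exact Finset.sum_congr rfl fun e _ => by rw [nsmul_eq_mul]; ring

/-- The number of coordinates with a given property is binomially distributed. -/
lemma expect_card_filter {β : Type*} [Fintype β] {w : β → ℝ} (hw : IsLaw w) {n : ℕ} {p : ℝ}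
    (Q : β → Prop) [DecidablePred Q] (hp : ∑ b, w b * ind (Q b) = p) (g : ℕ → ℝ) :
    expect w (fun x : Fin n → β => g (Finset.univ.filter fun j => Q (x j)).card)
      = binomExpect n p g := by
  have hp' : ∑ b, w b * ind (¬ Q b) = 1 - p := by
    rw [← hp, ← hw.sum_eq_one, ← Finset.sum_sub_distrib]
    refine Finset.sum_congr rfl fun b _ => ?_
    by_cases h : Q b
    · rw [ind_of h, ind_of_not (not_not.2 h)]; ring
    · rw [ind_of_not h, ind_of h]; ring
  have h1 : ∀ x : Fin n → β, g (Finset.univ.filter fun j => Q (x j)).card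
      = ∑ E : Finset (Fin n), g E.card * ∏ j, if j ∈ E then ind (Q (x j)) else ind (¬ Q (x j)) := by
    intro x
    rw [Finset.sum_eq_single (Finset.univ.filter fun j => Q (x j))]
    · rw [Finset.prod_eq_one, mul_one]
      intro j _
      by_cases h : Q (x j) <;> simp [h, ind]
    · intro E _ hE
      obtain ⟨j, hj⟩ : ∃ j, ¬ (j ∈ E ↔ Q (x j)) := by
        by_contra hne
        push Not at hne
        exact hE (by ext j; simp [hne j])
      rw [Finset.prod_eq_zero (Finset.mem_univ j), mul_zero]
      by_cases h : j ∈ E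
      · rw [if_pos h, ind_of_not]
        exact fun hQ => hj ⟨fun _ => hQ, fun _ => h⟩
      · rw [if_neg h, ind_of_not]
        exact fun hQ => hj ⟨fun hE => absurd hE h, fun hQ' => absurd hQ' hQ⟩
    · exact fun h => absurd (Finset.mem_univ _) h
  rw [expect_congr h1, expect_sum, ← sum_finset_eq_binomExpect]
  refine Finset.sum_congr rfl fun E _ => ?_
  rw [expect_const_mul]
  have h2 : expect w (fun x : Fin n → β => ∏ j, if j ∈ E then ind (Q (x j)) else ind (¬ Q (x j)))
      = ∏ j : Fin n, if j ∈ E then p else 1 - p := by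
    have := expect_prod (w := w) (fun (j : Fin n) b => if j ∈ E then ind (Q b) else ind (¬ Q b))
    rw [this]
    refine Finset.prod_congr rfl fun j _ => ?_
    split_ifs
    · exact hp
    · exact hp'
  rw [h2, Finset.prod_ite, Finset.prod_const, Finset.prod_const]
  have h3 : (Finset.univ.filter fun j => j ∈ E) = E := by ext; simp
  have h4 : (Finset.univ.filter fun j => j ∉ E) = Eᶜ := by ext; simp
  rw [h3, h4, Finset.card_compl, Fintype.card_fin]
  ring

variable {n : ℕ} {p : ℝ}

lemma binomExpect_mono (hp0 : 0 ≤ p) (hp1 : p ≤ 1) {f g : ℕ → ℝ} (h : ∀ e ≤ n, f e ≤ g e) :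
    binomExpect n p f ≤ binomExpect n p g := by
  have : 0 ≤ 1 - p := by linarith
  exact Finset.sum_le_sum fun e he =>
    mul_le_mul_of_nonneg_left (h e (Nat.lt_succ_iff.1 (Finset.mem_range.1 he))) (by positivity)

lemma binomExpect_add (f g : ℕ → ℝ) :
    binomExpect n p (fun e => f e + g e) = binomExpect n p f + binomExpect n p g := by
  simp only [binomExpect, mul_add, Finset.sum_add_distrib]

lemma binomExpect_const (c : ℝ) : binomExpect n p (fun _ => c) = c := by
  have h := add_pow p (1 - p) n
  rw [add_sub_cancel, one_pow] at h
  rw [binomExpect, ← Finset.sum_mul]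
  conv_rhs => rw [← one_mul c, h]
  congr 1
  exact Finset.sum_congr rfl fun e _ => by ring

lemma binomExpect_const_mul (c : ℝ) (f : ℕ → ℝ) :
    binomExpect n p (fun e => c * f e) = c * binomExpect n p f := by
  simp only [binomExpect, Finset.mul_sum]
  exact Finset.sum_congr rfl fun e _ => by ring

lemma binomExpect_nonneg (hp0 : 0 ≤ p) (hp1 : p ≤ 1) {f : ℕ → ℝ} (h : ∀ e ≤ n, 0 ≤ f e) :
    0 ≤ binomExpect n p f :=
  (binomExpect_const (n := n) (p := p) 0).symm.trans_le (binomExpect_mono hp0 hp1 h)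

/-- Chebyshev's inequality for the binomial distribution. -/
lemma binomExpect_ind_far_le (hp0 : 0 ≤ p) (hp1 : p ≤ 1) (hn : 0 < n) {c : ℝ} (hc : 0 < c) :
    binomExpect n p (fun e => ind (c ≤ |(e : ℝ) / n - p|)) ≤ 1 / (c ^ 2 * n) := by
  have hv := bernstein.variance hn.ne' (⟨p, hp0, hp1⟩ : unitInterval)
  have hv' : binomExpect n p (fun e => (p - (e : ℝ) / n) ^ 2) = p * (1 - p) / n := by
    simp only at hv
    rw [binomExpect, Finset.sum_range, ← hv]
    refine Finset.sum_congr rfl fun k _ => ?_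
    rw [bernstein_apply]
    simp only [bernstein.z]
    ring
  have hnr : (0 : ℝ) < n := by exact_mod_cast hn
  calc _ ≤ binomExpect n p (fun e => (c ^ 2)⁻¹ * (p - (e : ℝ) / n) ^ 2) := by
        refine binomExpect_mono hp0 hp1 fun e _ => ?_
        by_cases h : c ≤ |(e : ℝ) / n - p|
        · rw [ind_of h, ← div_eq_inv_mul, one_le_div (by positivity), ← sq_abs (p - _),
            abs_sub_comm]
          gcongr
        · rw [ind_of_not h]
          positivity
    _ = (c ^ 2)⁻¹ * (p * (1 - p) / n) := by rw [binomExpect_const_mul, hv']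
    _ ≤ (c ^ 2)⁻¹ * (1 / n) := by
        gcongr
        nlinarith
    _ = _ := by field_simp

end Binomial

section Bits

variable {M N n : ℕ}

/-- The uniform distribution of the bits of a codeword. -/
def bitLaw (n : ℕ) (_ : Fin n → Bool) : ℝ := (1 / 2) ^ n

lemma isLaw_bitLaw (n : ℕ) : IsLaw (bitLaw n) := by
  refine ⟨fun _ => by unfold bitLaw; positivity, ?_⟩
  simp [bitLaw]

/-- The uniform distribution on the two values of a bit. -/
def coinLaw (_ : Bool) : ℝ := 1 / 2

lemma sum_bitLaw_eq_expect (g : (Fin n → Bool) → ℝ) :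
    ∑ c, bitLaw n c * g c = expect coinLaw g := by
  simp [bitLaw, expect, coinLaw]

/-- The positions in which all the messages in `B` have the same bit. -/
def unanimous (x : Fin M → Fin n → Bool) (B : Finset (Fin M)) : Finset (Fin n) :=
  Finset.univ.filter fun j => (∀ i ∈ B, x i j = true) ∨ ∀ i ∈ B, x i j = false

lemma expect_coin_prod {ι : Type*} [Fintype ι] [DecidableEq ι] (B : Finset ι) (b : Bool) :
    expect coinLaw (fun c : ι → Bool => ind (∀ i ∈ B, c i = b)) = (1 / 2) ^ B.card := by
  rw [expect_congr fun c => ind_forall_mem_eq_prod B fun i => c i = b]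
  have := expect_prod (w := coinLaw) (fun (i : ι) c => if i ∈ B then ind (c = b) else 1)
  rw [this]
  have h2 : ∀ i : ι, ∑ c, coinLaw c * (if i ∈ B then ind (c = b) else 1)
      = if i ∈ B then 1 / 2 else 1 := by
    intro i
    cases b <;> by_cases hi : i ∈ B <;> simp [coinLaw, hi, ind]
  simp only [h2]
  rw [Finset.prod_ite_mem, Finset.univ_inter, Finset.prod_const]

/-- The number of unanimous positions of `u` messages is binomial with parameter `2 ^ (1 - u)`. -/
lemma expect_card_unanimous {B : Finset (Fin M)} (hB : B.Nonempty) (g : ℕ → ℝ) :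
    expect (bitLaw n) (fun x => g (unanimous x B).card)
      = binomExpect n (2 * (2 : ℝ)⁻¹ ^ B.card) g := by
  have h1 : expect (bitLaw n) (fun x : Fin M → Fin n → Bool => g (unanimous x B).card)
      = expect (bitLaw M) (fun y : Fin n → Fin M → Bool =>
        g (Finset.univ.filter fun j => (∀ i ∈ B, y j i = true) ∨ ∀ i ∈ B, y j i = false).card) := by
    rw [expect, expect]
    refine Fintype.sum_equiv (Equiv.piComm fun _ _ => Bool) _ _ fun x => ?_
    simp only [bitLaw, Finset.prod_const, Finset.card_univ, Fintype.card_fin, ← pow_mul]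
    rw [mul_comm n M]
    rfl
  rw [h1]
  refine expect_card_filter (isLaw_bitLaw M)
    (fun c : Fin M → Bool => (∀ i ∈ B, c i = true) ∨ ∀ i ∈ B, c i = false) ?_ g
  rw [sum_bitLaw_eq_expect]
  have h2 : ∀ c : Fin M → Bool, ind ((∀ i ∈ B, c i = true) ∨ ∀ i ∈ B, c i = false)
      = ind (∀ i ∈ B, c i = true) + ind (∀ i ∈ B, c i = false) := by
    intro c
    obtain ⟨i, hi⟩ := hB
    by_cases h3 : ∀ i ∈ B, c i = true
    · have h4 : ¬ ∀ i ∈ B, c i = false := fun h => by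
        have := h i hi
        rw [h3 i hi] at this
        exact Bool.noConfusion this
      rw [ind_of h3, ind_of_not h4, ind_of (Or.inl h3), add_zero]
    · rw [ind_of_not h3, zero_add]
      exact ind_congr ⟨fun h => h.resolve_left h3, Or.inr⟩
  rw [expect_congr h2, expect_add, expect_coin_prod, expect_coin_prod]
  rw [one_div]
  ring

/-- Given the bits of `B`, another message is consistent with them with probability `2 ^ (-e)`,
where `e` is the number of unanimous positions. -/
lemma sum_bitLaw_consistent {B : Finset (Fin M)} (hB : B.Nonempty) (x : Fin M → Fin n → Bool) :
    ∑ c, bitLaw n c * ind (∀ (j : Fin n) (b : Bool), (∀ i ∈ B, x i j = b) → c j = b)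
      = (2 : ℝ)⁻¹ ^ (unanimous x B).card := by
  obtain ⟨k, hk⟩ := hB
  have h1 : ∀ c : Fin n → Bool, ind (∀ (j : Fin n) (b : Bool), (∀ i ∈ B, x i j = b) → c j = b)
      = ind (∀ j ∈ unanimous x B, c j = x k j) := by
    refine fun c => ind_congr ⟨fun h j hj => ?_, fun h j b hb => ?_⟩
    · rw [unanimous, Finset.mem_filter] at hj
      rcases hj.2 with hj | hj
      · rw [h j _ hj, hj k hk]
      · rw [h j _ hj, hj k hk]
    · rw [h j, hb k hk]
      rw [unanimous, Finset.mem_filter]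
      cases b
      · exact ⟨Finset.mem_univ _, Or.inr hb⟩
      · exact ⟨Finset.mem_univ _, Or.inl hb⟩
  rw [Finset.sum_congr rfl fun c _ => by rw [h1 c], sum_bitLaw_eq_expect]
  rw [expect_congr fun c => ind_forall_mem_eq_prod (unanimous x B) fun j => c j = x k j]
  have := expect_prod (w := coinLaw) (fun (j : Fin n) c =>
    if j ∈ unanimous x B then ind (c = x k j) else 1)
  rw [this]
  have h3 : ∀ j : Fin n, ∑ c, coinLaw c * (if j ∈ unanimous x B then ind (c = x k j) else 1)
      = if j ∈ unanimous x B then (2 : ℝ)⁻¹ else 1 := by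
    intro j
    cases x k j <;> by_cases hi : j ∈ unanimous x B <;> simp [coinLaw, hi, ind]
  simp only [h3]
  rw [Finset.prod_ite_mem, Finset.univ_inter, Finset.prod_const]

lemma unanimous_update {B : Finset (Fin M)} {m : Fin M} (hm : m ∉ B) (x : Fin M → Fin n → Bool)
    (c : Fin n → Bool) : unanimous (Function.update x m c) B = unanimous x B := by
  have h : ∀ i ∈ B, Function.update x m c i = x i := fun i hi =>
    Function.update_of_ne (by rintro rfl; exact hm hi) _ _
  ext j
  simp only [unanimous, Finset.mem_filter, Finset.mem_univ, true_and]
  have h' : ∀ b, (∀ i ∈ B, Function.update x m c i j = b) ↔ ∀ i ∈ B, x i j = b := fun b =>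
    forall₂_congr fun i hi => by rw [h i hi]
  rw [h', h']

/-- A message outside of `B` survives with probability at most `2 ^ (-e₀)` jointly with at least
`e₀` unanimous positions. -/
lemma expect_consistent_le {B : Finset (Fin M)} (hB : B.Nonempty) {m : Fin M} (hm : m ∉ B)
    (e₀ : ℕ) :
    expect (bitLaw n) (fun x => ind (e₀ ≤ (unanimous x B).card) * ind (Consistent x B m))
      ≤ (2 : ℝ)⁻¹ ^ e₀ := by
  have hlaw := isLaw_bitLaw n
  have h := expect_mul_coord hlaw m (χ := fun x : Fin M → Fin n → Bool =>
    ind (e₀ ≤ (unanimous x B).card)) (φ := fun x c =>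
      ind (∀ (j : Fin n) (b : Bool), (∀ i ∈ B, x i j = b) → c j = b))
    (fun x c => by rw [unanimous_update hm]) (fun x c => by
      have h : ∀ i ∈ B, Function.update x m c i = x i := fun i hi =>
        Function.update_of_ne (by rintro rfl; exact hm hi) _ _
      funext d
      refine ind_congr (forall₂_congr fun j b => ?_)
      rw [forall₂_congr fun i hi => by rw [h i hi]])
  have h' : expect (bitLaw n) (fun x => ind (e₀ ≤ (unanimous x B).card) * ind (Consistent x B m))
    = _ := h
  rw [h']
  refine (expect_mono hlaw fun x => ?_).trans_eq (expect_const hlaw _)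
  rw [sum_bitLaw_consistent hB]
  by_cases he : e₀ ≤ (unanimous x B).card
  · rw [ind_of he, one_mul]
    exact pow_le_pow_of_le_one (by norm_num) (by norm_num) he
  · rw [ind_of_not he, zero_mul]
    positivity

/-- The expectation over a random codebook, as an iterated expectation over the slots and the
bits. -/
lemma sum_codebookProb_mul (Λ : Polynomial ℝ) (f : Codebook M N n → ℝ) :
    ∑ cb : Codebook M N n, codebookProb (1 / 2) Λ cb * f cb
      = expect (slotLaw Λ) (fun S : Fin M → Finset (Fin N) =>
        expect (bitLaw n) (fun x => f (fun i => (x i, S i)))) := by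
  have h1 : ∀ c : Codeword N n, codewordProb (1 / 2) Λ c = bitLaw n c.1 * slotLaw Λ c.2 := by
    intro c
    rw [codewordProb, slotLaw, bitLaw]
    congr 1
    rw [Finset.prod_congr rfl fun j _ => show (if c.1 j = true then (1 : ℝ) / 2 else 1 - 1 / 2)
      = 1 / 2 by split_ifs <;> norm_num]
    simp
  have h2 : ∑ cb : Codebook M N n, codebookProb (1 / 2) Λ cb * f cb
      = ∑ q : (Fin M → Fin n → Bool) × (Fin M → Finset (Fin N)),
        (∏ i, slotLaw Λ (q.2 i)) * ((∏ i, bitLaw n (q.1 i)) * f (fun i => (q.1 i, q.2 i))) := by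
    refine Fintype.sum_equiv (Equiv.arrowProdEquivProdArrow (Fin M) _ _) _ _ fun cb => ?_
    simp only [codebookProb, h1, Finset.prod_mul_distrib]
    change _ = (∏ i, slotLaw Λ (cb i).2) * ((∏ i, bitLaw n (cb i).1) * f cb)
    ring
  rw [h2, Fintype.sum_prod_type_right]
  simp only [expect, Finset.mul_sum]

end Bits

/-! ### Bad slots are rarely reached -/

section BadReach

variable {ι : Type*} [DecidableEq ι] {N : ℕ}

/-- An upper bound for the probability that a bad slot is reached within `ℓ` steps from user `i`
when the users sit in the slots `S`: the sum, over all paths, of the bound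
`c + ∑ m ∈ W, η m * ind (s ∈ S m)` for the probability that the last slot `s` of the path is bad.
The users of the path are removed from `W` one by one, at the price of increasing `c` by an upper
bound `h` of `η`, so that the remaining users stay independent of the path. -/
def reachWeight (η : ι → ℝ) (h : ℝ) (A : Finset ι) (S : ι → Finset (Fin N)) :
    ℕ → ℝ → ι → Finset ι → ℝ
  | 0, _, _, _ => 0
  | ℓ + 1, c, i, W => ∑ s ∈ S i, (c + h + ∑ m ∈ W.erase i, η m * ind (s ∈ S m) +
      ∑ j ∈ W.erase i ∩ A, ind (s ∈ S j) * reachWeight η h A S ℓ (c + h) j (W.erase i))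

variable {η : ι → ℝ} {h : ℝ} {A : Finset ι}

lemma badReach_succ {bad : Fin N → Prop} {S : ι → Finset (Fin N)} {ℓ : ℕ} {i : ι} {V : Finset ι} :
    BadReach bad S (ℓ + 1) i V ↔
      ∃ s ∈ S i, bad s ∨ ∃ j ∈ V.erase i, s ∈ S j ∧ BadReach bad S ℓ j (V.erase i) :=
  Iff.rfl

lemma reachWeight_succ (S : ι → Finset (Fin N)) (ℓ : ℕ) (c : ℝ) (i : ι) (W : Finset ι) :
    reachWeight η h A S (ℓ + 1) c i W = ∑ s ∈ S i, (c + h + ∑ m ∈ W.erase i, η m * ind (s ∈ S m) +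
      ∑ j ∈ W.erase i ∩ A, ind (s ∈ S j) * reachWeight η h A S ℓ (c + h) j (W.erase i)) :=
  rfl

lemma sum_le_add_sum_erase (hη0 : ∀ m, 0 ≤ η m) (hη : ∀ m, η m ≤ h) (S : ι → Finset (Fin N))
    (i : ι) (W : Finset ι) (s : Fin N) :
    ∑ m ∈ W, η m * ind (s ∈ S m) ≤ h + ∑ m ∈ W.erase i, η m * ind (s ∈ S m) := by
  by_cases hi : i ∈ W
  · rw [← Finset.add_sum_erase _ _ hi]
    have := mul_le_mul (hη i) (ind_le_one (s ∈ S i)) (ind_nonneg _) ((hη0 i).trans (hη i))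
    linarith
  · rw [Finset.erase_eq_of_notMem hi]
    linarith [(hη0 i).trans (hη i)]

lemma reachWeight_congr {S S' : ι → Finset (Fin N)} (ℓ : ℕ) (c : ℝ) {i : ι} {W : Finset ι}
    (hi : i ∈ W) (hS : ∀ j ∈ W, S j = S' j) :
    reachWeight η h A S ℓ c i W = reachWeight η h A S' ℓ c i W := by
  induction ℓ generalizing c i W with
  | zero => rfl
  | succ ℓ ih =>
    rw [reachWeight_succ, reachWeight_succ, hS i hi]
    refine Finset.sum_congr rfl fun s _ => ?_
    congr 1
    · congr 1
      exact Finset.sum_congr rfl fun m hm => by rw [hS m (Finset.mem_of_mem_erase hm)]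
    · refine Finset.sum_congr rfl fun j hj => ?_
      have hj' := (Finset.mem_inter.1 hj).1
      rw [hS j (Finset.mem_of_mem_erase hj'),
        ih _ hj' fun k hk => hS k (Finset.mem_of_mem_erase hk)]

lemma expect_badReach_le {κ β : Type*} [Fintype κ] [DecidableEq κ] [Fintype β] {w : β → ℝ}
    (hw : IsLaw w) (hη0 : ∀ m, 0 ≤ η m) (hη : ∀ m, η m ≤ h) (bad : (κ → β) → Fin N → Prop)
    (S : ι → Finset (Fin N)) (ℓ : ℕ) {c : ℝ} (i : ι) {W : Finset ι}
    (hbad : ∀ s, expect w (fun x => ind (bad x s)) ≤ c + ∑ m ∈ W, η m * ind (s ∈ S m)) :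
    expect w (fun x => ind (BadReach (bad x) S ℓ i (W ∩ A))) ≤ reachWeight η h A S ℓ c i W := by
  induction ℓ generalizing c i W with
  | zero => simp only [BadReach, ind_of_not not_false, expect_const hw, reachWeight, le_refl]
  | succ ℓ ih =>
    have hbad' : ∀ s, expect w (fun x => ind (bad x s))
        ≤ c + h + ∑ m ∈ W.erase i, η m * ind (s ∈ S m) := fun s => by
      linarith [hbad s, sum_le_add_sum_erase hη0 hη S i W s]
    have herase : (W ∩ A).erase i = W.erase i ∩ A := by rw [Finset.erase_inter]
    have hle : ∀ x, ind (BadReach (bad x) S (ℓ + 1) i (W ∩ A)) ≤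
        ∑ s ∈ S i, (ind (bad x s) + ∑ j ∈ W.erase i ∩ A,
          ind (s ∈ S j) * ind (BadReach (bad x) S ℓ j (W.erase i ∩ A))) := by
      intro x
      rw [badReach_succ, herase]
      refine (ind_exists_le_sum _ _).trans (Finset.sum_le_sum fun s _ => ?_)
      by_cases hb : bad x s
      · rw [ind_of (Or.inl hb), ind_of hb]
        have : 0 ≤ ∑ j ∈ W.erase i ∩ A,
            ind (s ∈ S j) * ind (BadReach (bad x) S ℓ j (W.erase i ∩ A)) :=
          Finset.sum_nonneg fun j _ => mul_nonneg (ind_nonneg _) (ind_nonneg _)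
        linarith
      · rw [ind_of_not hb, zero_add]
        simp only [← ind_and]
        exact (ind_mono fun h => h.resolve_left hb).trans (ind_exists_le_sum _ _)
    refine (expect_mono hw hle).trans ?_
    rw [expect_sum, reachWeight_succ]
    refine Finset.sum_le_sum fun s _ => ?_
    rw [expect_add, expect_sum]
    refine add_le_add (hbad' s) (Finset.sum_le_sum fun j _ => ?_)
    rw [expect_const_mul]
    exact mul_le_mul_of_nonneg_left (ih j hbad') (ind_nonneg _)

/-- The factor by which paths of length `ℓ` amplify the probability of a bad slot, when every user
occupies at most `d` slots and the load is `ρ`. -/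
def reachFactor (d ρ : ℝ) : ℕ → ℝ
  | 0 => 0
  | ℓ + 1 => d * (2 + ρ * reachFactor d ρ ℓ)

lemma reachFactor_succ (d ρ : ℝ) (ℓ : ℕ) :
    reachFactor d ρ (ℓ + 1) = d * (2 + ρ * reachFactor d ρ ℓ) :=
  rfl

lemma reachFactor_nonneg {d ρ : ℝ} (hd : 0 ≤ d) (hρ : 0 ≤ ρ) (ℓ : ℕ) : 0 ≤ reachFactor d ρ ℓ := by
  induction ℓ with
  | zero => exact le_rfl
  | succ ℓ ih => rw [reachFactor_succ]; positivity

lemma expect_reachWeight_le [Fintype ι] {Λ : Polynomial ℝ} (hΛ : IsDegreeDistribution Λ)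
    (hN : Λ.natDegree ≤ N) (hη0 : ∀ m, 0 ≤ η m) (hη : ∀ m, η m ≤ h) {θ ρ : ℝ} (hρ0 : 0 ≤ ρ)
    (hθ : (∑ m, η m) * (avgDegree Λ / N) ≤ θ) (hρ : A.card * (avgDegree Λ / N) ≤ ρ)
    (ℓ : ℕ) {c : ℝ} (hc : 0 ≤ c) (hcθ : c + ℓ * h ≤ θ) {i : ι} {W : Finset ι} (hi : i ∈ W)
    {g : Finset (Fin N) → ℝ} (hg : ∀ R, 0 ≤ g R) :
    expect (slotLaw Λ) (fun S => g (S i) * reachWeight η h A S ℓ c i W)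
      ≤ (∑ R, slotLaw Λ R * g R) * (reachFactor Λ.natDegree ρ ℓ * θ) := by
  have hlaw : IsLaw (slotLaw Λ : Finset (Fin N) → ℝ) := isLaw_slotLaw hΛ hN
  have hκ : 0 ≤ avgDegree Λ / N :=
    div_nonneg (zero_le_one.trans (one_le_avgDegree hΛ)) (Nat.cast_nonneg _)
  have hh : 0 ≤ h := (hη0 i).trans (hη i)
  induction ℓ generalizing c i W g with
  | zero => simp [reachWeight, expect_const hlaw, reachFactor]
  | succ ℓ ih =>
    have hcθ' : c + h + ℓ * h ≤ θ := by push_cast at hcθ; linarith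
    have hθ0 : 0 ≤ θ := le_trans (by positivity) hcθ'
    have hK := reachFactor_nonneg (d := Λ.natDegree) (Nat.cast_nonneg _) hρ0 ℓ
    -- the contribution of a slot `s` of user `i`, which is independent of the slots of user `i`
    have hslot : ∀ s : Fin N, expect (slotLaw Λ) (fun S : ι → Finset (Fin N) =>
        c + h + ∑ m ∈ W.erase i, η m * ind (s ∈ S m) + ∑ j ∈ W.erase i ∩ A,
          ind (s ∈ S j) * reachWeight η h A S ℓ (c + h) j (W.erase i))
        ≤ (2 + ρ * reachFactor Λ.natDegree ρ ℓ) * θ := by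
      intro s
      rw [expect_add, expect_add, expect_sum, expect_sum, expect_const hlaw]
      have h1 : ∑ m ∈ W.erase i, expect (slotLaw Λ)
          (fun S : ι → Finset (Fin N) => η m * ind (s ∈ S m)) ≤ θ := by
        refine le_trans ?_ hθ
        rw [Finset.sum_mul]
        refine le_trans (Finset.sum_le_sum fun m _ => ?_)
          (Finset.sum_le_univ_sum_of_nonneg fun m => mul_nonneg (hη0 m) hκ)
        rw [expect_const_mul, expect_coord hlaw m (fun R => ind (s ∈ R)), sum_slotLaw_mem hΛ hN]
      have h2 : ∑ j ∈ W.erase i ∩ A, expect (slotLaw Λ) (fun S : ι → Finset (Fin N) =>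
          ind (s ∈ S j) * reachWeight η h A S ℓ (c + h) j (W.erase i))
          ≤ ρ * (reachFactor Λ.natDegree ρ ℓ * θ) := by
        calc _ ≤ ∑ j ∈ W.erase i ∩ A, avgDegree Λ / N * (reachFactor Λ.natDegree ρ ℓ * θ) := by
              refine Finset.sum_le_sum fun j hj => ?_
              have := ih (add_nonneg hc hh) hcθ' (Finset.mem_inter.1 hj).1
                (g := fun R => ind (s ∈ R)) (fun R => ind_nonneg _)
              rwa [sum_slotLaw_mem hΛ hN] at this
          _ = ((W.erase i ∩ A).card * (avgDegree Λ / N)) * (reachFactor Λ.natDegree ρ ℓ * θ) := by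
              rw [Finset.sum_const, nsmul_eq_mul, mul_assoc]
          _ ≤ (A.card * (avgDegree Λ / N)) * (reachFactor Λ.natDegree ρ ℓ * θ) := by
              gcongr
              exact Finset.inter_subset_right
          _ ≤ _ := by gcongr
      have h3 : c + h ≤ θ := le_trans (le_add_of_nonneg_right (by positivity)) hcθ'
      linarith
    rw [expect_resample hlaw i, Finset.sum_mul]
    refine Finset.sum_le_sum fun R _ => ?_
    by_cases hR : slotLaw Λ R = 0
    · simp [hR]
    rw [mul_assoc]
    refine mul_le_mul_of_nonneg_left ?_ (slotLaw_nonneg hΛ R)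
    simp only [Function.update_self]
    rw [expect_const_mul]
    refine mul_le_mul_of_nonneg_left ?_ (hg R)
    have hcongr : ∀ S : ι → Finset (Fin N),
        reachWeight η h A (Function.update S i R) (ℓ + 1) c i W
          = ∑ s ∈ R, (c + h + ∑ m ∈ W.erase i, η m * ind (s ∈ S m) + ∑ j ∈ W.erase i ∩ A,
            ind (s ∈ S j) * reachWeight η h A S ℓ (c + h) j (W.erase i)) := by
      intro S
      have hu : ∀ j ∈ W.erase i, Function.update S i R j = S j := fun j hj =>
        update_eq_of_mem_erase S i R hj
      rw [reachWeight_succ, Function.update_self]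
      refine Finset.sum_congr rfl fun s _ => ?_
      congr 1
      · congr 1
        exact Finset.sum_congr rfl fun m hm => by rw [hu m hm]
      · refine Finset.sum_congr rfl fun j hj => ?_
        have hj' := (Finset.mem_inter.1 hj).1
        rw [hu j hj', reachWeight_congr ℓ _ hj' hu]
    rw [expect_congr hcongr, expect_sum]
    have hRd : (R.card : ℝ) ≤ Λ.natDegree := by exact_mod_cast card_le_of_slotLaw_ne_zero hR
    calc _ ≤ ∑ s ∈ R, (2 + ρ * reachFactor Λ.natDegree ρ ℓ) * θ :=
          Finset.sum_le_sum fun s _ => hslot s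
      _ = R.card * ((2 + ρ * reachFactor Λ.natDegree ρ ℓ) * θ) := by
          rw [Finset.sum_const, nsmul_eq_mul]
      _ ≤ Λ.natDegree * ((2 + ρ * reachFactor Λ.natDegree ρ ℓ) * θ) := by gcongr
      _ = _ := by rw [reachFactor_succ]; ring

end BadReach

section SlotBad

variable {M N n : ℕ}

/-- The probability that a slot is bad. For the slots with at least `H` users, it is estimated by
`1`; in the others, there are at most `2 ^ H` sets `B` of users, each of which has fewer than `e₀`
unanimous positions, or fails to exclude one of the other candidates. -/
lemma expect_slotBad_le {T e₀ H : ℕ} (hH : 0 < H) {τ : ℝ}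
    (hτ : ∀ u, 1 ≤ u → u ≤ T → binomExpect n (2 * (2 : ℝ)⁻¹ ^ u) (fun e => ind (e < e₀)) ≤ τ)
    (hτ0 : 0 ≤ τ) (S : Fin M → Finset (Fin N)) (A : Finset (Fin M)) (s : Fin N) :
    expect (bitLaw n) (fun x => ind (SlotBad T (fun i => (x i, S i)) A s))
      ≤ 2 ^ H * τ + ∑ m, (ind (m ∈ A) / H + 2 ^ H * (2 : ℝ)⁻¹ ^ e₀) * ind (s ∈ S m) := by
  have hlaw := isLaw_bitLaw n
  have hHr : (0 : ℝ) < H := by exact_mod_cast hH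
  set As := A.filter fun i => s ∈ S i with hAs
  have hAscard : (As.card : ℝ) = ∑ m, ind (m ∈ A) * ind (s ∈ S m) := by
    simp only [← ite_eq_ind, ite_mul, one_mul, zero_mul]
    rw [Finset.sum_ite_mem, Finset.univ_inter, ← Finset.sum_filter, hAs]
    simp
  have hsplit : ∑ m, (ind (m ∈ A) / H + 2 ^ H * (2 : ℝ)⁻¹ ^ e₀) * ind (s ∈ S m)
      = As.card / H + 2 ^ H * ((2 : ℝ)⁻¹ ^ e₀ * ∑ m, ind (s ∈ S m)) := by
    rw [hAscard, Finset.sum_div, Finset.mul_sum, Finset.mul_sum, ← Finset.sum_add_distrib]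
    exact Finset.sum_congr rfl fun m _ => by ring
  have hcand0 : 0 ≤ ∑ m, ind (s ∈ S m) := Finset.sum_nonneg fun m _ => ind_nonneg _
  rw [hsplit]
  by_cases hcard : H ≤ As.card
  · refine (expect_le_one hlaw fun x => ind_le_one _).trans ?_
    have h1 : (1 : ℝ) ≤ As.card / H := by
      rw [one_le_div hHr]
      exact_mod_cast hcard
    have h2 : 0 ≤ 2 ^ H * τ := by positivity
    have h3 : 0 ≤ 2 ^ H * ((2 : ℝ)⁻¹ ^ e₀ * ∑ m, ind (s ∈ S m)) := by positivity
    linarith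
  · set 𝓑 := As.powerset.filter fun B => B.Nonempty ∧ B.card ≤ T with h𝓑
    have hle : ∀ x : Fin M → Fin n → Bool, ind (SlotBad T (fun i => (x i, S i)) A s)
        ≤ ∑ B ∈ 𝓑, (ind ((unanimous x B).card < e₀) + ∑ m ∈ Finset.univ.filter (· ∉ B),
          ind (s ∈ S m) * (ind (e₀ ≤ (unanimous x B).card) * ind (Consistent x B m))) := by
      intro x
      have h1 : ind (SlotBad T (fun i => (x i, S i)) A s) ≤ ind (∃ B ∈ 𝓑,
          ∃ m ∈ Finset.univ.filter (· ∉ B), s ∈ S m ∧ Consistent x B m) := by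
        refine ind_mono ?_
        rintro ⟨B, hB, hBne, hBT, m, hm, hsm, hc⟩
        exact ⟨B, Finset.mem_filter.2 ⟨Finset.mem_powerset.2 hB, hBne, hBT⟩, m,
          by simpa using hm, hsm, hc⟩
      refine h1.trans ((ind_exists_le_sum _ _).trans (Finset.sum_le_sum fun B _ => ?_))
      by_cases he : e₀ ≤ (unanimous x B).card
      · rw [ind_of_not (not_lt.2 he), zero_add]
        refine (ind_exists_le_sum _ _).trans (Finset.sum_le_sum fun m _ => ?_)
        rw [ind_of he, one_mul, ind_and]
      · rw [ind_of (not_le.1 he)]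
        refine (ind_le_one _).trans (le_add_of_nonneg_right (Finset.sum_nonneg fun m _ => ?_))
        exact mul_nonneg (ind_nonneg _) (mul_nonneg (ind_nonneg _) (ind_nonneg _))
    refine (expect_mono hlaw hle).trans ?_
    rw [expect_sum]
    have hterm : ∀ B ∈ 𝓑, expect (bitLaw n) (fun x : Fin M → Fin n → Bool =>
        ind ((unanimous x B).card < e₀) + ∑ m ∈ Finset.univ.filter (· ∉ B),
          ind (s ∈ S m) * (ind (e₀ ≤ (unanimous x B).card) * ind (Consistent x B m)))
        ≤ τ + (2 : ℝ)⁻¹ ^ e₀ * ∑ m, ind (s ∈ S m) := by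
      intro B hB
      obtain ⟨-, hBne, hBT⟩ := Finset.mem_filter.1 hB
      rw [expect_add, expect_sum]
      refine add_le_add ?_ ?_
      · rw [expect_card_unanimous hBne (fun e => ind (e < e₀))]
        exact hτ _ hBne.card_pos hBT
      · rw [Finset.mul_sum]
        refine le_trans (Finset.sum_le_sum fun m hm => ?_)
          (Finset.sum_le_univ_sum_of_nonneg fun m => mul_nonneg (by positivity) (ind_nonneg _))
        rw [expect_const_mul, mul_comm]
        exact mul_le_mul_of_nonneg_right
          (expect_consistent_le hBne (Finset.mem_filter.1 hm).2 e₀) (ind_nonneg _)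
    have hcard𝓑 : (𝓑.card : ℝ) ≤ 2 ^ H := by
      have h1 : 𝓑.card ≤ 2 ^ As.card := by
        rw [← Finset.card_powerset]
        exact Finset.card_le_card (Finset.filter_subset _ _)
      have h2 : 2 ^ As.card ≤ 2 ^ H := Nat.pow_le_pow_right (by norm_num) (not_le.1 hcard).le
      exact_mod_cast h1.trans h2
    calc _ ≤ ∑ B ∈ 𝓑, (τ + (2 : ℝ)⁻¹ ^ e₀ * ∑ m, ind (s ∈ S m)) := Finset.sum_le_sum hterm
      _ = 𝓑.card * (τ + (2 : ℝ)⁻¹ ^ e₀ * ∑ m, ind (s ∈ S m)) := by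
          rw [Finset.sum_const, nsmul_eq_mul]
      _ ≤ 2 ^ H * (τ + (2 : ℝ)⁻¹ ^ e₀ * ∑ m, ind (s ∈ S m)) := by gcongr
      _ ≤ _ := by
          have : (0 : ℝ) ≤ As.card / H := by positivity
          linarith

/-- The probability that message passing meets a bad slot within `ℓ` steps. -/
lemma expect_expect_badReach_le {Λ : Polynomial ℝ} (hΛ : IsDegreeDistribution Λ)
    (hN : Λ.natDegree ≤ N) {T e₀ H : ℕ} (hH : 0 < H) {τ θ ρ : ℝ} (hτ0 : 0 ≤ τ) (hρ0 : 0 ≤ ρ)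
    (hτ : ∀ u, 1 ≤ u → u ≤ T → binomExpect n (2 * (2 : ℝ)⁻¹ ^ u) (fun e => ind (e < e₀)) ≤ τ)
    {A : Finset (Fin M)} (hρ : A.card * (avgDegree Λ / N) ≤ ρ) (ℓ : ℕ)
    (hθ : ρ / H + 2 ^ H * (avgDegree Λ * ((M : ℝ) / N * (2 : ℝ)⁻¹ ^ e₀)) ≤ θ)
    (hθ' : 2 ^ H * τ + ℓ * (1 / H + 2 ^ H * (2 : ℝ)⁻¹ ^ e₀) ≤ θ) (i : Fin M) :
    expect (slotLaw Λ) (fun S : Fin M → Finset (Fin N) => expect (bitLaw n) (fun x =>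
      ind (BadReach (SlotBad T (fun i => (x i, S i)) A) S ℓ i A)))
      ≤ reachFactor Λ.natDegree ρ ℓ * θ := by
  have hlaw : IsLaw (slotLaw Λ : Finset (Fin N) → ℝ) := isLaw_slotLaw hΛ hN
  have hHr : (0 : ℝ) < H := by exact_mod_cast hH
  set η : Fin M → ℝ := fun m => ind (m ∈ A) / H + 2 ^ H * (2 : ℝ)⁻¹ ^ e₀ with hη
  have hη0 : ∀ m, 0 ≤ η m := fun m => by
    have := ind_nonneg (m ∈ A)
    simp only [hη]
    positivity
  have hη1 : ∀ m, η m ≤ 1 / H + 2 ^ H * (2 : ℝ)⁻¹ ^ e₀ := fun m => by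
    simp only [hη]
    gcongr
    exact ind_le_one _
  have hsum : (∑ m, η m) * (avgDegree Λ / N) ≤ θ := by
    refine le_trans (le_of_eq_of_le ?_
      (add_le_add_left (div_le_div_of_nonneg_right hρ hHr.le) _)) hθ
    simp only [hη]
    rw [Finset.sum_add_distrib, ← Finset.sum_div]
    simp only [← ite_eq_ind]
    simp
    ring
  have key := expect_reachWeight_le hΛ hN hη0 hη1 hρ0 hsum hρ ℓ
    (c := 2 ^ H * τ) (by positivity) hθ' (Finset.mem_univ i) (g := fun _ => 1)
    (fun _ => zero_le_one)
  simp only [one_mul, mul_one, hlaw.sum_eq_one] at key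
  refine le_trans (expect_mono hlaw fun S => ?_) key
  have := expect_badReach_le (A := A) (isLaw_bitLaw n) hη0 hη1
    (fun x s => SlotBad T (fun i => (x i, S i)) A s) S ℓ i (W := Finset.univ)
    (fun s => expect_slotBad_le hH hτ hτ0 S A s)
  rwa [Finset.univ_inter] at this

end SlotBad

/-! ### The packet loss rate -/

section Loss

variable {M N n K : ℕ} {Λ : Polynomial ℝ}

lemma lossFraction_le_one (cb : Codebook M N n) (A : Finset (Fin M)) : lossFraction cb A ≤ 1 :=
  div_le_one_of_le₀ (by exact_mod_cast Finset.card_le_card Finset.sdiff_subset) (Nat.cast_nonneg _)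

/-- The expected loss, when the messages in `A` are transmitted, is estimated by the probability
that one of them is blocked in message passing or reaches a bad slot. -/
lemma sum_codebookProb_mul_lossFraction_le (hΛ : IsDegreeDistribution Λ) (hN : Λ.natDegree ≤ N)
    {T ℓ : ℕ} (hℓ : ℓ ≤ M) {A : Finset (Fin M)} {Y Z : ℝ} (hYZ : 0 ≤ Y + Z)
    (hY : ∀ i ∈ A, expect (slotLaw Λ) (fun S : Fin M → Finset (Fin N) =>
      ind (UserBlocked T S ℓ i A ∅)) ≤ Y)
    (hZ : ∀ i ∈ A, expect (slotLaw Λ) (fun S : Fin M → Finset (Fin N) =>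
      expect (bitLaw n) (fun x =>
        ind (BadReach (SlotBad T (fun i => (x i, S i)) A) S ℓ i A))) ≤ Z) :
    ∑ cb : Codebook M N n, codebookProb (1 / 2) Λ cb * lossFraction cb A ≤ Y + Z := by
  have hlaw : IsLaw (slotLaw Λ : Finset (Fin N) → ℝ) := isLaw_slotLaw hΛ hN
  have hbit := isLaw_bitLaw n
  have hle : ∀ cb : Codebook M N n, lossFraction cb A ≤ (A.card : ℝ)⁻¹ * ∑ i ∈ A,
      (ind (UserBlocked T (fun i => (cb i).2) ℓ i A ∅)
        + ind (BadReach (SlotBad T cb A) (fun i => (cb i).2) ℓ i A)) := by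
    intro cb
    rw [lossFraction, div_eq_inv_mul]
    refine mul_le_mul_of_nonneg_left ?_ (by positivity)
    have h1 : ((A \ decoded cb (slotSum cb A)).card : ℝ)
        = ∑ i ∈ A, ind (i ∉ decoded cb (slotSum cb A)) := by
      simp only [← ite_eq_ind]
      rw [← Finset.sum_filter, Finset.sum_const, nsmul_eq_mul, mul_one]
      congr 2
      ext i
      simp
    rw [h1]
    refine Finset.sum_le_sum fun i hi => ?_
    by_cases hd : i ∉ decoded cb (slotSum cb A)
    · rw [ind_of hd]
      rcases userBlocked_or_badReach_of_notMem_decoded hℓ hi hd with h | h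
      · rw [ind_of h]
        linarith [ind_nonneg (BadReach (SlotBad T cb A) (fun i => (cb i).2) ℓ i A)]
      · rw [ind_of h]
        linarith [ind_nonneg (UserBlocked T (fun i => (cb i).2) ℓ i A ∅)]
    · rw [ind_of_not hd]
      exact add_nonneg (ind_nonneg _) (ind_nonneg _)
  rw [sum_codebookProb_mul]
  refine (expect_mono hlaw fun S => expect_mono hbit fun x => hle _).trans ?_
  simp only [expect_const_mul, expect_sum, expect_add, expect_const hbit]
  rw [← div_eq_inv_mul]
  refine div_le_of_le_mul₀ (Nat.cast_nonneg _) hYZ ?_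
  rw [mul_comm, ← nsmul_eq_mul]
  exact Finset.sum_le_card_nsmul _ _ _ fun i hi => add_le_add (hY i hi) (hZ i hi)

lemma selectionProb_nonneg (w : Fin K → Fin M) : 0 ≤ selectionProb w :=
  Finset.prod_nonneg fun k _ => by split_ifs <;> positivity

lemma sum_selectionProb_le_one : ∑ w : Fin K → Fin M, selectionProb w ≤ 1 := by
  have h := Fintype.prod_sum (fun (k : Fin K) (m : Fin M) => if m.val % K = k.val then
    1 / ((Finset.univ.filter (fun m : Fin M => m.val % K = k.val)).card : ℝ) else 0)
  simp only [selectionProb]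
  rw [← h]
  refine Finset.prod_le_one (fun k _ => Finset.sum_nonneg fun m _ => by
    split_ifs <;> positivity) fun k _ => ?_
  rw [← Finset.sum_filter, Finset.sum_const, nsmul_eq_mul, mul_one_div]
  exact div_self_le_one _

/-- Different users select different messages. -/
lemma injective_of_selectionProb_ne_zero {w : Fin K → Fin M} (h : selectionProb w ≠ 0) :
    Function.Injective w := by
  have h1 : ∀ k, (w k).val % K = k.val := by
    intro k
    by_contra hk
    exact h (Finset.prod_eq_zero (Finset.mem_univ k) (if_neg hk))
  intro k k' hkk
  rw [Fin.ext_iff, ← h1 k, ← h1 k', hkk]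

/-- The number of active users concentrates around `μ K`. -/
lemma packetLossRate_le (hΛ : IsDegreeDistribution Λ) (hN : Λ.natDegree ≤ N) {μ : ℝ} (hμ : 0 ≤ μ)
    (hμ' : μ ≤ 1) (hK : 0 < K) {c Y : ℝ} (hc : 0 < c) (hY : 0 ≤ Y)
    (h : ∀ A : Finset (Fin M), |(A.card : ℝ) / K - μ| < c →
      ∑ cb : Codebook M N n, codebookProb (1 / 2) Λ cb * lossFraction cb A ≤ Y) :
    packetLossRate (1 / 2) μ Λ K M N n ≤ 1 / (c ^ 2 * K) + Y := by
  have hlaw : IsLaw (slotLaw Λ : Finset (Fin N) → ℝ) := isLaw_slotLaw hΛ hN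
  have h1 : 0 ≤ 1 - μ := by linarith
  calc packetLossRate (1 / 2) μ Λ K M N n
      = ∑ a : Finset (Fin K), μ ^ a.card * (1 - μ) ^ (K - a.card) * ∑ w : Fin K → Fin M,
        selectionProb w * ∑ cb : Codebook M N n,
          codebookProb (1 / 2) Λ cb * lossFraction cb (a.image w) := by
        rw [packetLossRate]
        simp only [Finset.mul_sum]
        refine Finset.sum_congr rfl fun a _ => Finset.sum_congr rfl fun w _ =>
          Finset.sum_congr rfl fun cb _ => by ring
    _ ≤ ∑ a : Finset (Fin K), μ ^ a.card * (1 - μ) ^ (K - a.card) *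
        (ind (c ≤ |(a.card : ℝ) / K - μ|) + Y) := by
        refine Finset.sum_le_sum fun a _ => mul_le_mul_of_nonneg_left ?_ (by positivity)
        have h0 : 0 ≤ ind (c ≤ |(a.card : ℝ) / K - μ|) + Y := add_nonneg (ind_nonneg _) hY
        refine le_trans (Finset.sum_le_sum (g := fun w => selectionProb w *
          (ind (c ≤ |(a.card : ℝ) / K - μ|) + Y)) fun w _ => ?_) ?_
        · by_cases hw : selectionProb w = 0
          · simp [hw]
          refine mul_le_mul_of_nonneg_left ?_ (selectionProb_nonneg w)
          have hcard : (a.image w).card = a.card :=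
            Finset.card_image_of_injective a (injective_of_selectionProb_ne_zero hw)
          by_cases hfar : c ≤ |(a.card : ℝ) / K - μ|
          · rw [ind_of hfar, sum_codebookProb_mul]
            refine le_trans (expect_le_one hlaw fun S => expect_le_one (isLaw_bitLaw n) fun x =>
              lossFraction_le_one _ _) (by linarith)
          · rw [ind_of_not hfar, zero_add]
            exact h _ (by rw [hcard]; exact not_le.1 hfar)
        · rw [← Finset.sum_mul]
          exact mul_le_of_le_one_left h0 sum_selectionProb_le_one
    _ = binomExpect K μ (fun e => ind (c ≤ |(e : ℝ) / K - μ|) + Y) :=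
        sum_finset_eq_binomExpect K μ (fun e => ind (c ≤ |(e : ℝ) / K - μ|) + Y)
    _ ≤ 1 / (c ^ 2 * K) + Y := by
        rw [binomExpect_add, binomExpect_const]
        gcongr
        exact binomExpect_ind_far_le hμ hμ' hK hc

end Loss

/-! ### The asymptotic regime -/

section Regime

variable {μ G D β δ : ℝ} {K M N n : ℕ → ℕ}

lemma tendsto_div_of_abs_sub_le_one {a b : ℕ → ℝ} (h : ∀ t, |a t - b t| ≤ 1)
    (hb : Tendsto b atTop atTop) : Tendsto (fun t => a t / b t) atTop (𝓝 1) := by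
  have h1 : Tendsto (fun t => (b t)⁻¹) atTop (𝓝 0) := tendsto_inv_atTop_zero.comp hb
  rw [tendsto_iff_norm_sub_tendsto_zero]
  refine squeeze_zero' (Eventually.of_forall fun _ => norm_nonneg _) ?_ h1
  filter_upwards [hb.eventually_gt_atTop 0] with t ht
  rw [Real.norm_eq_abs, div_sub_one ht.ne', abs_div, abs_of_pos ht, div_eq_mul_inv]
  exact mul_le_of_le_one_left (by positivity) (h t)

lemma Regime.tendsto_K_real (h : Regime μ G D β δ K M N n) :
    Tendsto (fun t => (K t : ℝ)) atTop atTop :=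
  tendsto_natCast_atTop_atTop.comp h.tendsto_K

lemma Regime.tendsto_slots_div_users (h : Regime μ G D β δ K M N n) (hμ : 0 < μ) (hG : 0 < G) :
    Tendsto (fun t => (N t : ℝ) / K t) atTop (𝓝 (μ / G)) := by
  have hb : Tendsto (fun t => μ * K t / G) atTop atTop :=
    (h.tendsto_K_real.const_mul_atTop hμ).atTop_div_const hG
  have h1 := (tendsto_div_of_abs_sub_le_one h.slots hb).mul_const (μ / G)
  rw [one_mul] at h1
  refine h1.congr fun t => ?_
  by_cases hK : (K t : ℝ) = 0
  · simp [hK]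
  · field_simp

lemma Regime.tendsto_N (h : Regime μ G D β δ K M N n) (hμ : 0 < μ) (hG : 0 < G) :
    Tendsto N atTop atTop := by
  rw [← tendsto_natCast_atTop_iff (R := ℝ)]
  have hb : Tendsto (fun t => μ * K t / G) atTop atTop :=
    (h.tendsto_K_real.const_mul_atTop hμ).atTop_div_const hG
  refine tendsto_atTop_mono (fun t => ?_) (tendsto_atTop_add_const_right _ (-1) hb)
  have := (abs_le.1 (h.slots t)).1
  linarith

lemma Regime.tendsto_mul_rpow (h : Regime μ G D β δ K M N n) (hD : 0 < D) (hδ : 0 < δ) :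
    Tendsto (fun t => D * (K t : ℝ) ^ (1 / δ)) atTop atTop :=
  ((tendsto_rpow_atTop (one_div_pos.2 hδ)).comp h.tendsto_K_real).const_mul_atTop hD

lemma Regime.tendsto_M (h : Regime μ G D β δ K M N n) (hD : 0 < D) (hδ : 0 < δ) :
    Tendsto M atTop atTop := by
  rw [← tendsto_natCast_atTop_iff (R := ℝ)]
  refine tendsto_atTop_mono (fun t => ?_)
    (tendsto_atTop_add_const_right _ (-1) (h.tendsto_mul_rpow hD hδ))
  have := (abs_le.1 (h.messages t)).1
  linarith

lemma Regime.tendsto_n (h : Regime μ G D β δ K M N n) (hD : 0 < D) (hβ : 1 ≤ β) (hδ : 0 < δ) :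
    Tendsto n atTop atTop := by
  rw [← tendsto_natCast_atTop_iff (R := ℝ)]
  have h1 : Tendsto (fun t => β * Real.logb 2 (M t)) atTop atTop :=
    ((Real.tendsto_logb_atTop one_lt_two).comp
      (tendsto_natCast_atTop_atTop.comp (h.tendsto_M hD hδ))).const_mul_atTop (by linarith)
  refine tendsto_atTop_mono (fun t => ?_) (tendsto_atTop_add_const_right _ (-1) h1)
  have := (abs_le.1 (h.length t)).1
  linarith

/-- The number of messages per slot is `2 ^ (x n + O(1))` with `x = (1 - δ) / β`. -/
lemma Regime.exists_abs_logb_sub_le (h : Regime μ G D β δ K M N n) (hμ : 0 < μ) (hG : 0 < G)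
    (hD : 0 < D) (hβ : 1 ≤ β) (hδ : 0 < δ) (hδ' : δ < 1) :
    ∃ C : ℝ, ∀ᶠ t in atTop, |Real.logb 2 ((M t : ℝ) / N t) - (1 - δ) / β * n t| ≤ C := by
  have hMD := (tendsto_div_of_abs_sub_le_one h.messages (h.tendsto_mul_rpow hD hδ))
  have h1 := hMD.rpow_const (p := δ) (Or.inl one_ne_zero)
  rw [Real.one_rpow] at h1
  have h2 := (h.tendsto_slots_div_users hμ hG).inv₀ (by positivity)
  have h3 : Tendsto (fun t => (M t : ℝ) ^ δ / N t) atTop (𝓝 (D ^ δ * (1 * (μ / G)⁻¹))) := by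
    refine ((h1.mul h2).const_mul (D ^ δ)).congr' ?_
    filter_upwards [h.tendsto_K.eventually_gt_atTop 0] with t ht
    have hK : (0 : ℝ) < K t := by exact_mod_cast ht
    have hKd : ((K t : ℝ) ^ (1 / δ)) ^ δ = K t := by
      rw [← Real.rpow_mul hK.le, one_div_mul_cancel hδ.ne', Real.rpow_one]
    rw [Real.div_rpow (Nat.cast_nonneg _) (by positivity),
      Real.mul_rpow hD.le (by positivity), hKd, inv_div]
    have hDd : 0 < D ^ δ := Real.rpow_pos_of_pos hD δ
    field_simp
  have hpos : 0 < D ^ δ * (1 * (μ / G)⁻¹) := by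
    have hDd : 0 < D ^ δ := Real.rpow_pos_of_pos hD δ
    positivity
  set q := D ^ δ * (1 * (μ / G)⁻¹) with hq
  have h4 : Tendsto (fun t => Real.logb 2 ((M t : ℝ) ^ δ / N t)) atTop (𝓝 (Real.logb 2 q)) :=
    ((Real.continuousAt_logb hpos.ne').tendsto).comp h3
  have hx0 : 0 ≤ (1 - δ) / β := div_nonneg (by linarith) (by linarith)
  refine ⟨|Real.logb 2 q| + 1 + (1 - δ) / β, ?_⟩
  filter_upwards [h4.abs.eventually (gt_mem_nhds (lt_add_one _)),
    (h.tendsto_M hD hδ).eventually_gt_atTop 0, (h.tendsto_N hμ hG).eventually_gt_atTop 0]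
    with t ht hM hN
  have hMr : (0 : ℝ) < M t := by exact_mod_cast hM
  have hNr : (0 : ℝ) < N t := by exact_mod_cast hN
  rw [Real.logb_div (by positivity) hNr.ne', Real.logb_rpow_eq_mul_logb_of_pos hMr] at ht
  rw [Real.logb_div hMr.ne' hNr.ne']
  have h5 : Real.logb 2 (M t) - Real.logb 2 (N t) - (1 - δ) / β * n t
      = (δ * Real.logb 2 (M t) - Real.logb 2 (N t))
        - (1 - δ) / β * (n t - β * Real.logb 2 (M t)) := by
    have : β ≠ 0 := by linarith
    field_simp
    ring
  rw [h5]
  refine (abs_sub _ _).trans (add_le_add ht.le ?_)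
  rw [abs_mul, abs_of_nonneg hx0]
  exact mul_le_of_le_one_right hx0 (h.length t)

lemma Regime.tendsto_ratio_mul_pow (h : Regime μ G D β δ K M N n) (hμ : 0 < μ) (hG : 0 < G)
    (hD : 0 < D) (hβ : 1 ≤ β) (hδ : 0 < δ) (hδ' : δ < 1) {r : ℝ} (hr : (1 - δ) / β < r) :
    Tendsto (fun t => (M t : ℝ) / N t * (2 : ℝ)⁻¹ ^ ⌈r * n t⌉₊) atTop (𝓝 0) := by
  obtain ⟨C, hC⟩ := h.exists_abs_logb_sub_le hμ hG hD hβ hδ hδ'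
  have hn : Tendsto (fun t => (n t : ℝ)) atTop atTop :=
    tendsto_natCast_atTop_atTop.comp (h.tendsto_n hD hβ hδ)
  have h1 : Tendsto (fun t => (2 : ℝ) ^ (C + -((r - (1 - δ) / β) * n t))) atTop (𝓝 0) := by
    have h2 : Tendsto (fun t => C + -((r - (1 - δ) / β) * n t)) atTop atBot :=
      tendsto_atBot_add_const_left _ _
        (tendsto_neg_atTop_atBot.comp (hn.const_mul_atTop (by linarith)))
    have h3 := Real.tendsto_exp_atBot.comp (h2.const_mul_atBot (Real.log_pos one_lt_two))
    refine h3.congr fun t => ?_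
    rw [Real.rpow_def_of_pos two_pos]
    rfl
  refine squeeze_zero' (Eventually.of_forall fun t => by positivity) ?_ h1
  filter_upwards [hC, (h.tendsto_M hD hδ).eventually_gt_atTop 0,
    (h.tendsto_N hμ hG).eventually_gt_atTop 0] with t ht hM hN
  have hMr : (0 : ℝ) < M t := by exact_mod_cast hM
  have hNr : (0 : ℝ) < N t := by exact_mod_cast hN
  have h4 : (M t : ℝ) / N t = (2 : ℝ) ^ Real.logb 2 ((M t : ℝ) / N t) :=
    (Real.rpow_logb two_pos (by norm_num) (by positivity)).symm
  rw [h4, ← Real.rpow_natCast, Real.inv_rpow two_pos.le, ← Real.rpow_neg two_pos.le,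
    ← Real.rpow_add two_pos]
  refine Real.rpow_le_rpow_of_exponent_le one_le_two ?_
  have := Nat.le_ceil (r * n t)
  have := (abs_le.1 ht).2
  linarith

end Regime

/-! ### Vanishing packet loss -/

section Vanishing

variable {μ G D β δ : ℝ} {K M N n : ℕ → ℕ} {Λ : Polynomial ℝ}

/-- An event of the filter `loadFilter ρ`, in explicit form. -/
lemma exists_of_eventually_loadFilter {ρ : ℝ} {P : ℕ × ℕ → Prop} (h : ∀ᶠ p in loadFilter ρ, P p) :
    ∃ N₀ : ℕ, ∃ r > 0, ∀ a N : ℕ, N₀ ≤ N → |(a : ℝ) / N - ρ| < r → P (a, N) := by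
  rw [loadFilter, eventually_comap] at h
  obtain ⟨s, hs, t, ht, hst⟩ := Filter.mem_prod_iff.1 h
  obtain ⟨N₀, hN₀⟩ := Filter.mem_atTop_sets.1 hs
  obtain ⟨r, hr, hrt⟩ := Metric.mem_nhds_iff.1 ht
  refine ⟨N₀, r, hr, fun a N hN ha => ?_⟩
  exact hst (show (N, (a : ℝ) / N) ∈ s ×ˢ t from ⟨hN₀ N hN, hrt ha⟩) (a, N) rfl

/-- If a fraction of at least `p > r` of the positions is unanimous on average, then it
is unlikely that fewer than `r n` positions are unanimous. -/
lemma binomExpect_ind_lt_le {n : ℕ} (hn : 0 < n) {r p q : ℝ} (hrp : r < p) (hpq : p ≤ q)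
    (hq0 : 0 ≤ q) (hq : q ≤ 1) :
    binomExpect n q (fun e => ind (e < ⌈r * n⌉₊)) ≤ 1 / ((p - r) ^ 2 * n) := by
  refine (binomExpect_mono hq0 hq fun e _ => ind_mono fun he => ?_).trans
    (binomExpect_ind_far_le hq0 hq hn (sub_pos.2 hrp))
  have hnr : (0 : ℝ) < n := by exact_mod_cast hn
  have h1 : (e : ℝ) / n < r := by
    rw [div_lt_iff₀ hnr]
    exact Nat.lt_ceil.1 he
  rw [le_abs]
  right
  linarith

lemma unanimousProb_le_one {u : ℕ} (hu : 1 ≤ u) : 2 * (2 : ℝ)⁻¹ ^ u ≤ 1 := by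
  have : (2 : ℝ)⁻¹ ^ u ≤ (2 : ℝ)⁻¹ ^ 1 := pow_le_pow_of_le_one (by norm_num) (by norm_num) hu
  linarith

/-- In the asymptotic regime, message passing does not meet bad slots. -/
lemma Regime.eventually_expect_badReach_le (h : Regime μ G D β δ K M N n) (hμ : 0 < μ)
    (hG : 0 < G) (hD : 0 < D) (hβ : 1 ≤ β) (hδ : 0 < δ) (hδ' : δ < 1)
    (hΛ : IsDegreeDistribution Λ) {T : ℕ} (hT : (1 - δ) / β < 2 * (2 : ℝ)⁻¹ ^ T) {ρ : ℝ}
    (hρ0 : 0 ≤ ρ) (ℓ : ℕ) {ε : ℝ} (hε : 0 < ε) :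
    ∀ᶠ t in atTop, ∀ A : Finset (Fin (M t)), A.card * (avgDegree Λ / N t) ≤ ρ → ∀ i,
      expect (slotLaw Λ) (fun S : Fin (M t) → Finset (Fin (N t)) => expect (bitLaw (n t)) (fun x =>
        ind (BadReach (SlotBad T (fun i => (x i, S i)) A) S ℓ i A))) ≤ ε := by
  have hF := reachFactor_nonneg (d := Λ.natDegree) (Nat.cast_nonneg _) hρ0 ℓ
  obtain ⟨θ, hθ, hFθ⟩ : ∃ θ : ℝ, 0 < θ ∧ reachFactor Λ.natDegree ρ ℓ * θ ≤ ε := by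
    refine ⟨ε / (reachFactor Λ.natDegree ρ ℓ + 1), by positivity, ?_⟩
    rw [mul_div_assoc', div_le_iff₀ (by positivity)]
    nlinarith
  obtain ⟨r, hr, hrT⟩ := exists_between hT
  have hr0 : 0 < r := (div_pos (by linarith) (by linarith)).trans hr
  -- `H` is chosen first, so that the slots with more than `H` users can be neglected
  obtain ⟨H, hH⟩ := exists_nat_gt (max ((ρ + ℓ) / (θ / 2)) 0)
  rw [max_lt_iff] at hH
  have hHr : (0 : ℝ) < H := hH.2
  have hH1 : (ρ + ℓ) / H < θ / 2 := by
    rw [div_lt_iff₀ (by positivity)] at hH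
    rw [div_lt_iff₀ hHr]
    linarith
  have hn : Tendsto (fun t => (n t : ℝ)) atTop atTop :=
    tendsto_natCast_atTop_atTop.comp (h.tendsto_n hD hβ hδ)
  have hτ : Tendsto (fun t => 2 ^ H * (1 / ((2 * (2 : ℝ)⁻¹ ^ T - r) ^ 2 * n t))) atTop (𝓝 0) := by
    have h1 := (hn.const_mul_atTop (r := (2 * (2 : ℝ)⁻¹ ^ T - r) ^ 2)
      (pow_pos (sub_pos.2 hrT) 2)).inv_tendsto_atTop.const_mul (2 ^ H : ℝ)
    rw [mul_zero] at h1
    exact h1.congr fun t => by simp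
  have hpow : Tendsto (fun t => (2 : ℝ)⁻¹ ^ ⌈r * n t⌉₊) atTop (𝓝 0) :=
    (tendsto_pow_atTop_nhds_zero_of_lt_one (by norm_num) (by norm_num)).comp
      (tendsto_nat_ceil_atTop.comp (hn.const_mul_atTop hr0))
  have h2 := hτ.add ((hpow.const_mul (2 ^ H : ℝ)).const_mul (ℓ : ℝ))
  simp only [mul_zero, add_zero] at h2
  have h3 := ((h.tendsto_ratio_mul_pow hμ hG hD hβ hδ hδ' hr).const_mul
    (avgDegree Λ)).const_mul (2 ^ H : ℝ)
  simp only [mul_zero] at h3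
  filter_upwards [h2.eventually (gt_mem_nhds (half_pos hθ)),
    h3.eventually (gt_mem_nhds (half_pos hθ)), (h.tendsto_n hD hβ hδ).eventually_gt_atTop 0,
    (h.tendsto_N hμ hG).eventually_ge_atTop Λ.natDegree] with t h4 h5 hnt hNt A hA i
  refine le_trans (expect_expect_badReach_le (e₀ := ⌈r * n t⌉₊)
    (τ := 1 / ((2 * (2 : ℝ)⁻¹ ^ T - r) ^ 2 * n t)) hΛ hNt (by exact_mod_cast hHr : 0 < H)
    (by positivity) hρ0 (fun u hu huT => ?_) hA ℓ (θ := θ) ?_ ?_ i) hFθ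
  · refine binomExpect_ind_lt_le hnt hrT ?_ (by positivity) (unanimousProb_le_one hu)
    exact mul_le_mul_of_nonneg_left
      (pow_le_pow_of_le_one (by norm_num) (by norm_num) huT) two_pos.le
  · have : ρ / H ≤ (ρ + ℓ) / H := by gcongr; linarith [(Nat.cast_nonneg ℓ : (0 : ℝ) ≤ ℓ)]
    linarith
  · have : (ℓ : ℝ) * (1 / H) ≤ (ρ + ℓ) / H := by
      rw [mul_one_div]
      gcongr
      linarith
    rw [mul_add]
    linarith

/-- The packet loss rate vanishes if density evolution with threshold `T` converges to zero, where
up to `T` messages can be resolved in a slot. -/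
lemma vanishingLoss_of_tendsto_slotEvolution (hμ : 0 < μ) (hμ' : μ ≤ 1) (hG : 0 < G) (hD : 0 < D)
    (hβ : 1 ≤ β) (hδ : 0 < δ) (hδ' : δ < 1) (hΛ : IsDegreeDistribution Λ) {T : ℕ}
    (hT : (1 - δ) / β < 2 * (2 : ℝ)⁻¹ ^ T)
    (hev : Tendsto (slotEvolution T Λ G) atTop (𝓝 0)) :
    VanishingLoss (1 / 2) μ Λ D β δ G := by
  intro K M N n h
  have hnonneg : ∀ t, 0 ≤ packetLossRate (1 / 2) μ Λ (K t) (M t) (N t) (n t) := by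
    intro t
    have h1 : 0 ≤ 1 - μ := by linarith
    refine Finset.sum_nonneg fun a _ => Finset.sum_nonneg fun w _ =>
      Finset.sum_nonneg fun cb _ => ?_
    refine mul_nonneg (mul_nonneg (mul_nonneg (by positivity) (selectionProb_nonneg w)) ?_)
      (div_nonneg (Nat.cast_nonneg _) (Nat.cast_nonneg _))
    refine Finset.prod_nonneg fun i _ => mul_nonneg (Finset.prod_nonneg fun j _ => ?_)
      (slotLaw_nonneg hΛ _)
    split_ifs <;> norm_num
  have key : ∀ ε > 0, ∀ᶠ t in atTop,
      packetLossRate (1 / 2) μ Λ (K t) (M t) (N t) (n t) ≤ 4 * ε := by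
    intro ε hε
    obtain ⟨ℓ, hℓ⟩ := (hev.eventually (gt_mem_nhds hε)).exists
    obtain ⟨N₀, r, hr, hblock⟩ := exists_of_eventually_loadFilter
      (eventually_expect_userBlocked_le (T := T) hΛ hG.le ℓ hε)
    have hload := (h.tendsto_slots_div_users hμ hG).inv₀ (by positivity)
    rw [inv_div] at hload
    have hload' : Tendsto (fun t => μ * ((N t : ℝ) / K t)⁻¹) atTop (𝓝 G) := by
      have := hload.const_mul μ
      rwa [mul_div_cancel₀ _ hμ.ne'] at this
    set c := r / 2 / (2 * (G / μ)) with hc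
    have hc0 : 0 < c := by positivity
    have hK := h.tendsto_K_real
    have hcheb : Tendsto (fun t => 1 / (c ^ 2 * K t)) atTop (𝓝 0) := by
      have := (hK.const_mul_atTop (r := c ^ 2) (by positivity)).inv_tendsto_atTop
      exact this.congr fun t => by simp
    have hκ : 0 ≤ avgDegree Λ := zero_le_one.trans (one_le_avgDegree hΛ)
    have hρ0 : 0 ≤ (G + r) * avgDegree Λ := by positivity
    filter_upwards [h.eventually_expect_badReach_le hμ hG hD hβ hδ hδ' hΛ hT hρ0 ℓ hε,
      hcheb.eventually (gt_mem_nhds hε), hload.eventually (gt_mem_nhds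
        (show G / μ < 2 * (G / μ) by have : 0 < G / μ := by positivity
                                     linarith)),
      hload'.eventually (Metric.ball_mem_nhds G (half_pos hr)), h.tendsto_K.eventually_gt_atTop 0,
      (h.tendsto_N hμ hG).eventually_ge_atTop (max N₀ (Λ.natDegree + 1)),
      (h.tendsto_M hD hδ).eventually_ge_atTop ℓ] with t hbad hch hl hl' hKt hNt hMt
    rw [max_le_iff] at hNt
    have hKr : (0 : ℝ) < K t := by exact_mod_cast hKt
    have hNr : (0 : ℝ) < N t := by exact_mod_cast (show 0 < N t by omega)
    rw [Real.dist_eq, inv_div] at hl'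
    rw [inv_div] at hl
    have hY0 := (slotEvolution_mem (T := T) hΛ hG.le ℓ).1
    refine (packetLossRate_le hΛ (by omega) hμ.le hμ' hKt hc0
      (Y := slotEvolution T Λ G ℓ + ε + ε) (by positivity) fun A hA => ?_).trans (by linarith)
    have hAload : |(A.card : ℝ) / N t - G| < r := by
      have h1 : (A.card : ℝ) / N t - G
          = ((A.card : ℝ) / K t - μ) * (K t / N t) + (μ * (K t / N t) - G) := by
        field_simp
        ring
      rw [h1]
      refine (abs_add_le _ _).trans_lt ?_
      rw [abs_mul, abs_of_pos (show (0 : ℝ) < K t / N t by positivity)]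
      have h2 : |(A.card : ℝ) / K t - μ| * (K t / N t) ≤ c * (2 * (G / μ)) := by
        gcongr
      have h3 : c * (2 * (G / μ)) = r / 2 := by
        rw [hc]
        field_simp
      linarith
    have hAρ : A.card * (avgDegree Λ / N t) ≤ (G + r) * avgDegree Λ := by
      rw [mul_div_assoc', mul_div_right_comm]
      refine mul_le_mul_of_nonneg_right ?_ hκ
      linarith [(abs_lt.1 hAload).2]
    exact sum_codebookProb_mul_lossFraction_le hΛ (by omega) hMt (by positivity)
      (hblock A.card (N t) hNt.1 hAload (M t) A rfl) (fun i _ => hbad A hAρ i)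
  rw [Metric.tendsto_atTop]
  intro ε hε
  obtain ⟨t₀, ht₀⟩ := eventually_atTop.1 (key (ε / 8) (by positivity))
  refine ⟨t₀, fun t ht => ?_⟩
  rw [Real.dist_eq, sub_zero, abs_of_nonneg (hnonneg t)]
  linarith [ht₀ t ht]

/-- All loads up to one that satisfies the density evolution inequality are below the threshold. -/
lemma iSup_densityEvolution_le_decodingThreshold (hμ : 0 < μ) (hμ' : μ ≤ 1) (hD : 0 < D)
    (hβ : 1 ≤ β) (hδ : 0 < δ) (hδ' : δ < 1) (hΛ : IsDegreeDistribution Λ) :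
    (⨆ G ∈ {G : ℝ | 0 < G ∧ DensityEvolution μ Λ D β δ G}, ENNReal.ofReal G) ≤
      decodingThreshold (1 / 2) μ Λ D β δ := by
  refine biSup_mono fun G hG => ?_
  obtain ⟨hG0, hG⟩ := hG
  refine ⟨hG0, fun ρ hρ hρG => ?_⟩
  have hT := one_le_tBar hβ hδ hδ'
  exact vanishingLoss_of_tendsto_slotEvolution hμ hμ' hρ hD hβ hδ hδ' hΛ
    (lt_of_le_critDegree hβ hδ hδ' (le_critDegree_of_le_tBar hβ hδ hδ' le_rfl))
    (tendsto_slotEvolution_zero hΛ hT hρ fun p hp hp1 =>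
      edgePoly_poissonTail_lt hΛ hμ hD hG0 hG hρ hρG hp hp1)

end Vanishing

/-! ### The central limit theorem for the binomial distribution -/

section CentralLimit

open MeasureTheory ProbabilityTheory

variable {p : ℝ}

lemma integral_binomial_eq (n : ℕ) (p : unitInterval) {E : Type*} [NormedAddCommGroup E]
    [NormedSpace ℝ E] [CompleteSpace E] (f : ℕ → E) :
    ∫ e, f e ∂(binomial n p) = ∑ e ∈ Finset.range (n + 1),
      ((n.choose e : ℝ) * (p : ℝ) ^ e * (1 - (p : ℝ)) ^ (n - e)) • f e := by
  rw [integral_binomial, Nat.range_succ_eq_Iic]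

/-- The characteristic function of a normalized Bernoulli random variable. -/
lemma charFun_bernoulli (p : unitInterval) (σ s : ℝ) :
    charFun ((binomial 1 p).map fun e : ℕ => ((e : ℝ) - p) / σ) s
      = p * Complex.exp ((s * (1 - p) / σ : ℝ) * Complex.I)
        + (1 - p) * Complex.exp ((-(s * p / σ) : ℝ) * Complex.I) := by
  rw [charFun_apply_real, integral_map (by fun_prop) (by fun_prop), integral_binomial_eq]
  simp only [Finset.sum_range_succ, Finset.sum_range_zero, Complex.real_smul]
  norm_num
  rw [add_comm]
  congr 2
  · congr 1
    ring
  · congr 1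
    ring

/-- The characteristic function of a shifted and rescaled binomial random variable. -/
lemma charFun_binomial (p : unitInterval) (σ r a t : ℝ) (n : ℕ) :
    charFun ((binomial n p).map fun e : ℕ => r * (((e : ℝ) - n * p - a) / σ)) t
      = Complex.exp ((-(t * (r * a) / σ) : ℝ) * Complex.I) *
        (charFun ((binomial 1 p).map fun e : ℕ => ((e : ℝ) - p) / σ) (r * t)) ^ n := by
  rw [charFun_bernoulli, charFun_apply_real, integral_map (by fun_prop) (by fun_prop),
    integral_binomial_eq, add_pow, Finset.mul_sum]
  refine Finset.sum_congr rfl fun e he => ?_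
  have he' : e ≤ n := Nat.lt_succ_iff.1 (Finset.mem_range.1 he)
  rw [Complex.real_smul, mul_pow, mul_pow, ← Complex.exp_nat_mul, ← Complex.exp_nat_mul]
  have h1 : Complex.exp (t * ((r * (((e : ℝ) - n * p - a) / σ) : ℝ) : ℂ) * Complex.I)
      = Complex.exp ((-(t * (r * a) / σ) : ℝ) * Complex.I) *
        Complex.exp (e * ((r * t * (1 - p) / σ : ℝ) * Complex.I)) *
        Complex.exp ((n - e : ℕ) * ((-(r * t * p / σ) : ℝ) * Complex.I)) := by
    rw [← Complex.exp_add, ← Complex.exp_add]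
    congr 1
    push_cast [Nat.cast_sub he']
    ring
  rw [h1]
  push_cast
  ring

lemma gaussianReal_Ici_zero : (gaussianReal 0 1).real (Set.Ici 0) = 1 / 2 := by
  have hna : NullSingletonClass (gaussianReal 0 1) := nullSingletonClass_gaussianReal one_ne_zero
  have h1 : (gaussianReal 0 1).real (Set.Iic 0) = (gaussianReal 0 1).real (Set.Ici 0) := by
    have h : (gaussianReal 0 1).map (fun x => -x) = gaussianReal 0 1 := by
      rw [gaussianReal_map_neg, neg_zero]
    conv_lhs => rw [← h]
    rw [map_measureReal_apply measurable_neg measurableSet_Iic]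
    congr 1
    ext x
    simp
  have h2 := probReal_add_probReal_compl (μ := gaussianReal 0 1) (measurableSet_Ici (a := (0 : ℝ)))
  rw [Set.compl_Ici, measureReal_congr Iio_ae_eq_Iic, h1] at h2
  linarith

/-- A binomial random variable exceeds its mean, up to `o(√n)`, with probability tending to one
half. -/
lemma tendsto_binomExpect_ind_le (hp0 : 0 < p) (hp1 : p < 1) {a : ℕ → ℝ}
    (ha : Tendsto (fun n : ℕ => (√(n : ℝ))⁻¹ * a n) atTop (𝓝 0)) :
    Tendsto (fun n => binomExpect n p (fun e => ind (p * n + a n ≤ e))) atTop (𝓝 (1 / 2)) := by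
  set q : unitInterval := ⟨p, hp0.le, hp1.le⟩ with hq
  set σ := √(p * (1 - p)) with hσ
  have hv : 0 < p * (1 - p) := mul_pos hp0 (by linarith)
  have hσ0 : 0 < σ := Real.sqrt_pos.2 hv
  have hσ2 : σ ^ 2 = p * (1 - p) := Real.sq_sqrt hv.le
  set ν : ℕ → Measure ℝ := fun n =>
    (binomial n q).map fun e : ℕ => (√(n : ℝ))⁻¹ * (((e : ℝ) - n * p - a n) / σ) with hν
  have hνp : ∀ n, IsProbabilityMeasure (ν n) := fun n =>
    Measure.isProbabilityMeasure_map (by fun_prop)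
  let γ : ProbabilityMeasure ℝ := ⟨gaussianReal 0 1, inferInstance⟩
  let ν' : ℕ → ProbabilityMeasure ℝ := fun n => ⟨ν n, hνp n⟩
  have hlim : Tendsto ν' atTop (𝓝 γ) := by
    rw [ProbabilityMeasure.tendsto_iff_tendsto_charFun]
    intro t
    have h0 : (binomial 1 q)[fun e : ℕ => ((e : ℝ) - p) / σ] = 0 := by
      rw [integral_binomial_eq]
      simp [Finset.sum_range_succ, hq]
      ring
    have h1 : (binomial 1 q)[(fun e : ℕ => ((e : ℝ) - p) / σ) ^ 2] = 1 := by
      rw [integral_binomial_eq]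
      simp only [Finset.sum_range_succ, Finset.sum_range_zero, Pi.pow_apply, div_pow, hσ2, hq]
      have hp' : 1 - p ≠ 0 := by linarith
      simp
      field_simp
      ring
    have h2 := tendsto_charFun_inv_sqrt_mul_pow (P := binomial 1 q) (by fun_prop) h0 h1 t
    have h3 : Tendsto (fun n : ℕ => Complex.exp
        ((-(t * ((√(n : ℝ))⁻¹ * a n) / σ) : ℝ) * Complex.I)) atTop (𝓝 1) := by
      have h4 : Tendsto (fun n : ℕ => -(t * ((√(n : ℝ))⁻¹ * a n) / σ)) atTop (𝓝 0) := by
        have := ((ha.const_mul t).div_const σ).neg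
        simpa using this
      have h5 : Continuous fun x : ℝ => Complex.exp ((x : ℝ) * Complex.I) := by fun_prop
      have h6 := (h5.tendsto 0).comp h4
      rwa [Complex.ofReal_zero, zero_mul, Complex.exp_zero] at h6
    have h4 := h3.mul h2
    rw [one_mul] at h4
    have h5 : charFun (gaussianReal 0 1) t = Complex.exp (-t ^ 2 / 2) := by
      simp [charFun_gaussianReal, neg_div]
    change Tendsto (fun n => charFun (ν n) t) atTop (𝓝 (charFun (gaussianReal 0 1) t))
    rw [h5]
    refine h4.congr fun n => ?_
    exact (charFun_binomial q σ _ (a n) t n).symm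
  have hfr : γ (frontier (Set.Ici (0 : ℝ))) = 0 := by
    have hna : NullSingletonClass (gaussianReal 0 1) := nullSingletonClass_gaussianReal one_ne_zero
    rw [frontier_Ici, ProbabilityMeasure.null_iff_toMeasure_null]
    exact measure_singleton (μ := gaussianReal 0 1) 0
  have h1 := ProbabilityMeasure.tendsto_measure_of_null_frontier_of_tendsto hlim hfr
  have h2 := (NNReal.continuous_coe.tendsto _).comp h1
  have h3 : ((γ (Set.Ici (0 : ℝ)) : NNReal) : ℝ) = 1 / 2 := gaussianReal_Ici_zero
  rw [h3] at h2
  refine h2.congr' ?_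
  filter_upwards [eventually_gt_atTop 0] with n hn
  have hnr : 0 < √(n : ℝ) := Real.sqrt_pos.2 (by exact_mod_cast hn)
  change (ν n).real (Set.Ici 0) = _
  rw [hν, map_measureReal_apply (by fun_prop) measurableSet_Ici,
    ← integral_indicator_one .of_discrete,
    integral_binomial_eq, binomExpect]
  refine Finset.sum_congr rfl fun e _ => ?_
  rw [smul_eq_mul]
  congr 1
  have hiff : e ∈ (fun e : ℕ => (√(n : ℝ))⁻¹ * (((e : ℝ) - n * p - a n) / σ)) ⁻¹' Set.Ici 0
      ↔ p * n + a n ≤ e := by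
    rw [Set.mem_preimage, Set.mem_Ici, mul_nonneg_iff_of_pos_left (by positivity),
      le_div_iff₀ hσ0, zero_mul]
    constructor <;> intro h <;> linarith
  by_cases h : p * n + a n ≤ e
  · rw [ind_of h, Set.indicator_of_mem (hiff.2 h), Pi.one_apply]
  · rw [ind_of_not h, Set.indicator_of_notMem (fun h' => h (hiff.1 h'))]

end CentralLimit

/-! ### The probability that a slot is resolved -/

section Resolve

variable {M N n : ℕ} {Λ : Polynomial ℝ}

lemma expect_comm {ι κ β γ : Type*} [Fintype ι] [DecidableEq ι] [Fintype κ] [DecidableEq κ]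
    [Fintype β] [Fintype γ] {w : β → ℝ} {v : γ → ℝ} (f : (ι → β) → (κ → γ) → ℝ) :
    expect w (fun x => expect v (fun y => f x y))
      = expect v (fun y => expect w (fun x => f x y)) := by
  simp only [expect, Finset.mul_sum]
  rw [Finset.sum_comm]
  refine Finset.sum_congr rfl fun y _ => Finset.sum_congr rfl fun x _ => by ring

/-- The event that all messages in `A` collide in slot `s` and are resolved, as a product over the
messages. -/
lemma ind_resolves (x : Fin M → Fin n → Bool) (S : Fin M → Finset (Fin N)) {A : Finset (Fin M)}
    (hA : A.Nonempty) (s : Fin N) :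
    ind ((∀ i ∈ A, s ∈ S i) ∧
      Resolves (fun i => (x i, S i)) s (slotSum (fun i => (x i, S i)) A s))
      = ∏ i, if i ∈ A then ind (s ∈ S i) else 1 - ind (s ∈ S i) * ind (Consistent x A i) := by
  by_cases h1 : ∀ i ∈ A, s ∈ S i
  · have hfilter : (A.filter fun i => s ∈ S i) = A := Finset.filter_true_of_mem h1
    have hiff : Resolves (fun i => (x i, S i)) s (slotSum (fun i => (x i, S i)) A s)
        ↔ ∀ m, s ∈ S m → Consistent x A m → m ∈ A := by
      rw [resolves_iff]
      simp only [hfilter]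
      exact and_iff_right hA
    by_cases h2 : ∀ m, s ∈ S m → Consistent x A m → m ∈ A
    · rw [ind_of ⟨h1, hiff.2 h2⟩, Finset.prod_eq_one]
      intro i _
      split_ifs with hi
      · exact ind_of (h1 i hi)
      · rw [← ind_and, ind_of_not (fun h => hi (h2 i h.1 h.2)), sub_zero]
    · rw [ind_of_not (fun h => h2 (hiff.1 h.2))]
      push Not at h2
      obtain ⟨m, hm, hc, hmA⟩ := h2
      rw [Finset.prod_eq_zero (Finset.mem_univ m)]
      rw [if_neg hmA, ind_of hm, ind_of hc]
      norm_num
  · rw [ind_of_not (fun h => h1 h.1)]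
    push Not at h1
    obtain ⟨i, hi, hsi⟩ := h1
    rw [Finset.prod_eq_zero (Finset.mem_univ i)]
    rw [if_pos hi, ind_of_not hsi]

lemma expect_ind_forall_mem (hΛ : IsDegreeDistribution Λ) (hN : Λ.natDegree ≤ N)
    (A : Finset (Fin M)) (s : Fin N) :
    expect (slotLaw Λ) (fun S : Fin M → Finset (Fin N) => ind (∀ i ∈ A, s ∈ S i))
      = (avgDegree Λ / N) ^ A.card := by
  have hlaw : IsLaw (slotLaw Λ : Finset (Fin N) → ℝ) := isLaw_slotLaw hΛ hN
  have h2 := expect_prod (w := (slotLaw Λ : Finset (Fin N) → ℝ))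
    (fun (i : Fin M) R => if i ∈ A then ind (s ∈ R) else 1)
  rw [expect_congr fun S => ind_forall_mem_eq_prod A fun i => s ∈ S i, h2]
  have h3 : ∀ i : Fin M, ∑ R : Finset (Fin N), slotLaw Λ R * (if i ∈ A then ind (s ∈ R) else 1)
      = if i ∈ A then avgDegree Λ / N else 1 := by
    intro i
    split_ifs
    · exact sum_slotLaw_mem hΛ hN s
    · simp [hlaw.sum_eq_one]
  simp only [h3]
  rw [Finset.prod_ite_mem, Finset.univ_inter, Finset.prod_const]

/-- The probability that the messages in `A` collide in slot `s` and are resolved: each of the other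
messages is in the slot with probability `q`, and is then discarded unless it is consistent. -/
lemma expect_ind_resolves (hΛ : IsDegreeDistribution Λ) (hN : Λ.natDegree ≤ N)
    {A : Finset (Fin M)} (hA : A.Nonempty) (s : Fin N) :
    expect (slotLaw Λ) (fun S : Fin M → Finset (Fin N) => expect (bitLaw n) (fun x =>
      ind ((∀ i ∈ A, s ∈ S i) ∧
        Resolves (fun i => (x i, S i)) s (slotSum (fun i => (x i, S i)) A s))))
      = (avgDegree Λ / N) ^ A.card * binomExpect n (2 * (2 : ℝ)⁻¹ ^ A.card)
        (fun e => (1 - avgDegree Λ / N * (2 : ℝ)⁻¹ ^ e) ^ (M - A.card)) := by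
  have hlaw : IsLaw (slotLaw Λ : Finset (Fin N) → ℝ) := isLaw_slotLaw hΛ hN
  have hbit := isLaw_bitLaw n
  set q := avgDegree Λ / N with hq
  rw [expect_comm]
  have h1 : ∀ x : Fin M → Fin n → Bool, expect (slotLaw Λ) (fun S : Fin M → Finset (Fin N) =>
      ind ((∀ i ∈ A, s ∈ S i) ∧
        Resolves (fun i => (x i, S i)) s (slotSum (fun i => (x i, S i)) A s)))
      = q ^ A.card * ∏ i ∈ Aᶜ, (1 - q * ind (∀ (j : Fin n) (b : Bool),
        (∀ k ∈ A, x k j = b) → x i j = b)) := by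
    intro x
    rw [expect_congr fun S => ind_resolves x S hA s]
    have h2 := expect_prod (w := (slotLaw Λ : Finset (Fin N) → ℝ)) (fun (i : Fin M) R =>
      if i ∈ A then ind (s ∈ R) else 1 - ind (s ∈ R) * ind (Consistent x A i))
    rw [h2]
    have h3 : ∀ i : Fin M, ∑ R : Finset (Fin N), slotLaw Λ R *
        (if i ∈ A then ind (s ∈ R) else 1 - ind (s ∈ R) * ind (Consistent x A i))
        = if i ∈ A then q else 1 - q * ind (Consistent x A i) := by
      intro i
      split_ifs
      · exact sum_slotLaw_mem hΛ hN s
      · simp only [mul_sub, mul_one, ← mul_assoc]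
        rw [Finset.sum_sub_distrib, ← Finset.sum_mul, sum_slotLaw_mem hΛ hN, hlaw.sum_eq_one]
    simp only [h3]
    rw [Finset.prod_ite, Finset.prod_const]
    congr 2
    · congr 1
      ext i
      simp
    · ext i
      simp
  rw [expect_congr h1, expect_const_mul]
  congr 1
  have h4 := expect_mul_prod_coord hbit A Aᶜ disjoint_compl_right (χ := fun _ => 1)
    (φ := fun x c => 1 - q * ind (∀ (j : Fin n) (b : Bool), (∀ k ∈ A, x k j = b) → c j = b))
    (fun _ _ _ _ => rfl) (fun i hi x c => by
      have h : ∀ k ∈ A, Function.update x i c k = x k := fun k hk =>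
        Function.update_of_ne (by rintro rfl; exact hi hk) _ _
      funext d
      congr 2
      refine ind_congr (forall₂_congr fun j b => ?_)
      rw [forall₂_congr fun k hk => by rw [h k hk]])
  simp only [one_mul] at h4
  rw [h4, ← expect_card_unanimous hA]
  refine expect_congr fun x => ?_
  have h5 : ∑ c, bitLaw n c * (1 - q * ind (∀ (j : Fin n) (b : Bool),
      (∀ k ∈ A, x k j = b) → c j = b)) = 1 - q * (2 : ℝ)⁻¹ ^ (unanimous x A).card := by
    simp only [mul_sub, mul_one]
    rw [Finset.sum_sub_distrib, hbit.sum_eq_one, ← sum_bitLaw_consistent hA, Finset.mul_sum]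
    congr 1
    exact Finset.sum_congr rfl fun c _ => by ring
  rw [h5, Finset.card_compl, Fintype.card_fin]

/-- If the `U` colliding messages are unanimous in `e` positions, then each of the others survives
in the slot with probability `q * 2 ^ (-e)`, independently, where `q` is the probability that it is
placed there. -/
lemma resolveProb_eq (hΛ : IsDegreeDistribution Λ) (hN : Λ.natDegree ≤ N) {U : ℕ} (hU : 1 ≤ U)
    (hUM : U ≤ M) : resolveProb (1 / 2) Λ M N n U
      = binomExpect n (2 * (2 : ℝ)⁻¹ ^ U)
        (fun e => (1 - avgDegree Λ / N * (2 : ℝ)⁻¹ ^ e) ^ (M - U)) := by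
  have hN0 : 0 < N := lt_of_lt_of_le hΛ.natDegree_pos hN
  have hq : 0 < avgDegree Λ / N :=
    div_pos (zero_lt_one.trans_le (one_le_avgDegree hΛ)) (by exact_mod_cast hN0)
  rw [resolveProb]
  set A : Finset (Fin M) := Finset.univ.filter (fun i => i.val < U) with hA
  have hcard : A.card = U := by
    rw [hA, Fin.card_filter_val_lt, min_eq_right hUM]
  have hAne : A.Nonempty := Finset.card_pos.1 (by omega)
  have hnum : ∀ s : Fin N, (∑ cb : Codebook M N n,
      if (∀ i ∈ A, s ∈ (cb i).2) ∧ Resolves cb s (slotSum cb A s)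
        then codebookProb (1 / 2) Λ cb else 0)
      = (avgDegree Λ / N) ^ U * binomExpect n (2 * (2 : ℝ)⁻¹ ^ U)
        (fun e => (1 - avgDegree Λ / N * (2 : ℝ)⁻¹ ^ e) ^ (M - U)) := by
    intro s
    rw [← hcard, ← expect_ind_resolves hΛ hN hAne s]
    refine Eq.trans ?_ (sum_codebookProb_mul Λ (fun cb : Codebook M N n =>
      ind ((∀ i ∈ A, s ∈ (cb i).2) ∧ Resolves cb s (slotSum cb A s))))
    exact Finset.sum_congr rfl fun cb _ => by rw [ite_eq_ind_mul, mul_comm]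
  have hden : ∀ s : Fin N, (∑ cb : Codebook M N n,
      if ∀ i ∈ A, s ∈ (cb i).2 then codebookProb (1 / 2) Λ cb else 0)
      = (avgDegree Λ / N) ^ U := by
    intro s
    have h1 : ∀ cb : Codebook M N n,
        (if ∀ i ∈ A, s ∈ (cb i).2 then codebookProb (1 / 2) Λ cb else 0)
          = codebookProb (1 / 2) Λ cb * ind (∀ i ∈ A, s ∈ (cb i).2) := fun cb => by
      rw [ite_eq_ind_mul, mul_comm]
    rw [Finset.sum_congr rfl fun cb _ => h1 cb, sum_codebookProb_mul]
    simp only [expect_const (isLaw_bitLaw n)]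
    rw [expect_ind_forall_mem hΛ hN, hcard]
  simp only [hnum, hden]
  rw [Finset.sum_const, Finset.sum_const, nsmul_eq_mul, nsmul_eq_mul, Finset.card_univ,
    Fintype.card_fin]
  have : (N : ℝ) ≠ 0 := by positivity
  field_simp

end Resolve

section Limit

variable {μ G D β δ : ℝ} {K M N n : ℕ → ℕ} {Λ : Polynomial ℝ}

/-- A window around the critical number `x n` of unanimous positions, which is wide enough for the
decoder to succeed above it and to fail below it, but negligible on the scale `√n` of the
fluctuations of a binomial random variable. -/
def window (n : ℕ) : ℝ := √√(n : ℝ)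

lemma tendsto_window : Tendsto window atTop atTop :=
  Real.tendsto_sqrt_atTop.comp (Real.tendsto_sqrt_atTop.comp tendsto_natCast_atTop_atTop)

lemma tendsto_inv_sqrt_mul_window :
    Tendsto (fun n : ℕ => (√(n : ℝ))⁻¹ * window n) atTop (𝓝 0) := by
  refine tendsto_window.inv_tendsto_atTop.congr fun n => ?_
  rcases n.eq_zero_or_pos with rfl | hn
  · simp [window]
  have h : √(n : ℝ) = √√(n : ℝ) * √√(n : ℝ) := (Real.mul_self_sqrt (Real.sqrt_nonneg _)).symm
  have h0 : 0 < √√(n : ℝ) := Real.sqrt_pos.2 (Real.sqrt_pos.2 (by exact_mod_cast hn))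
  simp only [window, Pi.inv_apply]
  rw [← div_eq_inv_mul, eq_div_iff (Real.sqrt_ne_zero'.2 (by exact_mod_cast hn)),
    inv_mul_eq_iff_eq_mul₀ h0.ne']
  exact h

/-- The decoder succeeds above the window and fails below it. -/
lemma Regime.tendsto_resolveProb (h : Regime μ G D β δ K M N n) (hμ : 0 < μ) (hG : 0 < G)
    (hD : 0 < D) (hβ : 1 ≤ β) (hδ : 0 < δ) (hδ' : δ < 1) (hΛ : IsDegreeDistribution Λ) {U : ℕ}
    (hU : 1 ≤ U) {l : ℝ}
    (h₁ : Tendsto (fun n : ℕ => binomExpect n (2 * (2 : ℝ)⁻¹ ^ U)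
      (fun e => ind ((1 - δ) / β * n + window n ≤ e))) atTop (𝓝 l))
    (h₂ : Tendsto (fun n : ℕ => binomExpect n (2 * (2 : ℝ)⁻¹ ^ U)
      (fun e => ind ((1 - δ) / β * n + -window n ≤ e))) atTop (𝓝 l)) :
    Tendsto (fun t => resolveProb (1 / 2) Λ (M t) (N t) (n t) U) atTop (𝓝 l) := by
  obtain ⟨C, hC⟩ := h.exists_abs_logb_sub_le hμ hG hD hβ hδ hδ'
  set x := (1 - δ) / β with hx
  have hκ : 0 < avgDegree Λ := zero_lt_one.trans_le (one_le_avgDegree hΛ)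
  have hn := h.tendsto_n hD hβ hδ
  have hw : Tendsto (fun t => window (n t)) atTop atTop := tendsto_window.comp hn
  have hp0 : (0 : ℝ) ≤ 2 * (2 : ℝ)⁻¹ ^ U := by positivity
  have hp1 := unanimousProb_le_one hU
  have hlog := Real.log_pos one_lt_two
  have hpow : Tendsto (fun t => (2 : ℝ) ^ (window (n t) - C)) atTop atTop := by
    have h1 := Real.tendsto_exp_atTop.comp
      ((tendsto_atTop_add_const_right atTop (-C) hw).const_mul_atTop hlog)
    refine h1.congr fun t => ?_
    rw [Real.rpow_def_of_pos two_pos]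
    rfl
  have hlow : Tendsto (fun t => avgDegree Λ * ((2 : ℝ) ^ (window (n t) - C))⁻¹) atTop (𝓝 0) := by
    have := hpow.inv_tendsto_atTop.const_mul (avgDegree Λ)
    rwa [mul_zero] at this
  have hup : Tendsto (fun t => Real.exp (-(avgDegree Λ / 2 * (2 : ℝ) ^ (window (n t) - C))))
      atTop (𝓝 0) :=
    Real.tendsto_exp_neg_atTop_nhds_zero.comp (hpow.const_mul_atTop (by positivity))
  have hlower := (h₁.comp hn).sub hlow
  have hupper := (h₂.comp hn).add hup
  rw [sub_zero] at hlower
  rw [add_zero] at hupper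
  -- `(M / N) 2 ^ (-e)` in terms of the distance from `e` to the critical value
  have hratio : ∀ᶠ t in atTop, ∀ e : ℕ,
      (x * n t + window (n t) ≤ e →
        (M t : ℝ) / N t * (2 : ℝ)⁻¹ ^ e ≤ ((2 : ℝ) ^ (window (n t) - C))⁻¹) ∧
      ((e : ℝ) ≤ x * n t + -window (n t) →
        (2 : ℝ) ^ (window (n t) - C) ≤ (M t : ℝ) / N t * (2 : ℝ)⁻¹ ^ e) := by
    filter_upwards [hC, (h.tendsto_M hD hδ).eventually_gt_atTop 0,
      (h.tendsto_N hμ hG).eventually_gt_atTop 0] with t ht hM hN e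
    have hMr : (0 : ℝ) < M t := by exact_mod_cast hM
    have hNr : (0 : ℝ) < N t := by exact_mod_cast hN
    have h4 : (M t : ℝ) / N t * (2 : ℝ)⁻¹ ^ e
        = (2 : ℝ) ^ (Real.logb 2 ((M t : ℝ) / N t) - e) := by
      rw [Real.rpow_sub two_pos, Real.rpow_logb two_pos (by norm_num) (by positivity),
        Real.rpow_natCast, inv_pow, div_eq_mul_inv _ ((2 : ℝ) ^ e)]
    rw [abs_le] at ht
    rw [h4, ← Real.rpow_neg two_pos.le]
    constructor <;> intro he <;> refine Real.rpow_le_rpow_of_exponent_le one_le_two ?_ <;> linarith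
  have hNd := (h.tendsto_N hμ hG).eventually_ge_atTop (Λ.natDegree + 1)
  have hMU := (h.tendsto_M hD hδ).eventually_ge_atTop (2 * U)
  have hq01 : ∀ t, Λ.natDegree + 1 ≤ N t → ∀ e : ℕ, 0 ≤ avgDegree Λ / N t * (2 : ℝ)⁻¹ ^ e ∧
      avgDegree Λ / N t * (2 : ℝ)⁻¹ ^ e ≤ 1 := by
    intro t hNt e
    refine ⟨by positivity, mul_le_one₀ ?_ (by positivity) (pow_le_one₀ (by norm_num) (by norm_num))⟩
    refine div_le_one_of_le₀ ((avgDegree_le hΛ).trans ?_) (Nat.cast_nonneg _)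
    exact_mod_cast (Nat.le_succ _).trans hNt
  refine tendsto_of_tendsto_of_tendsto_of_le_of_le' hlower hupper ?_ ?_
  · filter_upwards [hratio, hNd, hMU] with t ht hNt hMt
    rw [resolveProb_eq hΛ (by omega) hU (by omega), Function.comp_apply, sub_eq_add_neg,
      ← binomExpect_const (n := n t) (p := 2 * (2 : ℝ)⁻¹ ^ U)
        (-(avgDegree Λ * ((2 : ℝ) ^ (window (n t) - C))⁻¹)), ← binomExpect_add]
    refine binomExpect_mono hp0 hp1 fun e _ => ?_
    obtain ⟨hq0, hq1⟩ := hq01 t hNt e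
    have hnn : 0 ≤ (1 - avgDegree Λ / N t * (2 : ℝ)⁻¹ ^ e) ^ (M t - U) :=
      pow_nonneg (by linarith) _
    have hpos : 0 ≤ avgDegree Λ * ((2 : ℝ) ^ (window (n t) - C))⁻¹ := by positivity
    by_cases he : x * n t + window (n t) ≤ e
    · rw [ind_of he]
      have h6 := one_add_mul_le_pow (a := -(avgDegree Λ / N t * (2 : ℝ)⁻¹ ^ e)) (by linarith)
        (M t - U)
      rw [← sub_eq_add_neg] at h6
      refine le_trans ?_ h6
      have h7 : ((M t - U : ℕ) : ℝ) ≤ M t := by exact_mod_cast Nat.sub_le _ _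
      have h8 : ((M t - U : ℕ) : ℝ) * (avgDegree Λ / N t * (2 : ℝ)⁻¹ ^ e)
          ≤ avgDegree Λ * ((2 : ℝ) ^ (window (n t) - C))⁻¹ := by
        calc _ ≤ (M t : ℝ) * (avgDegree Λ / N t * (2 : ℝ)⁻¹ ^ e) := by gcongr
          _ = avgDegree Λ * ((M t : ℝ) / N t * (2 : ℝ)⁻¹ ^ e) := by ring
          _ ≤ _ := mul_le_mul_of_nonneg_left ((ht e).1 he) hκ.le
      rw [mul_neg]
      linarith
    · rw [ind_of_not he]
      linarith
  · filter_upwards [hratio, hNd, hMU] with t ht hNt hMt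
    rw [resolveProb_eq hΛ (by omega) hU (by omega), Function.comp_apply,
      ← binomExpect_const (n := n t) (p := 2 * (2 : ℝ)⁻¹ ^ U)
        (Real.exp (-(avgDegree Λ / 2 * (2 : ℝ) ^ (window (n t) - C)))), ← binomExpect_add]
    refine binomExpect_mono hp0 hp1 fun e _ => ?_
    obtain ⟨hq0, hq1⟩ := hq01 t hNt e
    by_cases he : x * n t + -window (n t) ≤ e
    · rw [ind_of he]
      have := pow_le_one₀ (n := M t - U)
        (show 0 ≤ 1 - avgDegree Λ / N t * (2 : ℝ)⁻¹ ^ e by linarith)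
        (by linarith)
      linarith [Real.exp_pos (-(avgDegree Λ / 2 * (2 : ℝ) ^ (window (n t) - C)))]
    · rw [ind_of_not he, zero_add]
      have h6 := Real.one_sub_le_exp_neg (avgDegree Λ / N t * (2 : ℝ)⁻¹ ^ e)
      refine (pow_le_pow_left₀ (by linarith) h6 _).trans ?_
      rw [← Real.exp_nat_mul, Real.exp_le_exp, mul_neg, neg_le_neg_iff]
      have h7 : (M t : ℝ) / 2 ≤ ((M t - U : ℕ) : ℝ) := by
        rw [Nat.cast_sub (by omega)]
        have : ((2 * U : ℕ) : ℝ) ≤ M t := by exact_mod_cast hMt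
        push_cast at this
        linarith
      calc _ ≤ avgDegree Λ / 2 * ((M t : ℝ) / N t * (2 : ℝ)⁻¹ ^ e) :=
            mul_le_mul_of_nonneg_left ((ht e).2 (not_le.1 he).le) (by positivity)
        _ = (M t : ℝ) / 2 * (avgDegree Λ / N t * (2 : ℝ)⁻¹ ^ e) := by ring
        _ ≤ _ := mul_le_mul_of_nonneg_right h7 hq0

lemma tendsto_inv_mul_shift {a : ℕ → ℝ}
    (ha : Tendsto (fun n : ℕ => (√(n : ℝ))⁻¹ * a n) atTop (𝓝 0)) :
    Tendsto (fun n : ℕ => (n : ℝ)⁻¹ * a n) atTop (𝓝 0) := by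
  have h1 := (Real.tendsto_sqrt_atTop.comp
    (tendsto_natCast_atTop_atTop (R := ℝ))).inv_tendsto_atTop.mul ha
  rw [zero_mul] at h1
  refine h1.congr fun n => ?_
  simp only [Pi.inv_apply, Function.comp_apply]
  rw [← mul_assoc, ← mul_inv, Real.mul_self_sqrt (Nat.cast_nonneg n)]

/-- The law of large numbers, below the mean. -/
lemma tendsto_binomExpect_ind_le_of_lt {p x : ℝ} (hp0 : 0 ≤ p) (hp1 : p ≤ 1) (hx : x < p)
    {a : ℕ → ℝ} (ha : Tendsto (fun n : ℕ => (√(n : ℝ))⁻¹ * a n) atTop (𝓝 0)) :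
    Tendsto (fun n => binomExpect n p (fun e => ind (x * n + a n ≤ e))) atTop (𝓝 1) := by
  obtain ⟨r, hxr, hrp⟩ := exists_between hx
  have h1 : Tendsto (fun n : ℕ => 1 - 1 / ((p - r) ^ 2 * n)) atTop (𝓝 1) := by
    have h2 := ((tendsto_natCast_atTop_atTop (R := ℝ)).const_mul_atTop
      (pow_pos (sub_pos.2 hrp) 2)).inv_tendsto_atTop.const_sub 1
    rw [sub_zero] at h2
    exact h2.congr fun n => by simp
  refine tendsto_of_tendsto_of_tendsto_of_le_of_le' h1 tendsto_const_nhds ?_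
    (Eventually.of_forall fun n => ?_)
  · filter_upwards [eventually_gt_atTop 0,
      (tendsto_inv_mul_shift ha).eventually (gt_mem_nhds (sub_pos.2 hxr))] with n hn han
    have hnr : (0 : ℝ) < n := by exact_mod_cast hn
    have h2 := binomExpect_ind_far_le hp0 hp1 hn (sub_pos.2 hrp)
    have h3 : 1 ≤ binomExpect n p (fun e => ind (x * n + a n ≤ e))
        + binomExpect n p (fun e => ind (p - r ≤ |(e : ℝ) / n - p|)) := by
      rw [← binomExpect_add]
      refine (binomExpect_const (n := n) (p := p) 1).symm.trans_le
        (binomExpect_mono hp0 hp1 fun e _ => ?_)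
      by_cases he : x * n + a n ≤ e
      · rw [ind_of he]
        linarith [ind_nonneg (p - r ≤ |(e : ℝ) / n - p|)]
      · have h4 : (e : ℝ) / n < r := by
          rw [div_lt_iff₀ hnr]
          rw [inv_mul_lt_iff₀ hnr] at han
          linarith [not_le.1 he]
        rw [ind_of_not he, zero_add, ind_of]
        rw [le_abs]
        right
        linarith
    linarith
  · exact (binomExpect_mono hp0 hp1 fun e _ => ind_le_one _).trans_eq (binomExpect_const 1)

/-- The law of large numbers, above the mean. -/
lemma tendsto_binomExpect_ind_le_of_gt {p x : ℝ} (hp0 : 0 ≤ p) (hp1 : p ≤ 1) (hx : p < x)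
    {a : ℕ → ℝ} (ha : Tendsto (fun n : ℕ => (√(n : ℝ))⁻¹ * a n) atTop (𝓝 0)) :
    Tendsto (fun n => binomExpect n p (fun e => ind (x * n + a n ≤ e))) atTop (𝓝 0) := by
  obtain ⟨r, hpr, hrx⟩ := exists_between hx
  have h1 : Tendsto (fun n : ℕ => 1 / ((r - p) ^ 2 * n)) atTop (𝓝 0) := by
    have h2 := ((tendsto_natCast_atTop_atTop (R := ℝ)).const_mul_atTop
      (pow_pos (sub_pos.2 hpr) 2)).inv_tendsto_atTop
    exact h2.congr fun n => by simp
  refine squeeze_zero' (Eventually.of_forall fun n =>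
    binomExpect_nonneg hp0 hp1 fun e _ => ind_nonneg _) ?_ h1
  filter_upwards [eventually_gt_atTop 0,
    (tendsto_inv_mul_shift ha).eventually (lt_mem_nhds (sub_neg.2 hrx))] with n hn han
  have hnr : (0 : ℝ) < n := by exact_mod_cast hn
  refine (binomExpect_mono hp0 hp1 fun e _ => ind_mono fun he => ?_).trans
    (binomExpect_ind_far_le hp0 hp1 hn (sub_pos.2 hpr))
  have h4 : r < (e : ℝ) / n := by
    rw [lt_div_iff₀ hnr]
    rw [lt_inv_mul_iff₀ hnr] at han
    linarith
  rw [le_abs]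
  left
  linarith

/-- The limit of the probability that a slot with `U` messages is resolved. -/
lemma Regime.exists_tendsto_resolveProb (h : Regime μ G D β δ K M N n) (hμ : 0 < μ) (hG : 0 < G)
    (hD : 0 < D) (hβ : 1 ≤ β) (hδ : 0 < δ) (hδ' : δ < 1) (hΛ : IsDegreeDistribution Λ) {U : ℕ}
    (hU : 1 ≤ U) :
    ∃ l, Tendsto (fun t => resolveProb (1 / 2) Λ (M t) (N t) (n t) U) atTop (𝓝 l) ∧ 0 ≤ l ∧
      ((1 - δ) / β < 2 * (2 : ℝ)⁻¹ ^ U → l = 1) := by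
  have hw := tendsto_inv_sqrt_mul_window
  have hw' : Tendsto (fun n : ℕ => (√(n : ℝ))⁻¹ * -window n) atTop (𝓝 0) := by
    simpa using hw.neg
  have hp0 : (0 : ℝ) < 2 * (2 : ℝ)⁻¹ ^ U := by positivity
  have hp1 := unanimousProb_le_one hU
  rcases lt_trichotomy ((1 - δ) / β) (2 * (2 : ℝ)⁻¹ ^ U) with hx | hx | hx
  · exact ⟨1, h.tendsto_resolveProb hμ hG hD hβ hδ hδ' hΛ hU
      (tendsto_binomExpect_ind_le_of_lt hp0.le hp1 hx hw)
      (tendsto_binomExpect_ind_le_of_lt hp0.le hp1 hx hw'), zero_le_one, fun _ => rfl⟩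
  · have hx1 : (1 - δ) / β < 1 := by
      rw [div_lt_one (by linarith)]
      linarith
    refine ⟨1 / 2, h.tendsto_resolveProb hμ hG hD hβ hδ hδ' hΛ hU ?_ ?_, by norm_num,
      fun h' => absurd hx h'.ne⟩
    · rw [hx] at hx1 ⊢
      exact tendsto_binomExpect_ind_le hp0 hx1 hw
    · rw [hx] at hx1 ⊢
      exact tendsto_binomExpect_ind_le hp0 hx1 hw'
  · exact ⟨0, h.tendsto_resolveProb hμ hG hD hβ hδ hδ' hΛ hU
      (tendsto_binomExpect_ind_le_of_gt hp0.le hp1 hx hw)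
      (tendsto_binomExpect_ind_le_of_gt hp0.le hp1 hx hw'), le_rfl, fun h' => absurd hx h'.not_gt⟩

end Limit

end

end IRSA

theorem theorem2 (Λ : Polynomial ℝ) (hΛ : IRSA.IsDegreeDistribution Λ)
    (μ D β δ : ℝ) (hμ : 0 < μ) (hμ' : μ ≤ 1) (hD : 0 < D) (hβ : 1 ≤ β) (hδ : 0 < δ) (hδ' : δ < 1) :
    (∀ G : ℝ, 0 < G → ∀ K M N n : ℕ → ℕ, IRSA.Regime μ G D β δ K M N n →
      ∀ U : ℕ, 1 ≤ U → ∃ l : ℝ,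
        Tendsto (fun t => IRSA.resolveProb (1 / 2) Λ (M t) (N t) (n t) U) atTop (𝓝 l) ∧
          IRSA.piBar μ Λ G D β δ U ≤ l ∧ (U ≤ IRSA.tBar β δ → 0 < l)) ∧
    (⨆ G ∈ {G : ℝ | 0 < G ∧ IRSA.DensityEvolution μ Λ D β δ G}, ENNReal.ofReal G) ≤
      IRSA.decodingThreshold (1 / 2) μ Λ D β δ := by
  refine ⟨fun G hG K M N n h U hU => ?_,
    IRSA.iSup_densityEvolution_le_decodingThreshold hμ hμ' hD hβ hδ hδ' hΛ⟩
  obtain ⟨l, hl, hl0, hl1⟩ := h.exists_tendsto_resolveProb hμ hG hD hβ hδ hδ' hΛ hU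
  refine ⟨l, hl, ?_, fun hUT => ?_⟩
  · by_cases hc : IRSA.critDegree β δ < U
    · rwa [IRSA.piBar, if_pos hc]
    · rw [hl1 (IRSA.lt_of_le_critDegree hβ hδ hδ' (not_lt.1 hc))]
      exact IRSA.piBar_le_one hΛ hμ hG hD β δ U
  · rw [hl1 (IRSA.lt_of_le_critDegree hβ hδ hδ' (IRSA.le_critDegree_of_le_tBar hβ hδ hδ' hUT))]
    exact one_pos
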